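/- **Setting.** Four parties $A,B,C,D$ share a pure state $|\vec x\rangle=\sqrt{x_0}\,|0000\rangle+\sqrt{x_A}\,|1000\rangle+\sqrt{x_B}\,|0100\rangle+\sqrt{x_C}\,|0010\rangle+\sqrt{x_D}\,|0001\rangle$, where $\vec x=(x_A,x_B,x_C,x_D)$ has non-negative entries with sum at most $1$ and $x_0=1-x_A-x_B-x_C-x_D$; in particular $W_4=(\tfrac14,\tfrac14,\tfrac14,\tfrac14)$. For a graph $\mathcal G$ on the parties, $P(\vec x,\mathcal G)$ is the supremum, over all LOCC protocols (local measurements, on systems of any finite dimension, chosen adaptively from all earlier outcomes, with any finite or an indefinite number of rounds), of the probability that the protocol halts with an EPR pair (up to local unitaries) shared by two parties joined by an edge of $\mathcal G$, in tensor product with a product state of the other parties. Configurations III are the graphs with edge sets $\{AB,CD\}$, $\{AB,BC,CD\}$ and $\{AB,BC,CD,AD\}$; configuration IV is the graph with edge set $\{AB,AC,AD,BC,BD\}$. * For $\mathcal G_{III}$ any of configurations III, let $n_1$ be a party with maximal component, $n_1'$ a party other than $n_1$, not joined to $n_1$, with the largest component among those, and $p,p'$ the other two parties. Put $$\tau(\vec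 x)=2x_p+2x_{p'}-2\frac{x_px_{p'}}{x_{n_1}}+\frac23\,\frac{x_px_{p'}x_{n_1'}}{x_{n_1}^2}.$$ * For $\mathcal G_{IV}$, let $n_1$ be a party with maximal component, $n_1'$ a party whose number of edges differs from that of $n_1$, with the largest component among those, and $e_2,e_3$ the other two parties, having 2 and 3 edges respectively. Put $$\Gamma(\vec x)=2x_{e_3}+(x_{e_2}+x_{n_1'})\Big(2-\frac{x_{e_3}}{x_{n_1}}\Big)-2\frac{x_{n_1'}x_{e_2}}{x_{n_1}}+\frac43\,\frac{x_{e_2}x_{e_3}x_{n_1'}}{x_{n_1}^2}$$ if $n_1$ has 3 edges, and $$\Gamma(\vec x)=2x_{n_1'}+2x_{e_3}-\frac{x_{n_1'}x_{e_3}}{x_{n_1}}+\frac{x_{e_2}x_{e_3}x_{n_1'}}{3x_{n_1}^2}$$ if $n_1$ has 2 edges. (Both functions are $0$ when $x_A=x_B=x_C=x_D=0$.) **The Least-Party-Out (LPO) protocol** for a state with $x_0=0$. At every stage $S$ is the set of parties with non-zero component, $\mathcal G$ is restricted to $S$, and the "equal or vanish" measurement of strength $t$ has the operators $\mathrm{diag}[\sqrt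 t,1]$ (outcome 1) and $\mathrm{diag}[\sqrt{1-t},0]$ (outcome 2). * *Phase II.* If some party of $S$ is isolated in $\mathcal G$: stop with failure if $|S|\le2$; otherwise an isolated party measures $\{\mathrm{diag}[1,0],\mathrm{diag}[0,1]\}$, and the protocol repeats Phase II after the first outcome and fails after the second. If no party is isolated and all components in $S$ are equal, go to Phase III. Otherwise choose a party $k$ with non-maximal component, joined to a party with maximal component if there is such a $k$; it performs the "equal or vanish" measurement of strength $x_k/\max_j x_j$, and Phase II is repeated. * *Phase III* (all components in $S$ equal). If $|S|\le2$, stop; this is a success if $|S|=2$ and the two parties are joined. Otherwise a party of $S$ with the least number of edges performs the "equal or vanish" measurement of some strength $\alpha_S\in[0,1)$. After outcome 1 go to Phase II, after outcome 2 repeat Phase III. **Theorem.** Let $\mathcal G_{III}$ be any of configurations III and $\mathcal G_{IV}$ be configuration IV. 1. For every $\vec x$, $P(\vec x,\mathcal G_{III})\le\tau(\vec x)$ and $P(\vec x,\mathcal G_{IV})\le\Gamma(\vec x)$. 2. Let $x_0=0$. However the choices of parties in the LPO protocol are made (by any rule that picks a party as a function of the set of admissible candidates), for every $\varepsilon>0$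 there is $\delta>0$ such that the LPO protocol with strengths $\alpha_S\in[1-\delta,1)$ succeeds with probability greater than $\tau(\vec x)-\varepsilon$ for $\mathcal G_{III}$, and greater than $\Gamma(\vec x)-\varepsilon$ for $\mathcal G_{IV}$. Consequently $P(\vec x,\mathcal G_{III})=\tau(\vec x)$ and $P(\vec x,\mathcal G_{IV})=\Gamma(\vec x)$. 3. For every $\varepsilon>0$, $\tfrac23-\varepsilon<P(W_4,\mathcal G_{III})\le\tfrac23$ and $\tfrac56-\varepsilon<P(W_4,\mathcal G_{IV})\le\tfrac56$. These statements hold for every admissible labelling $n_1,n_1',p,p'$ (respectively $n_1,n_1',e_2,e_3$). -/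

import Mathlib

open scoped NNReal ENNReal Matrix

noncomputable section

namespace RandomDistillation

/-! ### States and local operations -/

/-- (Unnormalised) pure states of `N` parties, each holding a system of dimension `n`. -/
abbrev StateVec (N n : ℕ) : Type := (Fin N → Fin n) → ℂ

/-- The squared norm of a state, i.e. the probability weight of an unnormalised state. -/
def weight {N n : ℕ} (ψ : StateVec N n) : ℝ≥0∞ := ENNReal.ofReal (∑ s, ‖ψ s‖ ^ 2)

/-- Party `k` applies the operator `M` to its own system. -/
def applyLocal {N n : ℕ} (k : Fin N) (M : Matrix (Fin n) (Fin n) ℂ) (ψ : StateVec N n) :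
    StateVec N n :=
  fun s => ∑ a, M (s k) a * ψ (Function.update s k a)

/-- The state `√x₀ |0…0⟩ + √x₁ |10…0⟩ + ⋯ + √x_N |0…01⟩`, `x₀ = 1 - ∑ xᵢ`; every qubit is embedded
in a local system of dimension `n ≥ 2` through the first two basis vectors. -/
def wState {N : ℕ} (n : ℕ) (x : Fin N → ℝ≥0) : StateVec N n := fun s =>
  if ∀ k, (s k : ℕ) = 0 then ((Real.sqrt (1 - ∑ i, (x i : ℝ)) : ℝ) : ℂ)
  else ∑ i, if (∀ k, (s k : ℕ) = if k = i then 1 else 0) then ((Real.sqrt (x i) : ℝ) : ℂ) else 0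

/-- The components of the standard state `W_N`. -/
def standardW (N : ℕ) : Fin N → ℝ≥0 := fun _ => 1 / (N : ℝ≥0)

/-- `ψ` is, up to a scalar and local unitaries, an EPR pair of the parties `i` and `j`, in tensor
product with a product state of all the other parties. -/
def IsEPR {N n : ℕ} (i j : Fin N) (ψ : StateVec N n) : Prop :=
  ∃ (c : ℂ) (u v : Fin 2 → EuclideanSpace ℂ (Fin n)) (φ : Fin N → Fin n → ℂ),
    Orthonormal ℂ u ∧ Orthonormal ℂ v ∧
    ψ = fun s => c * (∑ b, u b (s i) * v b (s j)) * ∏ k ∈ Finset.univ \ {i, j}, φ k (s k)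

/-- `ψ` is an EPR pair shared along some edge of the configuration graph. -/
def IsSuccess {N n : ℕ} (G : SimpleGraph (Fin N)) (ψ : StateVec N n) : Prop :=
  ∃ i j, G.Adj i j ∧ IsEPR i j ψ

/-! ### LOCC protocols -/

/-- What happens next in a protocol with classical memory `σ`: either the protocol halts, or party
`k` performs a complete local measurement with finitely many outcomes and announces the outcome,
upon which the classical memory is updated. -/
inductive Action (N n : ℕ) (σ : Type) : Type where
  | halt : Action N n σ
  | measure (k : Fin N) (m : ℕ) (K : Fin m → Matrix (Fin n) (Fin n) ℂ)
      (complete : ∑ l, (K l)ᴴ * K l = 1) (next : Fin m → σ) : Action N n σ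

/-- An LOCC protocol, with a finite or an indefinite number of rounds. The memory may in particular
hold the list of all earlier outcomes. -/
structure Protocol (N n : ℕ) (σ : Type) : Type where
  start : σ
  step : σ → Action N n σ

open scoped Classical in
/-- The contribution of a branch that halts in the (unnormalised) state `ψ`. -/
def haltValue {N n : ℕ} (G : SimpleGraph (Fin N)) (ψ : StateVec N n) : ℝ≥0∞ :=
  if IsSuccess G ψ then weight ψ else 0

/-- The probability that the protocol, in memory state `q` and quantum state `ψ`, halts in a success
state after at most `r` further measurements. -/
def successWithin {N n : ℕ} {σ : Type} (G : SimpleGraph (Fin N)) (p : Protocol N n σ) :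
    ℕ → σ → StateVec N n → ℝ≥0∞
  | 0, q, ψ =>
    match p.step q with
    | .halt => haltValue G ψ
    | .measure _ _ _ _ _ => 0
  | r + 1, q, ψ =>
    match p.step q with
    | .halt => haltValue G ψ
    | .measure k _ K _ next => ∑ l, successWithin G p r (next l) (applyLocal k (K l) ψ)

/-- The total probability that the protocol halts in a success state. -/
def successProb {N n : ℕ} {σ : Type} (G : SimpleGraph (Fin N)) (p : Protocol N n σ)
    (ψ : StateVec N n) : ℝ≥0∞ :=
  ⨆ r, successWithin G p r p.start ψ

/-- The optimal random distillation probability: the supremum over all LOCC protocols, on local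
systems of arbitrary finite dimension (qubits together with local ancillas). -/
def optimalProb {N : ℕ} (G : SimpleGraph (Fin N)) (x : Fin N → ℝ≥0) : ℝ≥0∞ :=
  ⨆ (n : ℕ) (_ : 2 ≤ n) (σ : Type) (p : Protocol N n σ), successProb G p (wState n x)

/-! ### The Least-Party-Out protocol -/

/-- The "equal or vanish" measurement operators `diag[√t, 1]` and `diag[√(1-t), 0]`. -/
def evKraus (t : ℝ≥0) : Fin 2 → Matrix (Fin 2) (Fin 2) ℂ :=
  ![Matrix.diagonal ![((Real.sqrt t : ℝ) : ℂ), 1],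
    Matrix.diagonal ![((Real.sqrt (1 - t) : ℝ) : ℂ), 0]]

theorem evKraus_complete {t : ℝ≥0} (ht : t ≤ 1) :
    ∑ l, (evKraus t l)ᴴ * evKraus t l = 1 := by
  have h1 : (0 : ℝ) ≤ 1 - t := sub_nonneg.2 (by exact_mod_cast ht)
  have h2 : ((Real.sqrt t : ℝ) : ℂ) * ((Real.sqrt t : ℝ) : ℂ) = ((t : ℝ) : ℂ) := by
    rw [← Complex.ofReal_mul, Real.mul_self_sqrt t.coe_nonneg]
  have h3 : ((Real.sqrt (1 - t) : ℝ) : ℂ) * ((Real.sqrt (1 - t) : ℝ) : ℂ) = 1 - ((t : ℝ) : ℂ) := by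
    rw [← Complex.ofReal_mul, Real.mul_self_sqrt h1]; simp
  ext i j
  fin_cases i <;> fin_cases j <;>
    simp [evKraus, Fin.sum_univ_two, Complex.conj_ofReal, h2, h3]

/-- The disentangling measurement operators `diag[1, 0]` and `diag[0, 1]`. -/
def removeKraus : Fin 2 → Matrix (Fin 2) (Fin 2) ℂ :=
  ![Matrix.diagonal ![1, 0], Matrix.diagonal ![0, 1]]

theorem removeKraus_complete : ∑ l, (removeKraus l)ᴴ * removeKraus l = 1 := by
  ext i j
  fin_cases i <;> fin_cases j <;> simp [removeKraus, Fin.sum_univ_two]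

/-- The classical memory of the protocol: the current phase and the current (unnormalised)
components of the state. The parties still entangled are those with a positive component, and the
current graph is the configuration graph restricted to them. -/
inductive LPOMemory (N : ℕ) : Type where
  | phaseII (x : Fin N → ℝ≥0)
  | phaseIII (x : Fin N → ℝ≥0)
  | failed

section LPO

variable {N : ℕ}

/-- The parties that still take part. -/
def parties (x : Fin N → ℝ≥0) : Finset (Fin N) := {k | 0 < x k}

/-- The largest component. -/
def maxComp (x : Fin N → ℝ≥0) : ℝ≥0 := Finset.univ.sup x

open scoped Classical in
/-- The number of edges of party `k` in the graph restricted to `S`. -/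
def edgesIn (G : SimpleGraph (Fin N)) (S : Finset (Fin N)) (k : Fin N) : ℕ :=
  (S.filter fun j => G.Adj k j).card

/-- The parties of `S` that are isolated in the graph restricted to `S`. -/
def isolated (G : SimpleGraph (Fin N)) (S : Finset (Fin N)) : Finset (Fin N) :=
  S.filter fun k => edgesIn G S k = 0

/-- The "least parties" of `S`: those with the least number of edges. -/
def leastParties (G : SimpleGraph (Fin N)) (S : Finset (Fin N)) : Finset (Fin N) :=
  S.filter fun k => ∀ j ∈ S, edgesIn G S k ≤ edgesIn G S j

/-- The parties with a non-maximal component. -/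
def nonMaximal (x : Fin N → ℝ≥0) : Finset (Fin N) :=
  (parties x).filter fun k => x k < maxComp x

open scoped Classical in
/-- The parties with a non-maximal component that are connected to a party whose component is
maximal. -/
def nonMaximalConnected (G : SimpleGraph (Fin N)) (x : Fin N → ℝ≥0) : Finset (Fin N) :=
  (nonMaximal x).filter fun k => ∃ j ∈ parties x, x j = maxComp x ∧ G.Adj k j

/-- The components after outcome "1" of the "equal or vanish" measurement by party `k`. -/
def afterEqual (x : Fin N → ℝ≥0) (k : Fin N) (t : ℝ≥0) : Fin N → ℝ≥0 :=
  fun j => if j = k then x j else t * x j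

/-- The components after outcome "2" of the "equal or vanish" measurement by party `k`. -/
def afterVanish (x : Fin N → ℝ≥0) (k : Fin N) (t : ℝ≥0) : Fin N → ℝ≥0 :=
  fun j => if j = k then 0 else (1 - t) * x j

/-- The "equal or vanish" measurement by party `k`. -/
def evAction (k : Fin N) (t : ℝ≥0) (ht : t ≤ 1) (equal vanish : LPOMemory N) :
    Action N 2 (LPOMemory N) :=
  .measure k 2 (evKraus t) (evKraus_complete ht) ![equal, vanish]

/-- A rule that resolves the free choices "choose some party such that …". -/
structure ChoiceRule (N : ℕ) where
  pick : Finset (Fin N) → Fin N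
  pick_mem : ∀ S : Finset (Fin N), S.Nonempty → pick S ∈ S

/-- Phase III, on a standard W state of the parties `parties x`: a least party measures with strength
`α`. After outcome "1" the "equal or vanish" subroutine follows, and after outcome "2" Phase III is
repeated without that party. -/
def stepIII (G : SimpleGraph (Fin N)) (c : ChoiceRule N)
    (α : Finset (Fin N) → Set.Iio (1 : ℝ≥0)) (x : Fin N → ℝ≥0) : Action N 2 (LPOMemory N) :=
  if (parties x).card ≤ 2 then .halt
  else
    let k := c.pick (leastParties G (parties x))
    let t := α (parties x)
    evAction k t (le_of_lt t.2) (.phaseII (afterEqual x k t)) (.phaseIII (afterVanish x k t))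

open scoped Classical in
/-- Phase II, the "equal or vanish" subroutine: isolated parties disentangle themselves; then, as
long as there are non-maximal components, some party with a non-maximal component, if possible one
connected to a party with maximal component, measures so that its component becomes maximal or
vanishes; once all components are equal, Phase III begins. -/
def stepII (G : SimpleGraph (Fin N)) (c : ChoiceRule N)
    (α : Finset (Fin N) → Set.Iio (1 : ℝ≥0)) (x : Fin N → ℝ≥0) : Action N 2 (LPOMemory N) :=
  if (isolated G (parties x)).Nonempty then
    if (parties x).card ≤ 2 then .halt
    else
      let k := c.pick (isolated G (parties x))
      .measure k 2 removeKraus removeKraus_complete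
        ![.phaseII (Function.update x k 0), .failed]
  else if nonMaximal x = ∅ then stepIII G c α x
  else
    let k := c.pick (if (nonMaximalConnected G x).Nonempty then nonMaximalConnected G x
      else nonMaximal x)
    let t := x k / maxComp x
    evAction k t (div_le_one_of_le₀ (Finset.le_sup (Finset.mem_univ k)) zero_le)
      (.phaseII (afterEqual x k t)) (.phaseII (afterVanish x k t))

/-- The Least-Party-Out protocol for a state with components `x` and `x₀ = 0`; the Phase III
measurement of a least party has strength `α S` when `S` is the set of parties that remain. -/
def lpo (G : SimpleGraph (Fin N)) (c : ChoiceRule N)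
    (α : Finset (Fin N) → Set.Iio (1 : ℝ≥0)) (x : Fin N → ℝ≥0) :
    Protocol N 2 (LPOMemory N) where
  start := .phaseII x
  step
    | .phaseII y => stepII G c α y
    | .phaseIII y => stepIII G c α y
    | .failed => .halt

/-- The success probability of the Least-Party-Out protocol. -/
def lpoProb (G : SimpleGraph (Fin N)) (c : ChoiceRule N)
    (α : Finset (Fin N) → Set.Iio (1 : ℝ≥0)) (x : Fin N → ℝ≥0) : ℝ≥0∞ :=
  successProb G (lpo G c α x) (wState 2 x)

end LPO

/-! ### The four-party configurations; the parties `A, B, C, D` are `0, 1, 2, 3` -/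

/-- Configurations III: the edge sets `{AB, CD}`, `{AB, BC, CD}` and `{AB, BC, CD, AD}`. -/
def configIII : Set (SimpleGraph (Fin 4)) :=
  {SimpleGraph.fromEdgeSet {s(0, 1), s(2, 3)},
   SimpleGraph.fromEdgeSet {s(0, 1), s(1, 2), s(2, 3)},
   SimpleGraph.fromEdgeSet {s(0, 1), s(1, 2), s(2, 3), s(0, 3)}}

/-- Configuration IV: all edges but `CD`. -/
def configIV : SimpleGraph (Fin 4) :=
  SimpleGraph.fromEdgeSet {s(0, 1), s(0, 2), s(0, 3), s(1, 2), s(1, 3)}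

/-- `n` has a maximal component, `n'` is a party unconnected to `n` with the largest component among
those, and `p`, `p'` are the other two parties. -/
structure TauLabelling (G : SimpleGraph (Fin 4)) (x : Fin 4 → ℝ≥0) (n n' p p' : Fin 4) : Prop where
  distinct : [n, n', p, p'].Nodup
  maximal : ∀ k, x k ≤ x n
  unconnected : ¬ G.Adj n n'
  largest : ∀ k, k ≠ n → ¬ G.Adj n k → x k ≤ x n'

/-- The value `τ(x)`, computed from a labelling as above (`0` when `x = 0`). -/
def tau (x : Fin 4 → ℝ≥0) (n n' p p' : Fin 4) : ℝ :=
  2 * x p + 2 * x p' - 2 * (x p * x p' / x n) + 2 / 3 * (x p * x p' * x n' / (x n : ℝ) ^ 2)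

/-- The number of edges of a party. -/
def edgeCount (G : SimpleGraph (Fin 4)) (k : Fin 4) : ℕ := (G.neighborSet k).ncard

/-- `n` has a maximal component, `n'` is a party edge complementary to `n` (with a different number of
edges) with the largest component among those, and `e₂`, `e₃` are the other two parties, with 2 and 3
edges. -/
structure GammaLabelling (G : SimpleGraph (Fin 4)) (x : Fin 4 → ℝ≥0) (n n' e₂ e₃ : Fin 4) :
    Prop where
  distinct : [n, n', e₂, e₃].Nodup
  maximal : ∀ k, x k ≤ x n
  complementary : edgeCount G n' ≠ edgeCount G n
  largest : ∀ k, edgeCount G k ≠ edgeCount G n → x k ≤ x n'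
  two_edges : edgeCount G e₂ = 2
  three_edges : edgeCount G e₃ = 3

/-- The value `Γ(x)`, computed from a labelling as above (`0` when `x = 0`). -/
def gammaValue (G : SimpleGraph (Fin 4)) (x : Fin 4 → ℝ≥0) (n n' e₂ e₃ : Fin 4) : ℝ :=
  if edgeCount G n = 3 then
    2 * x e₃ + (x e₂ + x n') * (2 - x e₃ / x n) - 2 * (x n' * x e₂ / x n)
      + 4 / 3 * (x e₂ * x e₃ * x n' / (x n : ℝ) ^ 2)
  else
    2 * x n' + 2 * x e₃ - x n' * x e₃ / x n + x e₂ * x e₃ * x n' / (3 * (x n : ℝ) ^ 2)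

end RandomDistillation

end

open RandomDistillation

/-! Upper bound. Local operators preserve the shape `wForm`: one product term plus `N` terms in
which a single site carries a different vector. Only the `N` weights `wComp` need to be recorded.
When party `k` measures, all other components are multiplied by one common factor. These factors sum
to 1 over the outcomes (degenerate cases aside), and component `k` is conserved in total. Hence a
non-negative function `f` of the components that is homogeneous of degree one and, in each single
coordinate, concave and non-decreasing cannot grow on average. Concavity is used as a supporting
line of non-negative slope at each point. An EPR pair on the edge `ij` weighs at most `2 min(xᵢ,
xⱼ)` (`weight_le_of_isEPR`), so if `f` also dominates these minima it bounds every protocol, in any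
dimension and with any number of rounds (`IsUpperPotential`).

Lower bound. The same `f` is attained by the Least-Party-Out protocol (`IsLowerPotential`). Up to
scaling, an "equal or vanish" measurement in Phase II moves component `k` to the maximum or to zero
with unchanged mean, and `f` is affine along that segment, so nothing is lost. Phase III pushes
component `k` beyond the maximum. At equal components the slope of `f` does not jump there for a
least party, so the loss is at most `2 (1 - α)² M`, with `M` the common component. Meanwhile the
pair sum `∑ min(yᵢ, yⱼ)` drops by at least `2 (1 - α) M`, so the total loss is at most `δ` times the
initial pair sum. A second potential, contracting by a fixed factor in every round, shows that
unfinished branches carry vanishing weight.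

It remains to see that `τ` and `Γ` are such functions. Each is given by a formula that depends on
which party is maximal; `PieceSystem` lists what these formulas must satisfy. Along a coordinate
line only two of them occur: typically an affine one until the component reaches the largest other
component `N`, then `C - D/t + E/t²`. By `hasSupport_of_glue` it suffices that `3 E ≤ D N` and that
the slope does not rise at `N`. If the identity of `n'` changes on the way, `τ` is a minimum of two
functions with supporting lines (`hasSupport_tauFun_of_distant`). -/

namespace RandomDistillation

variable {N n : ℕ}

/-! ### W-class states under local operators -/

/-- The squared norm of a vector. -/
noncomputable def normSqVec (v : Fin n → ℂ) : ℝ≥0 := ∑ x, ‖v x‖₊ ^ 2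

/-- The product of the local vectors `a k`. -/
def prodState (a : Fin N → Fin n → ℂ) : StateVec N n := fun s => ∏ k, a k (s k)

/-- The image of a W-class state under local operators: `c ⊗ₖ aₖ + ∑ᵢ bᵢ ⊗ₖ≠ᵢ aₖ`. -/
def wForm (c : ℂ) (a b : Fin N → Fin n → ℂ) : StateVec N n := fun s =>
  c * prodState a s + ∑ i, prodState (Function.update a i (b i)) s

/-- The components of the W-class state `wForm c a b`. -/
noncomputable def wComp (a b : Fin N → Fin n → ℂ) (i : Fin N) : ℝ≥0 :=
  ∏ k, normSqVec (Function.update a i (b i) k)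

theorem applyLocal_add (k : Fin N) (M : Matrix (Fin n) (Fin n) ℂ) (ψ χ : StateVec N n) :
    applyLocal k M (fun s => ψ s + χ s) = fun s => applyLocal k M ψ s + applyLocal k M χ s := by
  funext s
  simp [applyLocal, mul_add, Finset.sum_add_distrib]

theorem applyLocal_smul (k : Fin N) (M : Matrix (Fin n) (Fin n) ℂ) (c : ℂ) (ψ : StateVec N n) :
    applyLocal k M (fun s => c * ψ s) = fun s => c * applyLocal k M ψ s := by
  funext s
  simp only [applyLocal, Finset.mul_sum]
  exact Finset.sum_congr rfl fun _ _ => by ring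

theorem applyLocal_sum {ι : Type*} (t : Finset ι) (k : Fin N) (M : Matrix (Fin n) (Fin n) ℂ)
    (ψ : ι → StateVec N n) :
    applyLocal k M (fun s => ∑ i ∈ t, ψ i s) = fun s => ∑ i ∈ t, applyLocal k M (ψ i) s := by
  funext s
  simp only [applyLocal, Finset.mul_sum]
  exact Finset.sum_comm

theorem applyLocal_prodState (k : Fin N) (M : Matrix (Fin n) (Fin n) ℂ) (a : Fin N → Fin n → ℂ) :
    applyLocal k M (prodState a) = prodState (Function.update a k (M *ᵥ a k)) := by
  funext s
  simp only [applyLocal, prodState]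
  rw [← Finset.mul_prod_erase _ _ (Finset.mem_univ k), Function.update_self, Matrix.mulVec,
    dotProduct, Finset.sum_mul]
  refine Finset.sum_congr rfl fun x _ => ?_
  rw [← Finset.mul_prod_erase _ _ (Finset.mem_univ k), Function.update_self, mul_assoc]
  congr 2
  refine Finset.prod_congr rfl fun j hj => ?_
  have hj : j ≠ k := (Finset.mem_erase.1 hj).1
  rw [Function.update_of_ne hj, Function.update_of_ne hj]

/-- Each term is a product, so the operator acts on the site-`k` vectors alone. Orthogonality of `a
k` and `b k` is never required, hence no normal form has to be restored between measurements. -/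
theorem applyLocal_wForm (k : Fin N) (M : Matrix (Fin n) (Fin n) ℂ) (c : ℂ)
    (a b : Fin N → Fin n → ℂ) :
    applyLocal k M (wForm c a b) =
      wForm c (Function.update a k (M *ᵥ a k)) (Function.update b k (M *ᵥ b k)) := by
  unfold wForm
  rw [applyLocal_add, applyLocal_smul, applyLocal_sum]
  funext s
  simp only [applyLocal_prodState]
  congr 1
  refine Finset.sum_congr rfl fun i _ => ?_
  by_cases h : i = k
  · subst h; simp
  · rw [Function.update_of_ne h, Function.update_of_ne (Ne.symm h), Function.update_comm h]

/-- The weight of the factors of the `j`-th term of a W-class state held by parties other than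
`k`. -/
noncomputable def cofactor (a b : Fin N → Fin n → ℂ) (k j : Fin N) : ℝ≥0 :=
  ∏ l ∈ Finset.univ.erase k, normSqVec (Function.update a j (b j) l)

theorem wComp_eq (a b : Fin N → Fin n → ℂ) (k j : Fin N) :
    wComp a b j = normSqVec (if j = k then b k else a k) * cofactor a b k j := by
  rw [wComp, ← Finset.mul_prod_erase _ _ (Finset.mem_univ k), cofactor]
  congr 2
  by_cases h : j = k
  · subst h; simp
  · rw [Function.update_of_ne (Ne.symm h), if_neg h]

/-- Only the site-`k` factor changes; it comes from `b k` in the `k`-th term and from `a k` in all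
others. So a measurement rescales the components of the other parties by one common factor. -/
theorem wComp_update (a b : Fin N → Fin n → ℂ) (k j : Fin N) (M : Matrix (Fin n) (Fin n) ℂ) :
    wComp (Function.update a k (M *ᵥ a k)) (Function.update b k (M *ᵥ b k)) j =
      normSqVec (M *ᵥ (if j = k then b k else a k)) * cofactor a b k j := by
  rw [wComp_eq _ _ k, Function.update_self, Function.update_self, ← apply_ite (M *ᵥ ·)]
  congr 1
  refine Finset.prod_congr rfl fun l hl => ?_
  have hl : l ≠ k := (Finset.mem_erase.1 hl).1
  congr 1
  by_cases h : l = j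
  · subst h; simp [hl]
  · simp [h, hl]

/-- Completeness as a conservation law. Applied to `a k` it normalises the common rescaling factors;
applied to `b k` it conserves component `k`. -/
theorem sum_normSqVec_mulVec {m : ℕ} (K : Fin m → Matrix (Fin n) (Fin n) ℂ)
    (hK : ∑ l, (K l)ᴴ * K l = 1) (v : Fin n → ℂ) :
    ∑ l, normSqVec (K l *ᵥ v) = normSqVec v := by
  have key : ∀ w : Fin n → ℂ, ((normSqVec w : ℝ) : ℂ) = star w ⬝ᵥ w := by
    intro w
    simp only [normSqVec, dotProduct, NNReal.coe_sum, NNReal.coe_pow, coe_nnnorm,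
      Complex.ofReal_sum, Complex.ofReal_pow, Pi.star_apply, RCLike.star_def]
    exact Finset.sum_congr rfl fun x _ => (Complex.conj_mul' (w x)).symm
  have h : (((∑ l, normSqVec (K l *ᵥ v) : ℝ≥0) : ℝ) : ℂ) = ((normSqVec v : ℝ) : ℂ) := by
    rw [NNReal.coe_sum, Complex.ofReal_sum]
    simp only [key, Matrix.star_mulVec]
    have : star v ⬝ᵥ ((∑ l, (K l)ᴴ * K l) *ᵥ v) = star v ⬝ᵥ v := by rw [hK, Matrix.one_mulVec]
    rw [← this, Matrix.sum_mulVec, dotProduct_sum]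
    refine Finset.sum_congr rfl fun l _ => ?_
    rw [← Matrix.dotProduct_mulVec, Matrix.mulVec_mulVec]
  exact_mod_cast h

/-! ### Weights of sums of product states -/

theorem sum_star_prodState_mul (p q : Fin N → Fin n → ℂ) :
    ∑ s, star (prodState p s) * prodState q s = ∏ k, (star (p k) ⬝ᵥ q k) := by
  simp only [dotProduct, Finset.prod_univ_sum, Fintype.piFinset_univ, prodState, star_prod,
    Finset.prod_mul_distrib, Pi.star_apply]

theorem sum_norm_sq_prodState (p : Fin N → Fin n → ℂ) :
    ∑ s, ‖prodState p s‖ ^ 2 = ∏ k, (normSqVec (p k) : ℝ) := by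
  simp only [normSqVec, NNReal.coe_sum, NNReal.coe_pow, coe_nnnorm, Finset.prod_univ_sum,
    Fintype.piFinset_univ, prodState, norm_prod, Finset.prod_pow]

theorem sum_norm_sq_prodState_add {p q : Fin N → Fin n → ℂ} {i : Fin N}
    (h : star (p i) ⬝ᵥ q i = 0) :
    ∑ s, ‖prodState p s + prodState q s‖ ^ 2 =
      ∏ k, (normSqVec (p k) : ℝ) + ∏ k, (normSqVec (q k) : ℝ) := by
  have h0 : ∑ s, star (prodState p s) * prodState q s = 0 := by
    rw [sum_star_prodState_mul]; exact Finset.prod_eq_zero (Finset.mem_univ i) h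
  have h1 : ∀ z w : ℂ, ‖z + w‖ ^ 2 = ‖z‖ ^ 2 + ‖w‖ ^ 2 + 2 * (star z * w).re := by
    intro z w
    simp only [← Complex.normSq_eq_norm_sq, Complex.normSq_apply]
    simp; ring
  simp only [h1, Finset.sum_add_distrib, ← Finset.mul_sum, ← Complex.re_sum, h0,
    sum_norm_sq_prodState]
  simp

theorem normSqVec_smul (c : ℂ) (v : Fin n → ℂ) : normSqVec (c • v) = ‖c‖₊ ^ 2 * normSqVec v := by
  simp [normSqVec, Finset.mul_sum, mul_pow]

theorem norm_star_dotProduct_sq_le (v w : Fin n → ℂ) :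
    ‖star v ⬝ᵥ w‖₊ ^ 2 ≤ normSqVec v * normSqVec w := by
  have h1 : ‖star v ⬝ᵥ w‖₊ ≤ ∑ x, ‖v x‖₊ * ‖w x‖₊ := by
    refine (nnnorm_sum_le _ _).trans (le_of_eq ?_)
    exact Finset.sum_congr rfl fun x _ => by simp
  exact (pow_le_pow_left₀ zero_le h1 2).trans (Finset.sum_mul_sq_le_sq_mul_sq _ _ _)

/-- Supplies a unit vector in the span of an orthonormal pair that is orthogonal to a vector whose
inner products with the pair are `z` and `w`. -/
theorem exists_unit_pair (z w : ℂ) :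
    ∃ α β : ℂ, ‖α‖ ^ 2 + ‖β‖ ^ 2 = 1 ∧ star α * z + star β * w = 0 := by
  by_cases h : z = 0
  · exact ⟨1, 0, by simp, by simp [h]⟩
  have hr : 0 < ‖z‖ ^ 2 + ‖w‖ ^ 2 := by positivity
  set r : ℝ := Real.sqrt (‖z‖ ^ 2 + ‖w‖ ^ 2) with hr'
  have hr0 : 0 < r := Real.sqrt_pos.2 hr
  refine ⟨star w / r, -star z / r, ?_, ?_⟩
  · have : r ^ 2 = ‖z‖ ^ 2 + ‖w‖ ^ 2 := Real.sq_sqrt hr.le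
    simp only [norm_div, norm_neg, norm_star, Complex.norm_real, Real.norm_eq_abs, div_pow, sq_abs,
      this]
    field_simp; ring
  · simp; ring

/-! ### EPR pairs among the W-class states -/

theorem normSqVec_of_orthonormal {u : Fin 2 → EuclideanSpace ℂ (Fin n)} (hu : Orthonormal ℂ u)
    (b : Fin 2) : normSqVec (fun x => u b x) = 1 := by
  have h := hu.1 b
  rw [EuclideanSpace.norm_eq, Real.sqrt_eq_one] at h
  rw [← NNReal.coe_inj]
  simpa [normSqVec] using h

theorem dotProduct_of_orthonormal {u : Fin 2 → EuclideanSpace ℂ (Fin n)} (hu : Orthonormal ℂ u)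
    (b b' : Fin 2) :
    star (fun x => u b x) ⬝ᵥ (fun x => u b' x) = if b = b' then 1 else 0 := by
  have h := (orthonormal_iff_ite.1 hu) b b'
  rw [← h]
  simp [dotProduct, PiLp.inner_apply, mul_comm]

/-- Half of the weight of an EPR pair survives projection of party `i` onto any unit vector in the
span of its two basis vectors. Choosing this vector orthogonal to `a i` kills every term except the
one with `b i` at site `i`, whose weight is at most component `i`. -/
theorem weight_le_of_isEPR {i j : Fin N} (hij : i ≠ j) {c : ℂ} {a b : Fin N → Fin n → ℂ}
    (h : IsEPR i j (wForm c a b)) :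
    weight (wForm c a b) ≤ ENNReal.ofReal (2 * wComp a b i) := by
  obtain ⟨e, u, v, φ, hu, hv, hψ⟩ := h
  set F : Fin 2 → Fin N → Fin n → ℂ := fun β k x =>
    if k = i then u β x else if k = j then v β x else φ k x with hF
  have hFi : ∀ β, F β i = fun x => u β x := fun β => by funext x; simp [hF]
  have hFj : ∀ β, F β j = fun x => v β x := fun β => by funext x; simp [hF, hij.symm]
  have hψF : wForm c a b = fun s => e * (prodState (F 0) s + prodState (F 1) s) := by
    rw [hψ]
    funext s
    have hp : ∀ β, prodState (F β) s =
        u β (s i) * v β (s j) * ∏ k ∈ Finset.univ \ {i, j}, φ k (s k) := by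
      intro β
      rw [prodState, ← Finset.prod_sdiff (Finset.subset_univ {i, j}), Finset.prod_pair hij, hFi,
        hFj, mul_comm]
      congr 1
      refine Finset.prod_congr rfl fun k hk => ?_
      simp only [Finset.mem_sdiff, Finset.mem_univ, true_and, Finset.mem_insert,
        Finset.mem_singleton, not_or] at hk
      simp [hF, hk.1, hk.2]
    rw [hp, hp, Fin.sum_univ_two]
    ring
  set Φ : ℝ := ∏ k ∈ Finset.univ.erase i, (normSqVec (F 0 k) : ℝ) with hΦ
  have hΦ' : ∀ β, ∏ k ∈ Finset.univ.erase i, (normSqVec (F β k) : ℝ) = Φ := by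
    intro β
    refine Finset.prod_congr rfl fun k hk => ?_
    by_cases hkj : k = j
    · subst hkj
      rw [hFj, hFj, normSqVec_of_orthonormal hv, normSqVec_of_orthonormal hv]
    · simp [hF, hkj, (Finset.mem_erase.1 hk).1]
  have hprod : ∀ β x, ∏ k, (normSqVec (Function.update (F β) i x k) : ℝ) = normSqVec x * Φ := by
    intro β x
    rw [← Finset.mul_prod_erase _ _ (Finset.mem_univ i), Function.update_self, ← hΦ' β]
    congr 1
    refine Finset.prod_congr rfl fun k hk => ?_
    rw [Function.update_of_ne (Finset.mem_erase.1 hk).1]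
  have horth : ∀ x y, star (Function.update (F 0) i x j) ⬝ᵥ Function.update (F 1) i y j = 0 := by
    intro x y
    rw [Function.update_of_ne hij.symm, Function.update_of_ne hij.symm, hFj, hFj,
      dotProduct_of_orthonormal hv]
    simp
  have hsum : ∀ x y, ∑ s, ‖e * (prodState (Function.update (F 0) i x) s +
      prodState (Function.update (F 1) i y) s)‖ ^ 2 =
      ‖e‖ ^ 2 * ((normSqVec x + normSqVec y) * Φ) := by
    intro x y
    simp only [norm_mul, mul_pow, ← Finset.mul_sum]
    rw [sum_norm_sq_prodState_add (horth x y), hprod, hprod]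
    ring
  -- The coefficients of the projection vector `w`, orthogonal to `a i`.
  obtain ⟨α, β, hαβ, h0⟩ := exists_unit_pair (star (fun x => u 0 x) ⬝ᵥ a i)
    (star (fun x => u 1 x) ⬝ᵥ a i)
  set w : Fin n → ℂ := α • (fun x => u 0 x) + β • (fun x => u 1 x) with hw
  have hw0 : star w ⬝ᵥ (fun x => u 0 x) = star α := by
    simp [hw, add_dotProduct, dotProduct_of_orthonormal hu]
  have hw1 : star w ⬝ᵥ (fun x => u 1 x) = star β := by
    simp [hw, add_dotProduct, dotProduct_of_orthonormal hu]
  have hwa : star w ⬝ᵥ a i = 0 := by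
    rw [← h0]; simp [hw, add_dotProduct]
  have hwn : normSqVec w = 1 := by
    have h1 : star w ⬝ᵥ w = 1 := by
      conv_lhs => rw [hw, dotProduct_add, dotProduct_smul, dotProduct_smul, hw0, hw1]
      have : ((‖α‖ ^ 2 + ‖β‖ ^ 2 : ℝ) : ℂ) = 1 := by rw [hαβ]; simp
      rw [← this]
      push_cast
      rw [← Complex.mul_conj', ← Complex.mul_conj']
      rfl
    have h2 : ((normSqVec w : ℝ) : ℂ) = star w ⬝ᵥ w := by
      simp only [normSqVec, dotProduct, NNReal.coe_sum, NNReal.coe_pow, coe_nnnorm,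
        Complex.ofReal_sum, Complex.ofReal_pow, Pi.star_apply, RCLike.star_def]
      exact Finset.sum_congr rfl fun x _ => (Complex.conj_mul' (w x)).symm
    rw [h1] at h2
    exact_mod_cast h2
  set M := Matrix.vecMulVec w (star w) with hM
  have hMx : ∀ x, M *ᵥ x = (star w ⬝ᵥ x) • w := by
    intro x
    rw [hM, Matrix.vecMulVec_mulVec]
    funext l
    simp [mul_comm]
  have hproj1 : ∑ s, ‖applyLocal i M (wForm c a b) s‖ ^ 2 = ‖e‖ ^ 2 * Φ := by
    rw [hψF, applyLocal_smul, applyLocal_add, applyLocal_prodState, applyLocal_prodState]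
    rw [hsum, hFi, hFi, hMx, hMx, hw0, hw1, normSqVec_smul, normSqVec_smul, hwn]
    simp only [nnnorm_star, mul_one, NNReal.coe_pow, coe_nnnorm]
    rw [hαβ, one_mul]
  -- Only the `i`-th term survives, and Cauchy–Schwarz bounds its site-`i` factor by the squared
  -- norm of `b i`.
  have hproj2 : ∑ s, ‖applyLocal i M (wForm c a b) s‖ ^ 2 ≤ wComp a b i := by
    have hform : applyLocal i M (wForm c a b) =
        prodState (Function.update a i ((star w ⬝ᵥ b i) • w)) := by
      rw [applyLocal_wForm, hMx, hMx, hwa, zero_smul]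
      have hz : ∀ a' : Fin N → Fin n → ℂ, a' i = 0 → ∀ s, prodState a' s = 0 := fun a' h s =>
        Finset.prod_eq_zero (Finset.mem_univ i) (by rw [h]; rfl)
      funext s
      rw [wForm, hz _ (by simp), mul_zero, zero_add, Finset.sum_eq_single i]
      · simp
      · intro l _ hl
        exact hz _ (by simp [Ne.symm hl]) s
      · simp
    rw [hform, sum_norm_sq_prodState]
    have h1 : ∏ k, normSqVec (Function.update a i ((star w ⬝ᵥ b i) • w) k) ≤ wComp a b i := by
      rw [wComp, ← Finset.mul_prod_erase _ _ (Finset.mem_univ i),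
        ← Finset.mul_prod_erase (a := i) Finset.univ
          (fun k => normSqVec (Function.update a i (b i) k)) (Finset.mem_univ i)]
      refine mul_le_mul' ?_ (le_of_eq (Finset.prod_congr rfl fun k hk => ?_))
      · rw [Function.update_self, Function.update_self, normSqVec_smul, hwn, mul_one]
        simpa [hwn] using norm_star_dotProduct_sq_le w (b i)
      · rw [Function.update_of_ne (Finset.mem_erase.1 hk).1,
          Function.update_of_ne (Finset.mem_erase.1 hk).1]
    exact_mod_cast h1
  have hweight : ∑ s, ‖wForm c a b s‖ ^ 2 = 2 * (‖e‖ ^ 2 * Φ) := by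
    have h1 := hsum (F 0 i) (F 1 i)
    rw [Function.update_eq_self, Function.update_eq_self] at h1
    rw [hψF, h1, hFi, hFi, normSqVec_of_orthonormal hu, normSqVec_of_orthonormal hu]
    simp; ring
  rw [weight, hweight]
  exact ENNReal.ofReal_le_ofReal (by linarith)

theorem IsEPR.symm {i j : Fin N} {ψ : StateVec N n} (h : IsEPR i j ψ) : IsEPR j i ψ := by
  obtain ⟨e, u, v, φ, hu, hv, hψ⟩ := h
  refine ⟨e, v, u, φ, hv, hu, ?_⟩
  rw [hψ, Finset.pair_comm]
  funext s
  simp only [mul_comm (u _ _)]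

/-! ### The upper bound for arbitrary protocols -/

/-- A function of the components of a W-class state that bounds the probability of distilling an
EPR pair along an edge of `G`: homogeneous, with non-decreasing supporting lines in every single
component, and at least `2 * min xᵢ xⱼ` for every edge. -/
structure IsUpperPotential (G : SimpleGraph (Fin N)) (f : (Fin N → ℝ≥0) → ℝ) : Prop where
  nonneg : ∀ y, 0 ≤ f y
  smul : ∀ (s : ℝ≥0) y, f (fun j => s * y j) = s * f y
  single : ∀ y k, (∀ j, j ≠ k → y j = 0) → f y = 0
  edge : ∀ y i j, G.Adj i j → 2 * min (y i : ℝ) (y j) ≤ f y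
  support : ∀ y k, ∃ m : ℝ, 0 ≤ m ∧ ∀ t : ℝ≥0, f (Function.update y k t) ≤ f y + m * (t - y k)

theorem IsUpperPotential.haltValue_le {G : SimpleGraph (Fin N)} {f : (Fin N → ℝ≥0) → ℝ}
    (hf : IsUpperPotential G f) (c : ℂ) (a b : Fin N → Fin n → ℂ) :
    haltValue G (wForm c a b) ≤ ENNReal.ofReal (f (wComp a b)) := by
  rw [haltValue]
  split_ifs with h
  · obtain ⟨i, j, hij, h⟩ := h
    have h1 := weight_le_of_isEPR hij.ne h
    have h2 := weight_le_of_isEPR hij.ne' h.symm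
    refine (le_min h1 h2).trans ?_
    rw [← ENNReal.ofReal_mono.map_min, ← mul_min_of_nonneg _ _ (by norm_num)]
    exact ENNReal.ofReal_le_ofReal (hf.edge _ _ _ hij)
  · exact zero_le

/-- By homogeneity, each outcome is a multiple `s l` of `y` with only component `k` moved. The
supporting line at `y k` bounds it, and since the `s l` sum to 1 and component `k` is conserved, the
linear corrections cancel in the sum. -/
theorem IsUpperPotential.sum_le {G : SimpleGraph (Fin N)} {f : (Fin N → ℝ≥0) → ℝ}
    (hf : IsUpperPotential G f) (k : Fin N) {m : ℕ} (K : Fin m → Matrix (Fin n) (Fin n) ℂ)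
    (hK : ∑ l, (K l)ᴴ * K l = 1) (a b : Fin N → Fin n → ℂ) :
    ∑ l, f (wComp (Function.update a k (K l *ᵥ a k)) (Function.update b k (K l *ᵥ b k))) ≤
      f (wComp a b) := by
  set X := fun l => wComp (Function.update a k (K l *ᵥ a k)) (Function.update b k (K l *ᵥ b k))
    with hX
  set y := wComp a b with hy
  have hXk : ∀ l, X l k = normSqVec (K l *ᵥ b k) * cofactor a b k k := fun l => by
    simp [hX, wComp_update]
  have hXj : ∀ l j, j ≠ k → X l j = normSqVec (K l *ᵥ a k) * cofactor a b k j := fun l j hj => by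
    simp [hX, wComp_update, hj]
  have hyk : y k = normSqVec (b k) * cofactor a b k k := by simp [hy, wComp_eq a b k]
  have hyj : ∀ j, j ≠ k → y j = normSqVec (a k) * cofactor a b k j := fun j hj => by
    simp [hy, wComp_eq a b k, hj]
  have hsa := sum_normSqVec_mulVec K hK (a k)
  have hsb : ∑ l, (X l k : ℝ) = y k := by
    rw [hyk, ← sum_normSqVec_mulVec K hK (b k), Finset.sum_mul, NNReal.coe_sum]
    simp only [hXk]
  -- If `a k` vanishes there is no rescaling factor to normalise, but then every outcome has only
  -- component `k`.
  by_cases h0 : normSqVec (a k) = 0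
  · rw [h0, Finset.sum_eq_zero_iff] at hsa
    refine (Finset.sum_eq_zero fun l _ => hf.single _ k fun j hj => ?_).trans_le (hf.nonneg y)
    exact (hXj l j hj).trans (by rw [hsa l (Finset.mem_univ l), zero_mul])
  obtain ⟨μ, hμ, hsup⟩ := hf.support y k
  set s : Fin m → ℝ≥0 := fun l => normSqVec (K l *ᵥ a k) / normSqVec (a k) with hs
  have hssum : ∑ l, (s l : ℝ) = 1 := by
    have : ∑ l, s l = 1 := by rw [hs, ← Finset.sum_div, hsa, div_self h0]
    exact_mod_cast this
  have hXs : ∀ l j, j ≠ k → X l j = s l * y j := fun l j hj => by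
    rw [hXj l j hj, hyj j hj, hs]; field_simp
  have hle : ∀ l, f (X l) ≤ s l * (f y - μ * y k) + μ * X l k := by
    intro l
    rcases eq_or_ne (s l) 0 with h | h
    -- An outcome that wipes out the other components is worth 0; this is where the slope has to be
    -- non-negative.
    · rw [hf.single (X l) k fun j hj => by rw [hXs l j hj, h, zero_mul], h]
      simp only [NNReal.coe_zero, zero_mul, zero_add]
      positivity
    · have : X l = fun j => s l * Function.update y k (X l k / s l) j := by
        funext j
        by_cases hj : j = k
        · subst hj; rw [Function.update_self]; field_simp
        · rw [Function.update_of_ne hj, hXs l j hj]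
      conv_lhs => rw [this]
      rw [hf.smul]
      have h1 := mul_le_mul_of_nonneg_left (hsup (X l k / s l)) (s l).coe_nonneg
      refine h1.trans (le_of_eq ?_)
      have : (s l : ℝ) ≠ 0 := by exact_mod_cast h
      push_cast
      field_simp
      ring
  refine (Finset.sum_le_sum fun l _ => hle l).trans (le_of_eq ?_)
  rw [Finset.sum_add_distrib, ← Finset.sum_mul, ← Finset.mul_sum, hssum, hsb]
  ring

theorem IsUpperPotential.successWithin_le {G : SimpleGraph (Fin N)} {f : (Fin N → ℝ≥0) → ℝ}
    (hf : IsUpperPotential G f) {σ : Type} (p : Protocol N n σ) (r : ℕ) (q : σ) (c : ℂ)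
    (a b : Fin N → Fin n → ℂ) :
    successWithin G p r q (wForm c a b) ≤ ENNReal.ofReal (f (wComp a b)) := by
  induction r generalizing q a b with
  | zero =>
    rw [successWithin]
    split
    · exact hf.haltValue_le c a b
    · exact zero_le
  | succ r ih =>
    rw [successWithin]
    split
    · exact hf.haltValue_le c a b
    · rename_i k m K hK next _
      refine le_trans ?_ (ENNReal.ofReal_le_ofReal (hf.sum_le k K hK a b))
      rw [ENNReal.ofReal_sum_of_nonneg fun l _ => hf.nonneg _]
      refine Finset.sum_le_sum fun l _ => ?_
      rw [applyLocal_wForm]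
      exact ih _ _ _

/-- The amplitude of `|0…0⟩` goes into `c`, which does not enter the components. Hence the upper
bound holds for every `x₀`. -/
theorem wState_eq_wForm {x : Fin N → ℝ≥0} {n : ℕ} (hn : 2 ≤ n) :
    ∃ (c : ℂ) (a b : Fin N → Fin n → ℂ), wState n x = wForm c a b ∧ wComp a b = x := by
  refine ⟨((Real.sqrt (1 - ∑ i, (x i : ℝ)) : ℝ) : ℂ), fun _ z => if (z : ℕ) = 0 then 1 else 0,
    fun i z => if (z : ℕ) = 1 then ((Real.sqrt (x i) : ℝ) : ℂ) else 0, ?_, ?_⟩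
  · funext s
    have h1 : ∀ i, prodState (Function.update
        (fun _ (z : Fin n) => if (z : ℕ) = 0 then (1 : ℂ) else 0) i
          (fun z : Fin n => if (z : ℕ) = 1 then ((Real.sqrt (x i) : ℝ) : ℂ) else 0)) s =
        if (∀ k, (s k : ℕ) = if k = i then 1 else 0) then ((Real.sqrt (x i) : ℝ) : ℂ) else 0 := by
      intro i
      rw [prodState, ← Finset.mul_prod_erase _ _ (Finset.mem_univ i), Function.update_self]
      have h2 : ∀ k ∈ Finset.univ.erase i, Function.update
          (fun _ (z : Fin n) => if (z : ℕ) = 0 then (1 : ℂ) else 0)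
          i (fun z : Fin n => if (z : ℕ) = 1 then ((Real.sqrt (x i) : ℝ) : ℂ) else 0) k (s k) =
          if (s k : ℕ) = 0 then 1 else 0 := by
        intro k hk
        rw [Function.update_of_ne (Finset.mem_erase.1 hk).1]
      rw [Finset.prod_congr rfl h2]
      split_ifs with h3 h4 h4
      · rw [Finset.prod_eq_one, mul_one]
        intro k hk
        rw [if_pos]
        rw [h4 k, if_neg (Finset.mem_erase.1 hk).1]
      · push Not at h4
        obtain ⟨k, hk⟩ := h4
        have hki : k ≠ i := by rintro rfl; simp [h3] at hk
        rw [Finset.prod_eq_zero (Finset.mem_erase.2 ⟨hki, Finset.mem_univ k⟩), mul_zero]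
        simpa [hki] using hk
      · have := h4 i; simp at this; omega
      · rw [zero_mul]
    rw [wState, wForm]
    simp only [h1]
    by_cases h : ∀ k, (s k : ℕ) = 0
    · simp [h, prodState]
    · have : prodState (fun (_ : Fin N) (z : Fin n) => if (z : ℕ) = 0 then (1 : ℂ) else 0) s =
          0 := by
        obtain ⟨k, hk⟩ := not_forall.1 h
        exact Finset.prod_eq_zero (Finset.mem_univ k) (by simpa using hk)
      rw [if_neg h, this, mul_zero, zero_add]
  · have ha : normSqVec (fun z : Fin n => if (z : ℕ) = 0 then (1 : ℂ) else 0) = 1 := by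
      rw [normSqVec, Finset.sum_eq_single (⟨0, by omega⟩ : Fin n)]
      · simp
      · intro z _ hz
        have : (z : ℕ) ≠ 0 := fun h => hz (Fin.ext h)
        simp [this]
      · simp
    have hb : ∀ i, normSqVec (fun z : Fin n => if (z : ℕ) = 1 then ((Real.sqrt (x i) : ℝ) : ℂ)
        else 0) = x i := by
      intro i
      rw [normSqVec, Finset.sum_eq_single (⟨1, by omega⟩ : Fin n)]
      · rw [← NNReal.coe_inj]; simp
      · intro z _ hz
        have : (z : ℕ) ≠ 1 := fun h => hz (Fin.ext h)
        simp [this]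
      · simp
    funext i
    rw [wComp_eq _ _ i, if_pos rfl, hb, cofactor, Finset.prod_eq_one, mul_one]
    intro k hk
    rw [Function.update_of_ne (Finset.mem_erase.1 hk).1, ha]

theorem IsUpperPotential.optimalProb_le {G : SimpleGraph (Fin N)} {f : (Fin N → ℝ≥0) → ℝ}
    (hf : IsUpperPotential G f) (x : Fin N → ℝ≥0) :
    optimalProb G x ≤ ENNReal.ofReal (f x) := by
  refine iSup_le fun n => iSup_le fun hn => iSup_le fun σ => iSup_le fun p => iSup_le fun r => ?_
  obtain ⟨c, a, b, h, hx⟩ := wState_eq_wForm (x := x) hn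
  rw [h, ← hx]
  exact hf.successWithin_le p r _ c a b

/-! ### W-class states of qubits under diagonal measurements -/

/-- The W-class state without `|0…0⟩` term with components `y`. -/
noncomputable def uState (y : Fin N → ℝ≥0) : StateVec N 2 := fun s =>
  ∑ i, if (∀ k, (s k : ℕ) = if k = i then 1 else 0) then ((Real.sqrt (y i) : ℝ) : ℂ) else 0

theorem wState_eq_uState {x : Fin N → ℝ≥0} (hx : ∑ i, x i = 1) : wState 2 x = uState x := by
  funext s
  have h1 : (∑ i, (x i : ℝ)) = 1 := by exact_mod_cast hx
  rw [wState, uState]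
  by_cases h : ∀ k, (s k : ℕ) = 0
  · simp [h, h1]
  · rw [if_neg h]

theorem applyLocal_diagonal {n : ℕ} (k : Fin N) (d : Fin n → ℂ) (ψ : StateVec N n) :
    applyLocal k (Matrix.diagonal d) ψ = fun s => d (s k) * ψ s := by
  funext s
  rw [applyLocal, Finset.sum_eq_single (s k)]
  · simp
  · intro b _ hb
    rw [Matrix.diagonal_apply_ne _ (Ne.symm hb), zero_mul]
  · simp

theorem applyLocal_diagonal_uState (k : Fin N) (d : Fin 2 → ℂ) (y y' : Fin N → ℝ≥0)
    (h : ∀ i, ((Real.sqrt (y' i) : ℝ) : ℂ) = d (if k = i then 1 else 0) * (Real.sqrt (y i) : ℝ)) :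
    applyLocal k (Matrix.diagonal d) (uState y) = uState y' := by
  rw [applyLocal_diagonal]
  funext s
  rw [uState, uState, Finset.mul_sum]
  refine Finset.sum_congr rfl fun i _ => ?_
  split_ifs with hs
  · rw [h]
    congr 2
    have := hs k
    split_ifs at this ⊢ <;> exact Fin.ext this
  · rw [mul_zero]

theorem applyLocal_evKraus_zero (k : Fin N) (t : ℝ≥0) (y : Fin N → ℝ≥0) :
    applyLocal k (evKraus t 0) (uState y) = uState (afterEqual y k t) := by
  refine applyLocal_diagonal_uState _ _ _ _ fun i => ?_
  rw [afterEqual]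
  by_cases h : i = k
  · subst h; simp
  · simp [h, Ne.symm h]

theorem applyLocal_evKraus_one (k : Fin N) {t : ℝ≥0} (ht : t ≤ 1) (y : Fin N → ℝ≥0) :
    applyLocal k (evKraus t 1) (uState y) = uState (afterVanish y k t) := by
  refine applyLocal_diagonal_uState _ _ _ _ fun i => ?_
  rw [afterVanish]
  by_cases h : i = k
  · subst h; simp
  · simp [h, Ne.symm h, NNReal.coe_sub ht]

theorem applyLocal_removeKraus_zero (k : Fin N) (y : Fin N → ℝ≥0) :
    applyLocal k (removeKraus 0) (uState y) = uState (Function.update y k 0) := by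
  refine applyLocal_diagonal_uState _ _ _ _ fun i => ?_
  by_cases h : i = k
  · subst h; simp
  · simp [h, Ne.symm h]

/-! ### Halting on an edge -/

theorem uState_apply_single (y : Fin N → ℝ≥0) (i : Fin N) :
    uState y (fun k => if k = i then 1 else 0) = ((Real.sqrt (y i) : ℝ) : ℂ) := by
  rw [uState, Finset.sum_eq_single i]
  · rw [if_pos]
    intro k; split_ifs <;> rfl
  · intro l _ hl
    rw [if_neg]
    intro h
    simpa [hl] using h l
  · simp

theorem weight_uState_ge (y : Fin N → ℝ≥0) {i j : Fin N} (hij : i ≠ j) :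
    ENNReal.ofReal (y i + y j) ≤ weight (uState y) := by
  refine ENNReal.ofReal_le_ofReal ?_
  set e : Fin N → Fin N → Fin 2 := fun i k => if k = i then 1 else 0 with he
  have hne : e i ≠ e j := fun h => by simpa [he, hij] using congrFun h i
  have h := Finset.sum_le_sum_of_subset_of_nonneg (Finset.subset_univ {e i, e j})
    (fun s _ _ => sq_nonneg ‖uState y s‖)
  rw [Finset.sum_pair hne, he, uState_apply_single, uState_apply_single] at h
  simpa using h

theorem isEPR_uState {y : Fin N → ℝ≥0} {i j : Fin N} (hij : i ≠ j) (h : y i = y j)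
    (h0 : ∀ l, l ≠ i → l ≠ j → y l = 0) : IsEPR i j (uState y) := by
  -- The pair is `|01⟩ + |10⟩`, so the second party's basis is swapped.
  refine ⟨((Real.sqrt (y i) : ℝ) : ℂ), fun b => EuclideanSpace.basisFun (Fin 2) ℂ b,
    fun b => EuclideanSpace.basisFun (Fin 2) ℂ (Equiv.swap 0 1 b),
    fun _ z => if z = 0 then 1 else 0, (EuclideanSpace.basisFun (Fin 2) ℂ).orthonormal,
    (EuclideanSpace.basisFun (Fin 2) ℂ).orthonormal.comp _ (Equiv.injective _), ?_⟩
  funext s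
  have hs : ∀ a b : Fin N, a ≠ b → ({a, b} : Finset (Fin N)) = {i, j} →
      (if (∀ k, (s k : ℕ) = if k = a then 1 else 0) then (1 : ℂ) else 0) =
      (if s a = 1 then 1 else 0) * (if s b = 0 then 1 else 0) *
        ∏ k ∈ Finset.univ \ {i, j}, (if s k = 0 then 1 else 0) := by
    intro a b hab habij
    rw [← habij]
    by_cases hall : ∀ k, (s k : ℕ) = if k = a then 1 else 0
    · rw [if_pos hall, if_pos, if_pos, Finset.prod_eq_one]
      · simp
      · intro k hk
        simp only [Finset.mem_sdiff, Finset.mem_univ, true_and, Finset.mem_insert,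
          Finset.mem_singleton, not_or] at hk
        rw [if_pos]
        exact Fin.ext (by simpa [hk.1] using hall k)
      · exact Fin.ext (by simpa [hab.symm] using hall b)
      · exact Fin.ext (by simpa using hall a)
    · rw [if_neg hall]
      by_contra hne
      apply hall
      have h1 := right_ne_zero_of_mul (Ne.symm hne)
      have h2 := right_ne_zero_of_mul (left_ne_zero_of_mul (Ne.symm hne))
      have h3 := left_ne_zero_of_mul (left_ne_zero_of_mul (Ne.symm hne))
      rw [Finset.prod_ne_zero_iff] at h1
      intro k
      by_cases hka : k = a
      · subst hka
        have : s k = 1 := by by_contra h; simp [h] at h3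
        simp [this]
      · rw [if_neg hka]
        by_cases hkb : k = b
        · subst hkb
          have : s k = 0 := by by_contra h; simp [h] at h2
          simp [this]
        · have h4 := h1 k (by simp [hka, hkb])
          have : s k = 0 := by by_contra h; simp [h] at h4
          simp [this]
  have hsum : uState y s = ((Real.sqrt (y i) : ℝ) : ℂ) *
      ((if (∀ k, (s k : ℕ) = if k = i then 1 else 0) then (1 : ℂ) else 0) +
       (if (∀ k, (s k : ℕ) = if k = j then 1 else 0) then (1 : ℂ) else 0)) := by
    rw [uState, ← Finset.sum_subset (Finset.subset_univ {i, j}), Finset.sum_pair hij, ← h]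
    · simp only [mul_add, mul_ite, mul_one, mul_zero]
    · intro l _ hl
      simp only [Finset.mem_insert, Finset.mem_singleton, not_or] at hl
      simp [h0 l hl.1 hl.2]
  rw [hsum, hs i j hij rfl, hs j i hij.symm (Finset.pair_comm _ _), Fin.sum_univ_two]
  simp only [EuclideanSpace.basisFun_apply, Equiv.swap_apply_left, Equiv.swap_apply_right,
    PiLp.single_apply]
  ring

theorem haltValue_uState_ge {G : SimpleGraph (Fin N)} {y : Fin N → ℝ≥0} {i j : Fin N}
    (hij : G.Adj i j) (h : y i = y j) (h0 : ∀ l, l ≠ i → l ≠ j → y l = 0) :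
    ENNReal.ofReal (2 * y i) ≤ haltValue G (uState y) := by
  rw [haltValue, if_pos ⟨i, j, hij, isEPR_uState hij.ne h h0⟩]
  refine le_trans (le_of_eq ?_) (weight_uState_ge y hij.ne)
  rw [← h, two_mul]

/-! ### Potentials for the Least-Party-Out protocol -/

/-- The components of the (unnormalised) standard W state of the parties in `S`. -/
noncomputable def indicatorState (S : Finset (Fin N)) : Fin N → ℝ≥0 :=
  fun j => if j ∈ S then 1 else 0

/-- A function of the components of a W-class state that the Least-Party-Out protocol attains:
no loss in Phase II, and a loss of second order in `1 - α` in Phase III. -/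
structure IsLowerPotential (G : SimpleGraph (Fin N)) (f : (Fin N → ℝ≥0) → ℝ) : Prop where
  smul : ∀ (s : ℝ≥0) y, f (fun j => s * y j) = s * f y
  single : ∀ y k, (∀ j, j ≠ k → y j = 0) → f y = 0
  le_sum : ∀ y, f y ≤ 3 * ∑ i, (y i : ℝ)
  pair : ∀ y i j, G.Adj i j → y i = y j → (∀ l, l ≠ i → l ≠ j → y l = 0) → f y ≤ 2 * y i
  isolated : ∀ y k, (∀ j, G.Adj k j → y j = 0) → f y ≤ f (Function.update y k 0)
  adjacent : ∀ y n k, (∀ j, y j ≤ y n) → G.Adj k n → y k < y n →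
    y n * f y ≤ y k * f (Function.update y k (y n)) + (y n - y k) * f (Function.update y k 0)
  disconnected : ∀ y n n' k k', (∀ j, y j ≤ y n) → y n' = y n → G.Adj n n' → G.Adj k k' →
    ¬ G.Adj k n → ¬ G.Adj k n' → ¬ G.Adj k' n → ¬ G.Adj k' n' → y k < y n → y k' < y n →
    y n * f y ≤ y k * f (Function.update y k (y n)) + (y n - y k) * f (Function.update y k 0)
  equal : ∀ (S : Finset (Fin N)) (k : Fin N) (α : ℝ≥0), 3 ≤ S.card → k ∈ leastParties G S → α ≤ 1 →
    f (indicatorState S) ≤ f (afterEqual (indicatorState S) k α) +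
      f (afterVanish (indicatorState S) k α) + 2 * (1 - α) ^ 2

/-! ### The pair sum and the rank, which control loss and duration -/

/-- The sum of `min (yᵢ, yⱼ)` over all pairs. -/
noncomputable def minSum (y : Fin N → ℝ≥0) : ℝ≥0 := ∑ i, ∑ j, min (y i) (y j)

theorem sum_le_minSum (y : Fin N → ℝ≥0) : ∑ i, y i ≤ minSum y := by
  refine Finset.sum_le_sum fun i _ => ?_
  simpa using Finset.single_le_sum (f := fun j => min (y i) (y j)) (fun _ _ => zero_le)
    (Finset.mem_univ i)

theorem minSum_le_mul_sum (y : Fin N → ℝ≥0) : minSum y ≤ N * ∑ i, y i := by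
  rw [minSum, Finset.mul_sum]
  refine Finset.sum_le_sum fun i _ => ?_
  refine (Finset.sum_le_sum fun j _ => min_le_left (y i) (y j)).trans ?_
  simp

theorem minSum_le_of_le {y : Fin N → ℝ≥0} {M : ℝ≥0} (h : ∀ i, y i ≤ M) :
    minSum y ≤ N ^ 2 * M := by
  refine (minSum_le_mul_sum y).trans ?_
  rw [pow_two, mul_assoc]
  refine mul_le_mul_right ((Finset.sum_le_sum fun i _ => h i).trans ?_) _
  simp

theorem minSum_mono {y z : Fin N → ℝ≥0} (h : ∀ i, y i ≤ z i) : minSum y ≤ minSum z :=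
  Finset.sum_le_sum fun i _ => Finset.sum_le_sum fun j _ => min_le_min (h i) (h j)

/-- For pairs without `k` the two outcomes share the minimum in the proportions `t` and `1 - t`. For
pairs with `k` the second outcome contributes nothing and the first no more than before. -/
theorem min_afterEqual_add_min_afterVanish_le (y : Fin N → ℝ≥0) (k : Fin N) {t : ℝ≥0} (ht : t ≤ 1)
    (i j : Fin N) :
    min (afterEqual y k t i) (afterEqual y k t j) +
        min (afterVanish y k t i) (afterVanish y k t j) ≤
      min (y i) (y j) := by
  have h1 : t + (1 - t) = 1 := add_tsub_cancel_of_le ht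
  have h2 : ∀ z, t * z ≤ z := fun z => mul_le_of_le_one_left zero_le ht
  simp only [afterEqual, afterVanish]
  by_cases hi : i = k <;> by_cases hj : j = k
  · simp [hi, hj]
  · simp [hi, hj, h2]
  · simp [hi, hj, h2]
  · simp only [hi, hj, if_false]
    rw [← mul_min, ← mul_min, ← add_mul, h1, one_mul]

theorem minSum_afterEqual_add_le (y : Fin N → ℝ≥0) (k : Fin N) {t : ℝ≥0} (ht : t ≤ 1) :
    minSum (afterEqual y k t) + minSum (afterVanish y k t) ≤ minSum y := by
  simp only [minSum, ← Finset.sum_add_distrib]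
  exact Finset.sum_le_sum fun i _ => Finset.sum_le_sum fun j _ =>
    min_afterEqual_add_min_afterVanish_le y k ht i j

/-- Each pair of `k` with another party falls from `M` to `t M`, and three parties provide at least
two such pairs. This first-order drop pays for the second-order loss of Phase III. -/
theorem minSum_afterEqual_add_le_of_equal (y : Fin N → ℝ≥0) (k : Fin N) {t M : ℝ≥0} (ht : t ≤ 1)
    (hy : ∀ j ∈ parties y, y j = M) (hk : k ∈ parties y) (hc : 3 ≤ (parties y).card) :
    minSum (afterEqual y k t) + minSum (afterVanish y k t) + 2 * (1 - t) * M ≤ minSum y := by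
  have h1 : (2 : ℝ≥0) * (1 - t) * M ≤
      ∑ i, ∑ j, if i = k then (if j ∈ (parties y).erase k then (1 - t) * M else 0) else 0 := by
    rw [Finset.sum_comm]
    simp only [Finset.sum_ite_eq', Finset.mem_univ, if_true, Finset.sum_ite_mem, Finset.univ_inter,
      Finset.sum_const, nsmul_eq_mul, ← mul_assoc]
    gcongr
    rw [Finset.card_erase_of_mem hk]
    exact_mod_cast (by omega : 2 ≤ (parties y).card - 1)
  refine (add_le_add_right h1 _).trans ?_
  simp only [minSum, ← Finset.sum_add_distrib]
  refine Finset.sum_le_sum fun i _ => Finset.sum_le_sum fun j _ => ?_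
  split_ifs with hi hj
  · subst hi
    obtain ⟨hji, hj⟩ := Finset.mem_erase.1 hj
    have h2 : t * M ≤ M := mul_le_of_le_one_left zero_le ht
    simp only [afterEqual, afterVanish, hji, if_true, if_false, hy i hk, hy j hj, min_self,
      zero_le, min_eq_left, add_zero, min_eq_right h2]
    rw [← add_mul, add_tsub_cancel_of_le ht, one_mul]
  · rw [add_zero]; exact min_afterEqual_add_min_afterVanish_le y k ht i j
  · rw [add_zero]; exact min_afterEqual_add_min_afterVanish_le y k ht i j

/-- A rank that decreases in every step of Phase II. -/
noncomputable def phaseRank (y : Fin N → ℝ≥0) : ℕ :=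
  (N + 1) * (parties y).card + (nonMaximal y).card

theorem phaseRank_le (y : Fin N → ℝ≥0) : phaseRank y ≤ (N + 1) * N + N := by
  have h1 : (parties y).card ≤ N := by simpa using Finset.card_le_univ (parties y)
  have h2 : (nonMaximal y).card ≤ N := by simpa using Finset.card_le_univ (nonMaximal y)
  exact Nat.add_le_add (Nat.mul_le_mul_left _ h1) h2

theorem mem_parties {y : Fin N → ℝ≥0} {k : Fin N} : k ∈ parties y ↔ 0 < y k := by simp [parties]

theorem mem_nonMaximal {y : Fin N → ℝ≥0} {k : Fin N} :
    k ∈ nonMaximal y ↔ 0 < y k ∧ y k < maxComp y := by simp [nonMaximal, mem_parties]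

theorem le_maxComp (y : Fin N → ℝ≥0) (k : Fin N) : y k ≤ maxComp y :=
  Finset.le_sup (Finset.mem_univ k)

theorem exists_eq_maxComp (y : Fin N → ℝ≥0) (k : Fin N) : ∃ n, y n = maxComp y := by
  obtain ⟨n, _, h⟩ := Finset.exists_mem_eq_sup Finset.univ ⟨k, Finset.mem_univ k⟩ y
  exact ⟨n, h.symm⟩

theorem eq_maxComp_of_nonMaximal_eq_empty {y : Fin N → ℝ≥0} (h : nonMaximal y = ∅) {k : Fin N}
    (hk : 0 < y k) : y k = maxComp y := by
  by_contra hne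
  have : k ∈ nonMaximal y := mem_nonMaximal.2 ⟨hk, lt_of_le_of_ne (le_maxComp y k) hne⟩
  simp [h] at this

theorem phaseRank_lt {y z : Fin N → ℝ≥0} {k : Fin N} (h1 : parties z ⊆ parties y)
    (h2 : nonMaximal z ⊆ nonMaximal y) (hk : k ∈ nonMaximal y) (hk' : k ∉ nonMaximal z) :
    phaseRank z + 1 ≤ phaseRank y := by
  have h3 : (nonMaximal z).card < (nonMaximal y).card :=
    Finset.card_lt_card (Finset.ssubset_iff_of_subset h2 |>.2 ⟨k, hk, hk'⟩)
  have := Nat.mul_le_mul_left (N + 1) (Finset.card_le_card h1)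
  unfold phaseRank
  omega

/-- The weight `N + 1` per party exceeds any number of non-maximal parties, so losing a party lowers
the rank without a comparison of maxima. -/
theorem phaseRank_update_lt {y : Fin N → ℝ≥0} {k : Fin N} (hk : k ∈ parties y) :
    phaseRank (Function.update y k 0) + 1 ≤ phaseRank y := by
  have h1 : parties (Function.update y k 0) ⊆ (parties y).erase k := by
    intro j hj
    rw [mem_parties] at hj
    by_cases hjk : j = k
    · subst hjk; simp at hj
    · rw [Function.update_of_ne hjk] at hj
      exact Finset.mem_erase.2 ⟨hjk, mem_parties.2 hj⟩
  have h2 := Finset.card_le_card h1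
  rw [Finset.card_erase_of_mem hk] at h2
  have h3 : 0 < (parties y).card := Finset.card_pos.2 ⟨k, hk⟩
  have h4 : (nonMaximal (Function.update y k 0)).card ≤ N := by
    simpa using Finset.card_le_univ (nonMaximal (Function.update y k 0))
  obtain ⟨c, hc⟩ := Nat.exists_eq_add_of_lt h3
  unfold phaseRank
  have h5 : (N + 1) * (parties (Function.update y k 0)).card ≤ (N + 1) * c :=
    Nat.mul_le_mul_left _ (by omega)
  have h6 : (N + 1) * (parties y).card = (N + 1) * c + (N + 1) := by rw [hc]; ring
  omega

/-- At this strength the other components shrink to at most `y k`: party `k` becomes maximal and no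
maximal party ceases to be so. -/
theorem phaseRank_afterEqual_lt {y : Fin N → ℝ≥0} {k : Fin N} (hk : k ∈ nonMaximal y) :
    phaseRank (afterEqual y k (y k / maxComp y)) + 1 ≤ phaseRank y := by
  obtain ⟨h0, hlt⟩ := mem_nonMaximal.1 hk
  have hM : 0 < maxComp y := h0.trans hlt
  have hk' : afterEqual y k (y k / maxComp y) k = y k := by simp [afterEqual]
  have hne : ∀ j, j ≠ k → afterEqual y k (y k / maxComp y) j = y k / maxComp y * y j := fun j hj =>
    by simp [afterEqual, hj]
  have hle : maxComp (afterEqual y k (y k / maxComp y)) ≤ y k := by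
    refine Finset.sup_le fun j _ => ?_
    by_cases hj : j = k
    · rw [hj, hk']
    · rw [hne j hj, div_mul_eq_mul_div, div_le_iff₀ hM]
      exact mul_le_mul_right (le_maxComp y j) _
  refine phaseRank_lt (k := k) (fun j hj => ?_) (fun j hj => ?_) hk fun h => ?_
  · by_cases hjk : j = k
    · subst hjk; exact mem_parties.2 h0
    · rw [mem_parties, hne j hjk] at hj
      exact mem_parties.2 (pos_of_mul_pos_right hj zero_le)
  · by_cases hjk : j = k
    · subst hjk; exact hk
    · rw [mem_nonMaximal, hne j hjk] at hj
      refine mem_nonMaximal.2 ⟨pos_of_mul_pos_right hj.1 zero_le, ?_⟩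
      have := hj.2.trans_le hle
      rw [div_mul_eq_mul_div, div_lt_iff₀ hM] at this
      exact lt_of_mul_lt_mul_left this zero_le
  · have := (mem_nonMaximal.1 h).2
    rw [hk'] at this
    exact absurd hle (not_le.2 this)

theorem phaseRank_afterVanish_lt {y : Fin N → ℝ≥0} {k : Fin N} {t : ℝ≥0} (hk : k ∈ nonMaximal y) :
    phaseRank (afterVanish y k t) + 1 ≤ phaseRank y := by
  have hk' : afterVanish y k t k = 0 := by simp [afterVanish]
  have hne : ∀ j, j ≠ k → afterVanish y k t j = (1 - t) * y j := fun j hj => by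
    simp [afterVanish, hj]
  have hle : maxComp (afterVanish y k t) ≤ (1 - t) * maxComp y := by
    refine Finset.sup_le fun j _ => ?_
    by_cases hj : j = k
    · rw [hj, hk']; exact zero_le
    · rw [hne j hj]
      exact mul_le_mul_right (le_maxComp y j) _
  have hpos : ∀ j, 0 < afterVanish y k t j → j ≠ k := by
    rintro j hj rfl
    simp [hk'] at hj
  refine phaseRank_lt (k := k) (fun j hj => ?_) (fun j hj => ?_) hk fun h => ?_
  · rw [mem_parties] at hj
    rw [hne j (hpos j hj)] at hj
    exact mem_parties.2 (pos_of_mul_pos_right hj zero_le)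
  · rw [mem_nonMaximal] at hj
    have hjk := hpos j hj.1
    rw [hne j hjk] at hj
    refine mem_nonMaximal.2 ⟨pos_of_mul_pos_right hj.1 zero_le, ?_⟩
    exact lt_of_mul_lt_mul_left (hj.2.trans_le hle) zero_le
  · exact absurd (mem_nonMaximal.1 h).1 (by simp [hk'])

theorem nonMaximal_afterVanish_eq_empty {y : Fin N → ℝ≥0} (h : nonMaximal y = ∅) (k : Fin N)
    (t : ℝ≥0) : nonMaximal (afterVanish y k t) = ∅ := by
  refine Finset.eq_empty_of_forall_notMem fun j hj => ?_
  obtain ⟨h1, h2⟩ := mem_nonMaximal.1 hj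
  obtain ⟨i, hi⟩ := exists_eq_maxComp (afterVanish y k t) k
  rw [← hi] at h2
  have hval : ∀ l, 0 < afterVanish y k t l → afterVanish y k t l = (1 - t) * maxComp y := by
    intro l hl
    have hlk : l ≠ k := by rintro rfl; simp [afterVanish] at hl
    rw [afterVanish, if_neg hlk] at hl ⊢
    rw [eq_maxComp_of_nonMaximal_eq_empty h (pos_of_mul_pos_right hl zero_le)]
  have h3 := h1.trans h2
  rw [hval j h1, hval i h3] at h2
  exact lt_irrefl _ h2

/-- The probability that a protocol about to perform an action halts in a success state after at
most `r` measurements. -/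
noncomputable def actionValue {n : ℕ} {σ : Type} (G : SimpleGraph (Fin N)) (p : Protocol N n σ)
    (ψ : StateVec N n) : ℕ → Action N n σ → ℝ≥0∞
  | _, .halt => haltValue G ψ
  | 0, .measure _ _ _ _ _ => 0
  | r + 1, .measure k _ K _ next => ∑ l, successWithin G p r (next l) (applyLocal k (K l) ψ)

theorem successWithin_eq_actionValue {n : ℕ} {σ : Type} (G : SimpleGraph (Fin N))
    (p : Protocol N n σ) (r : ℕ) (q : σ) (ψ : StateVec N n) :
    successWithin G p r q ψ = actionValue G p ψ r (p.step q) := by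
  cases r <;> rw [successWithin] <;> cases p.step q <;> rfl

theorem edgesIn_eq_zero_iff {G : SimpleGraph (Fin N)} {S : Finset (Fin N)} {k : Fin N} :
    edgesIn G S k = 0 ↔ ∀ j ∈ S, ¬ G.Adj k j := by
  classical
  rw [edgesIn, Finset.card_eq_zero, Finset.filter_eq_empty_iff]

theorem eq_zero_of_mem_isolated {G : SimpleGraph (Fin N)} {y : Fin N → ℝ≥0} {k : Fin N}
    (h : k ∈ isolated G (parties y)) (j : Fin N) (hj : G.Adj k j) : y j = 0 := by
  by_contra hne
  exact edgesIn_eq_zero_iff.1 (Finset.mem_filter.1 h).2 j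
    (mem_parties.2 (pos_iff_ne_zero.2 hne)) hj

theorem exists_adj_of_isolated_eq_empty {G : SimpleGraph (Fin N)} {y : Fin N → ℝ≥0}
    (h : ¬ (isolated G (parties y)).Nonempty) {k : Fin N} (hk : 0 < y k) :
    ∃ j, G.Adj k j ∧ 0 < y j := by
  by_contra! hne
  exact h ⟨k, Finset.mem_filter.2 ⟨mem_parties.2 hk, edgesIn_eq_zero_iff.2 fun j hj hadj =>
    absurd (mem_parties.1 hj) (not_lt.2 (hne j hadj))⟩⟩

/-! ### Induction over the rounds of the Least-Party-Out protocol -/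

namespace IsLowerPotential

variable {G : SimpleGraph (Fin N)} {f : (Fin N → ℝ≥0) → ℝ}

/-- Phase II loses nothing: up to the factors `t` and `1 - t` the outcomes are `y` with component
`k` raised to the maximum or set to 0. If no non-maximal party has a maximal neighbour, then, nobody
being isolated, a maximal `n` has a maximal neighbour `n'` and `k` a non-maximal neighbour `k'`,
with no edge between the two pairs; this is the case covered by `disconnected`. -/
theorem le_afterEqual_add_afterVanish (hf : IsLowerPotential G f) {y : Fin N → ℝ≥0} {k : Fin N}
    (h0 : ¬ (RandomDistillation.isolated G (parties y)).Nonempty) (hk : k ∈ nonMaximal y)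
    (hc : (nonMaximalConnected G y).Nonempty → k ∈ nonMaximalConnected G y) :
    f y ≤ f (afterEqual y k (y k / maxComp y)) + f (afterVanish y k (y k / maxComp y)) := by
  classical
  obtain ⟨hk0, hkM⟩ := mem_nonMaximal.1 hk
  have hM : 0 < maxComp y := hk0.trans hkM
  have key : maxComp y * f y ≤ y k * f (Function.update y k (maxComp y)) +
      (maxComp y - y k) * f (Function.update y k 0) := by
    by_cases hne : (nonMaximalConnected G y).Nonempty
    · obtain ⟨n, -, hn, hadj⟩ := (Finset.mem_filter.1 (hc hne)).2
      rw [← hn]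
      exact hf.adjacent y n k (fun j => hn ▸ le_maxComp y j) hadj (hn ▸ hkM)
    · have hno : ∀ a b, 0 < y a → y a < maxComp y → y b = maxComp y → ¬ G.Adj a b := by
        intro a b ha haM hb hadj
        exact hne ⟨a, Finset.mem_filter.2 ⟨mem_nonMaximal.2 ⟨ha, haM⟩, b,
          mem_parties.2 (hb ▸ hM), hb, hadj⟩⟩
      obtain ⟨n, hn⟩ := exists_eq_maxComp y k
      obtain ⟨n', hnn', hn'0⟩ := exists_adj_of_isolated_eq_empty h0 (hn ▸ hM : 0 < y n)
      obtain ⟨k', hkk', hk'0⟩ := exists_adj_of_isolated_eq_empty h0 hk0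
      have hn' : y n' = maxComp y := by
        by_contra h
        exact hno n' n hn'0 (lt_of_le_of_ne (le_maxComp y n') h) hn hnn'.symm
      have hk' : y k' < maxComp y :=
        lt_of_le_of_ne (le_maxComp y k') fun h => hno k k' hk0 hkM h hkk'
      rw [← hn]
      exact hf.disconnected y n n' k k' (fun j => hn ▸ le_maxComp y j) (hn'.trans hn.symm) hnn' hkk'
        (hno _ _ hk0 hkM hn) (hno _ _ hk0 hkM hn') (hno _ _ hk'0 hk' hn) (hno _ _ hk'0 hk' hn')
        (hn ▸ hkM) (hn ▸ hk')
  set t := y k / maxComp y with ht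
  have ht1 : t ≤ 1 := div_le_one_of_le₀ hkM.le zero_le
  have h1 : afterEqual y k t = fun j => t * Function.update y k (maxComp y) j := by
    funext j
    by_cases hj : j = k
    · subst hj; simp [afterEqual, ht, hM.ne']
    · simp [afterEqual, hj]
  have h2 : afterVanish y k t = fun j => (1 - t) * Function.update y k 0 j := by
    funext j
    by_cases hj : j = k
    · subst hj; simp [afterVanish]
    · simp [afterVanish, hj]
  rw [h1, h2, hf.smul, hf.smul, NNReal.coe_sub ht1, ht, NNReal.coe_div, NNReal.coe_one]
  have hM' : (0 : ℝ) < maxComp y := by exact_mod_cast hM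
  rw [← mul_le_mul_iff_right₀ hM']
  refine key.trans (le_of_eq ?_)
  field_simp

theorem le_afterEqual_add_afterVanish_of_equal (hf : IsLowerPotential G f) {y : Fin N → ℝ≥0}
    {k : Fin N} {α M : ℝ≥0} (hy : ∀ j ∈ parties y, y j = M)
    (hk : k ∈ leastParties G (parties y)) (hc : 3 ≤ (parties y).card) (hα : α ≤ 1) :
    f y ≤ f (afterEqual y k α) + f (afterVanish y k α) + 2 * (1 - α) ^ 2 * M := by
  have h0 : y = fun j => M * indicatorState (parties y) j := by
    funext j
    by_cases hj : j ∈ parties y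
    · simp [indicatorState, hj, hy j hj]
    · have h : y j = 0 := by simpa [mem_parties] using hj
      simp [indicatorState, hj, h]
  set S := parties y with hS
  have h1 : afterEqual y k α = fun j => M * afterEqual (indicatorState S) k α j := by
    rw [h0]; funext j; simp only [afterEqual]; split_ifs <;> ring
  have h2 : afterVanish y k α = fun j => M * afterVanish (indicatorState S) k α j := by
    rw [h0]; funext j; simp only [afterVanish]; split_ifs <;> ring
  have h3 := mul_le_mul_of_nonneg_left (hf.equal S k α hc hk hα) M.coe_nonneg
  rw [h1, h2, hf.smul, hf.smul]
  conv_lhs => rw [h0, hf.smul]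
  linarith

/-- If `f y > 0`, at least two parties remain, and they are joined: otherwise removing one as
isolated would leave a single party, of value 0. -/
theorem le_of_card_le_two (hf : IsLowerPotential G f) {y : Fin N → ℝ≥0}
    (hc : (parties y).card ≤ 2) (h : nonMaximal y = ∅) :
    ENNReal.ofReal (f y) ≤ haltValue G (uState y) := by
  by_cases hpos : f y ≤ 0
  · rw [ENNReal.ofReal_of_nonpos hpos]; exact zero_le
  have h1 : ∀ k, ∃ j, j ≠ k ∧ 0 < y j := by
    intro k
    by_contra! hne
    exact hpos (hf.single y k fun j hj => le_antisymm (hne j hj) zero_le).le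
  have h0 : ∃ k, 0 < y k := by
    by_contra! hne
    have h2 := hf.le_sum y
    rw [Finset.sum_eq_zero fun i _ => by simpa using hne i] at h2
    exact hpos (by simpa using h2)
  obtain ⟨i, hi⟩ := h0
  obtain ⟨j, hji, hj⟩ := h1 i
  have hS : parties y = {i, j} := by
    refine (Finset.eq_of_subset_of_card_le (fun l hl => ?_) ?_).symm
    · rcases Finset.mem_insert.1 hl with rfl | hl
      · exact mem_parties.2 hi
      · rw [Finset.mem_singleton.1 hl]; exact mem_parties.2 hj
    · rwa [Finset.card_pair hji.symm]
  have hz : ∀ l, l ≠ i → l ≠ j → y l = 0 := by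
    intro l hli hlj
    by_contra hl
    have : l ∈ parties y := mem_parties.2 (pos_iff_ne_zero.2 hl)
    simp [hS, hli, hlj] at this
  have hadj : G.Adj i j := by
    by_contra hadj
    refine hpos ((hf.isolated y i fun l hl => hz l hl.ne' ?_).trans (hf.single _ j ?_).le)
    · rintro rfl; exact hadj hl
    · intro l hl
      by_cases hli : l = i
      · subst hli; simp
      · rw [Function.update_of_ne hli]; exact hz l hli hl
  have heq : y i = y j := by
    rw [eq_maxComp_of_nonMaximal_eq_empty h hi, eq_maxComp_of_nonMaximal_eq_empty h hj]
  exact (ENNReal.ofReal_le_ofReal (hf.pair y i j hadj heq hz)).trans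
    (haltValue_uState_ge hadj heq hz)

/-- A potential that contracts in every step of the Least-Party-Out protocol. -/
noncomputable def contracting (η : ℝ) (y : Fin N → ℝ≥0) : ℝ := (1 + η * phaseRank y) * minSum y

/-- The lower bound, after `r` steps, for the success probability. -/
noncomputable def bound (f : (Fin N → ℝ≥0) → ℝ) (δ η lam : ℝ) (r : ℕ) (y : Fin N → ℝ≥0) : ℝ :=
  f y - δ * minSum y - 3 * lam ^ r * contracting η y

theorem minSum_le_contracting {η : ℝ} (hη : 0 ≤ η) (y : Fin N → ℝ≥0) :
    (minSum y : ℝ) ≤ contracting η y := by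
  have : 0 ≤ η * phaseRank y * minSum y := by positivity
  unfold contracting
  linarith

theorem bound_le {δ η lam : ℝ} (hδ : 0 ≤ δ) (hη : 0 ≤ η) (hl : 0 ≤ lam) (r : ℕ)
    (y : Fin N → ℝ≥0) : bound f δ η lam r y ≤ f y := by
  have h1 : 0 ≤ contracting η y := (minSum y).coe_nonneg.trans (minSum_le_contracting hη y)
  have h2 : 0 ≤ δ * minSum y := by positivity
  have h3 : 0 ≤ 3 * lam ^ r * contracting η y := by positivity
  unfold bound
  linarith

/-- The 3 in `bound` is the constant of `le_sum`; it makes the claim for zero rounds vacuous. -/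
theorem bound_zero_le (hf : IsLowerPotential G f) {δ η lam : ℝ} (hδ : 0 ≤ δ) (hη : 0 ≤ η)
    (y : Fin N → ℝ≥0) : bound f δ η lam 0 y ≤ 0 := by
  have h1 := minSum_le_contracting hη y
  have h2 : 0 ≤ δ * minSum y := by positivity
  have h3 := hf.le_sum y
  have h4 : ∑ i, (y i : ℝ) ≤ minSum y := by exact_mod_cast sum_le_minSum y
  unfold bound
  rw [pow_zero]
  linarith

end IsLowerPotential

namespace IsLowerPotential

variable {G : SimpleGraph (Fin N)} {f : (Fin N → ℝ≥0) → ℝ} {δ η lam : ℝ}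

/-- In Phase II the pair sum may stay put, and the contraction by `lam` comes from the falling rank.
-/
theorem bound_succ_le_of_rank (hδ : 0 ≤ δ) (hη : 0 ≤ η) (hl : 0 ≤ lam)
    (hII : ∀ ρ : ℕ, ρ + 1 ≤ (N + 1) * N + N → 1 + η * ρ ≤ lam * (1 + η * (ρ + 1)))
    {y y₁ y₂ : Fin N → ℝ≥0} (hf : f y ≤ f y₁ + f y₂) (hm : minSum y₁ + minSum y₂ ≤ minSum y)
    (h₁ : phaseRank y₁ + 1 ≤ phaseRank y) (h₂ : phaseRank y₂ + 1 ≤ phaseRank y) (r : ℕ) :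
    bound f δ η lam (r + 1) y ≤ bound f δ η lam r y₁ + bound f δ η lam r y₂ := by
  have hm' : (minSum y₁ : ℝ) + minSum y₂ ≤ minSum y := by exact_mod_cast hm
  obtain ⟨ρ, hρ⟩ : ∃ ρ, phaseRank y = ρ + 1 := ⟨phaseRank y - 1, by omega⟩
  have hle : ∀ z : Fin N → ℝ≥0, phaseRank z + 1 ≤ phaseRank y →
      contracting η z ≤ (1 + η * ρ) * minSum z := by
    intro z hz
    have : (phaseRank z : ℝ) ≤ ρ := by exact_mod_cast (by omega : phaseRank z ≤ ρ)
    unfold contracting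
    gcongr
  have h3 : contracting η y₁ + contracting η y₂ ≤ lam * contracting η y := by
    calc _ ≤ (1 + η * ρ) * minSum y₁ + (1 + η * ρ) * minSum y₂ := add_le_add (hle _ h₁) (hle _ h₂)
      _ = (1 + η * ρ) * (minSum y₁ + minSum y₂) := by ring
      _ ≤ (lam * (1 + η * (ρ + 1))) * minSum y := by
          have := hII ρ (hρ ▸ phaseRank_le y)
          have h4 : 0 ≤ 1 + η * ρ := by positivity
          exact mul_le_mul this hm' (by positivity) (h4.trans this)
      _ = lam * contracting η y := by
          unfold contracting; rw [hρ]; push_cast; ring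
  have h5 : 3 * lam ^ r * (contracting η y₁ + contracting η y₂) ≤
      3 * lam ^ r * (lam * contracting η y) := by gcongr
  have h6 := mul_le_mul_of_nonneg_left hm' hδ
  unfold bound
  rw [pow_succ]
  linarith

theorem bound_succ_le_of_isolated (hδ : 0 ≤ δ) (hη : 0 ≤ η) (hl : 0 ≤ lam)
    (hII : ∀ ρ : ℕ, ρ + 1 ≤ (N + 1) * N + N → 1 + η * ρ ≤ lam * (1 + η * (ρ + 1)))
    {y z : Fin N → ℝ≥0} (hf : f y ≤ f z) (hm : minSum z ≤ minSum y)
    (h : phaseRank z + 1 ≤ phaseRank y) (r : ℕ) :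
    bound f δ η lam (r + 1) y ≤ bound f δ η lam r z := by
  have hm' : (minSum z : ℝ) ≤ minSum y := by exact_mod_cast hm
  obtain ⟨ρ, hρ⟩ : ∃ ρ, phaseRank y = ρ + 1 := ⟨phaseRank y - 1, by omega⟩
  have h3 : contracting η z ≤ lam * contracting η y := by
    have h4 : (phaseRank z : ℝ) ≤ ρ := by exact_mod_cast (by omega : phaseRank z ≤ ρ)
    calc _ ≤ (1 + η * ρ) * minSum z := by unfold contracting; gcongr
      _ ≤ (lam * (1 + η * (ρ + 1))) * minSum y := by
          have := hII ρ (hρ ▸ phaseRank_le y)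
          have h4 : 0 ≤ 1 + η * ρ := by positivity
          exact mul_le_mul this hm' (by positivity) (h4.trans this)
      _ = lam * contracting η y := by
          unfold contracting; rw [hρ]; push_cast; ring
  have h5 : 3 * lam ^ r * contracting η z ≤ 3 * lam ^ r * (lam * contracting η y) := by gcongr
  have h6 := mul_le_mul_of_nonneg_left hm' hδ
  unfold bound
  rw [pow_succ]
  linarith

/-- In Phase III the rank may jump to its maximum, but the pair sum shrinks at least by the factor
`1 - 2γ/N²`, which outweighs this by `hIII`. The drop of the pair sum, times `δ ≥ 1 - α`, also
absorbs the loss of `f`. -/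
theorem bound_succ_le_of_equal (hf : IsLowerPotential G f) (hN : 0 < N) (hη : 0 ≤ η)
    (hl : 0 ≤ lam) {γ : ℝ} (hIII : (1 + η * ((N + 1) * N + N : ℕ)) * (1 - 2 * γ / N ^ 2) ≤ lam)
    {y : Fin N → ℝ≥0} {k : Fin N} {α : ℝ≥0} (hy : nonMaximal y = ∅)
    (hk : k ∈ leastParties G (parties y)) (hc : 3 ≤ (parties y).card) (hα : α ≤ 1)
    (hαδ : 1 - α ≤ δ) (hγ : γ ≤ 1 - α) (r : ℕ) :
    bound f δ η lam (r + 1) y ≤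
      bound f δ η lam r (afterEqual y k α) + bound f δ η lam r (afterVanish y k α) := by
  have hyM : ∀ j ∈ parties y, y j = maxComp y := fun j hj =>
    eq_maxComp_of_nonMaximal_eq_empty hy (mem_parties.1 hj)
  have h1 := hf.le_afterEqual_add_afterVanish_of_equal hyM hk hc hα
  have h2 : (minSum (afterEqual y k α) : ℝ) + minSum (afterVanish y k α) +
      2 * (1 - α) * maxComp y ≤ minSum y := by
    have := minSum_afterEqual_add_le_of_equal y k hα hyM (Finset.mem_filter.1 hk).1 hc
    rw [← NNReal.coe_le_coe] at this
    push_cast [NNReal.coe_sub hα] at this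
    exact this
  have hα0 : (0 : ℝ) ≤ 1 - α := sub_nonneg.2 (by exact_mod_cast hα)
  have h3 : (2 : ℝ) * (1 - α) ^ 2 * maxComp y ≤ δ * (2 * (1 - α) * maxComp y) := by
    have : (1 - α : ℝ) * (2 * (1 - α) * maxComp y) ≤ δ * (2 * (1 - α) * maxComp y) := by gcongr
    linarith
  have h4 : (minSum y : ℝ) ≤ N ^ 2 * maxComp y := by
    exact_mod_cast minSum_le_of_le (le_maxComp y)
  have hN' : (0 : ℝ) < N ^ 2 := by positivity
  have h5 : 2 * γ / N ^ 2 * minSum y ≤ 2 * (1 - α) * maxComp y := by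
    rw [div_mul_eq_mul_div, div_le_iff₀ hN']
    calc 2 * γ * minSum y ≤ 2 * (1 - α) * (N ^ 2 * maxComp y) := by gcongr
      _ = _ := by ring
  have hle : ∀ z : Fin N → ℝ≥0,
      contracting η z ≤ (1 + η * ((N + 1) * N + N : ℕ)) * minSum z := by
    intro z
    have : (phaseRank z : ℝ) ≤ ((N + 1) * N + N : ℕ) := by exact_mod_cast phaseRank_le z
    unfold contracting
    gcongr
  have h6 : contracting η (afterEqual y k α) + contracting η (afterVanish y k α) ≤
      lam * contracting η y := by
    set R : ℝ := (((N + 1) * N + N : ℕ) : ℝ)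
    have hR : 0 ≤ 1 + η * R := by positivity
    calc _ ≤ (1 + η * R) * (minSum (afterEqual y k α) + minSum (afterVanish y k α)) := by
          rw [mul_add]; exact add_le_add (hle _) (hle _)
      _ ≤ (1 + η * R) * ((1 - 2 * γ / N ^ 2) * minSum y) :=
          mul_le_mul_of_nonneg_left (by linarith) hR
      _ = (1 + η * R) * (1 - 2 * γ / N ^ 2) * minSum y := by ring
      _ ≤ lam * minSum y := by gcongr
      _ ≤ lam * contracting η y := mul_le_mul_of_nonneg_left (minSum_le_contracting hη y) hl
  have h7 : 3 * lam ^ r * (contracting η (afterEqual y k α) + contracting η (afterVanish y k α)) ≤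
      3 * lam ^ r * (lam * contracting η y) := by gcongr
  have hδ : 0 ≤ δ := hα0.trans hαδ
  have h8 := mul_le_mul_of_nonneg_left h2 hδ
  unfold bound
  rw [pow_succ]
  linarith

theorem ofReal_bound_le_evAction {p : Protocol N 2 (LPOMemory N)} {r : ℕ} {k : Fin N} {t : ℝ≥0}
    (ht : t ≤ 1) {q₁ q₂ : LPOMemory N} {y : Fin N → ℝ≥0}
    (h : bound f δ η lam (r + 1) y ≤
      bound f δ η lam r (afterEqual y k t) + bound f δ η lam r (afterVanish y k t))
    (h₁ : ENNReal.ofReal (bound f δ η lam r (afterEqual y k t)) ≤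
      successWithin G p r q₁ (uState (afterEqual y k t)))
    (h₂ : ENNReal.ofReal (bound f δ η lam r (afterVanish y k t)) ≤
      successWithin G p r q₂ (uState (afterVanish y k t))) :
    ENNReal.ofReal (bound f δ η lam (r + 1) y) ≤
      actionValue G p (uState y) (r + 1) (evAction k t ht q₁ q₂) := by
  refine (ENNReal.ofReal_le_ofReal h).trans (ENNReal.ofReal_add_le.trans ?_)
  simp only [actionValue, evAction, Fin.sum_univ_two, applyLocal_evKraus_zero,
    applyLocal_evKraus_one k ht]
  exact add_le_add h₁ h₂

variable (c : ChoiceRule N) (α : Finset (Fin N) → Set.Iio (1 : ℝ≥0)) (x : Fin N → ℝ≥0)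

theorem leastParties_nonempty (G : SimpleGraph (Fin N)) {S : Finset (Fin N)} (hS : S.Nonempty) :
    (leastParties G S).Nonempty := by
  obtain ⟨k, hk, h⟩ := Finset.exists_min_image S (edgesIn G S) hS
  exact ⟨k, Finset.mem_filter.2 ⟨hk, h⟩⟩

/-- The lower bound for the success probability from both phases of the protocol. -/
theorem ofReal_bound_le_successWithin (hf : IsLowerPotential G f) (hN : 0 < N) (hδ : 0 ≤ δ)
    (hη : 0 ≤ η) (hl : 0 ≤ lam)
    (hII : ∀ ρ : ℕ, ρ + 1 ≤ (N + 1) * N + N → 1 + η * ρ ≤ lam * (1 + η * (ρ + 1)))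
    {γ : ℝ} (hIII : (1 + η * ((N + 1) * N + N : ℕ)) * (1 - 2 * γ / N ^ 2) ≤ lam)
    (hα : ∀ S, 1 - ((α S : ℝ≥0) : ℝ) ≤ δ) (hγ : ∀ S, γ ≤ 1 - ((α S : ℝ≥0) : ℝ)) (r : ℕ)
    (y : Fin N → ℝ≥0) :
    ENNReal.ofReal (bound f δ η lam r y) ≤
      successWithin G (lpo G c α x) r (.phaseII y) (uState y) ∧
    (nonMaximal y = ∅ → ENNReal.ofReal (bound f δ η lam r y) ≤
      successWithin G (lpo G c α x) r (.phaseIII y) (uState y)) := by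
  induction r generalizing y with
  | zero =>
    rw [ENNReal.ofReal_of_nonpos (hf.bound_zero_le hδ hη y)]
    exact ⟨zero_le, fun _ => zero_le⟩
  | succ r ih =>
    have hstepIII : nonMaximal y = ∅ → ENNReal.ofReal (bound f δ η lam (r + 1) y) ≤
        actionValue G (lpo G c α x) (uState y) (r + 1) (stepIII G c α y) := by
      intro hy
      rw [stepIII]
      split_ifs with hc
      · exact (ENNReal.ofReal_le_ofReal (bound_le hδ hη hl _ y)).trans (hf.le_of_card_le_two hc hy)
      · have hc' : 3 ≤ (parties y).card := by omega
        have hk := c.pick_mem _ (leastParties_nonempty G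
          (Finset.card_pos.1 (by omega : 0 < (parties y).card)))
        have hα1 : ((α (parties y) : ℝ≥0)) ≤ 1 := le_of_lt (α (parties y)).2
        refine ofReal_bound_le_evAction _ (hf.bound_succ_le_of_equal hN hη hl hIII hy hk hc' hα1
          (hα _) (hγ _) r) (ih _).1 ((ih _).2 (nonMaximal_afterVanish_eq_empty hy _ _))
    have hev : ∀ (k : Fin N) (ht : y k / maxComp y ≤ 1),
        ¬ (RandomDistillation.isolated G (parties y)).Nonempty → k ∈ nonMaximal y →
        ((nonMaximalConnected G y).Nonempty → k ∈ nonMaximalConnected G y) →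
        ENNReal.ofReal (bound f δ η lam (r + 1) y) ≤
          actionValue G (lpo G c α x) (uState y) (r + 1) (evAction k (y k / maxComp y) ht
            (.phaseII (afterEqual y k (y k / maxComp y)))
            (.phaseII (afterVanish y k (y k / maxComp y)))) := fun k ht hiso hk hconn =>
      ofReal_bound_le_evAction _ (bound_succ_le_of_rank hδ hη hl hII
        (hf.le_afterEqual_add_afterVanish hiso hk hconn)
        (minSum_afterEqual_add_le y _ ht) (phaseRank_afterEqual_lt hk)
        (phaseRank_afterVanish_lt hk) r) (ih _).1 (ih _).1
    refine ⟨?_, fun hy => ?_⟩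
    · rw [successWithin_eq_actionValue]
      change _ ≤ actionValue _ _ _ _ (stepII G c α y)
      rw [stepII]
      by_cases hiso : (RandomDistillation.isolated G (parties y)).Nonempty
      on_goal 1 => rw [if_pos hiso]; split_ifs with hc
      on_goal 3 => rw [if_neg hiso]; by_cases hy : nonMaximal y = ∅
      on_goal 3 => rw [if_pos hy]
      on_goal 4 => rw [if_neg hy]
      -- Halting here is a failure, so the bound must be non-positive: removing the isolated party
      -- does not lower `f` and leaves at most one party.
      · obtain ⟨k, hk⟩ := hiso
        have hkS : k ∈ parties y := (Finset.mem_filter.1 hk).1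
        have hle := hf.isolated y k fun j hj => eq_zero_of_mem_isolated hk j hj
        refine le_trans (le_of_eq (ENNReal.ofReal_of_nonpos ?_)) zero_le
        refine (bound_le hδ hη hl _ y).trans (hle.trans ?_)
        have hcard : ((parties y).erase k).card ≤ 1 := by
          rw [Finset.card_erase_of_mem hkS]; omega
        by_cases hne : ((parties y).erase k).Nonempty
        · obtain ⟨j, hj⟩ := hne
          refine (hf.single _ j fun l hl => ?_).le
          by_cases hlk : l = k
          · subst hlk; simp
          · rw [Function.update_of_ne hlk]
            by_contra h
            exact hl (Finset.card_le_one.1 hcard l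
              (Finset.mem_erase.2 ⟨hlk, mem_parties.2 (pos_iff_ne_zero.2 h)⟩) j hj)
        · refine (hf.single _ k fun l hl => ?_).le
          rw [Function.update_of_ne hl]
          by_contra h
          exact hne ⟨l, Finset.mem_erase.2 ⟨hl, mem_parties.2 (pos_iff_ne_zero.2 h)⟩⟩
      · have hk := c.pick_mem _ hiso
        have hkS := (Finset.mem_filter.1 hk).1
        refine (ENNReal.ofReal_le_ofReal (bound_succ_le_of_isolated hδ hη hl hII
          (hf.isolated y _ fun j hj => eq_zero_of_mem_isolated hk j hj)
          (minSum_mono fun i => ?_) (phaseRank_update_lt hkS) r)).trans ?_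
        · by_cases hi : i = c.pick (RandomDistillation.isolated G (parties y))
          · rw [hi, Function.update_self]; exact zero_le
          · rw [Function.update_of_ne hi]
        · refine (ih _).1.trans ?_
          simp only [actionValue, Fin.sum_univ_two, applyLocal_removeKraus_zero]
          -- The second outcome is a failure; its term is dropped.
          exact le_self_add
      · exact hstepIII hy
      · have hsub : nonMaximalConnected G y ⊆ nonMaximal y := by
          classical exact Finset.filter_subset _ _
        refine hev _ _ hiso ?_ fun h => ?_
        · split_ifs with hconn
          · exact hsub (c.pick_mem _ hconn)
          · exact c.pick_mem _ (Finset.nonempty_iff_ne_empty.2 hy)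
        · rw [if_pos h]
          exact c.pick_mem _ h
    · rw [successWithin_eq_actionValue]
      exact hstepIII hy

/-- There are finitely many sets `S`, so `1 - α S` has a positive minimum `γ`, which yields a
contraction factor below 1. As the number of rounds grows, the last term of `bound` tends to 0. -/
theorem ofReal_sub_le_lpoProb (hf : IsLowerPotential G f) (hN : 0 < N) (hδ : 0 ≤ δ)
    (hα : ∀ S, 1 - ((α S : ℝ≥0) : ℝ) ≤ δ) (hx : ∑ i, x i = 1) :
    ENNReal.ofReal (f x - δ * minSum x) ≤ lpoProb G c α x := by
  obtain ⟨S₀, hS₀⟩ := Finite.exists_min fun S => 1 - ((α S : ℝ≥0) : ℝ)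
  set γ : ℝ := 1 - ((α S₀ : ℝ≥0) : ℝ) with hγ
  have hγ0 : 0 < γ := sub_pos.2 (by exact_mod_cast (α S₀).2)
  have hγ1 : γ ≤ 1 := sub_le_self _ (NNReal.coe_nonneg _)
  set R : ℝ := (((N + 1) * N + N : ℕ) : ℝ) with hR
  have hR0 : 0 < R := by rw [hR]; exact_mod_cast (by positivity)
  have hN1 : (1 : ℝ) ≤ N := by exact_mod_cast hN
  -- With `η R = g`, Phase II needs `η (ρ + 1) ≤ g` for ranks `ρ + 1 ≤ R`, and Phase III needs `(1 +
  -- g)(1 - 2g) ≤ 1 - g ≤ lam`.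
  set g : ℝ := γ / N ^ 2 with hg
  have hg0 : 0 < g := by positivity
  set η : ℝ := g / R with hη
  have hη0 : 0 < η := by positivity
  have hηR : η * R = g := by rw [hη]; field_simp
  have hR1 : 1 ≤ R := by
    rw [hR]; exact_mod_cast (Nat.succ_le_of_lt (by positivity : 0 < (N + 1) * N + N))
  have hηg : η ≤ g := div_le_self hg0.le hR1
  set lam : ℝ := 1 - η / (1 + g) with hlam
  have hlam1 : lam < 1 := by
    have : 0 < η / (1 + g) := by positivity
    linarith
  have hdiv : η / (1 + g) ≤ g / (1 + g) := by gcongr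
  have hgg : g / (1 + g) ≤ g := div_le_self hg0.le (by linarith)
  have hl0 : 0 ≤ lam := by
    have : g / (1 + g) ≤ 1 := by rw [div_le_one (by positivity)]; linarith
    linarith
  have hII : ∀ ρ : ℕ, ρ + 1 ≤ (N + 1) * N + N → 1 + η * ρ ≤ lam * (1 + η * (ρ + 1)) := by
    intro ρ hρ
    have h1 : ((ρ : ℝ) + 1) ≤ R := by rw [hR]; exact_mod_cast hρ
    have h2 : η * (ρ + 1) ≤ g := by rw [← hηR]; gcongr
    have h3 : η / (1 + g) * (1 + η * (ρ + 1)) ≤ η := by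
      rw [div_mul_eq_mul_div, div_le_iff₀ (by positivity)]
      gcongr
    rw [hlam]
    linarith
  have hIII : (1 + η * R) * (1 - 2 * γ / N ^ 2) ≤ lam := by
    have h1 : 2 * γ / N ^ 2 = 2 * g := by rw [hg]; ring
    rw [hηR, h1, hlam]
    have := mul_pos hg0 hg0
    linarith
  have hlim : Filter.Tendsto (fun r => ENNReal.ofReal (bound f δ η lam r x)) Filter.atTop
      (nhds (ENNReal.ofReal (f x - δ * minSum x))) := by
    refine ENNReal.tendsto_ofReal ?_
    have h := ((tendsto_pow_atTop_nhds_zero_of_lt_one hl0 hlam1).const_mul 3).mul_const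
      (contracting η x)
    simpa [bound] using h.const_sub (f x - δ * minSum x)
  refine le_of_tendsto' hlim fun r => ?_
  refine (hf.ofReal_bound_le_successWithin c α x hN hδ hη0.le hl0 hII hIII hα hS₀ r x).1.trans
    ?_
  rw [lpoProb, successProb, wState_eq_uState hx]
  exact le_iSup (fun r => successWithin G (lpo G c α x) r (lpo G c α x).start (uState x)) r

theorem exists_forall_lt_lpoProb (hf : IsLowerPotential G f) (hN : 0 < N) (hx : ∑ i, x i = 1)
    {ε : ℝ≥0} (hε : 0 < ε) :
    ∃ δ : ℝ≥0, 0 < δ ∧ ∀ α : Finset (Fin N) → Set.Iio (1 : ℝ≥0),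
      (∀ S, 1 ≤ (α S : ℝ≥0) + δ) → ENNReal.ofReal (f x) < lpoProb G c α x + ε := by
  -- The pair sum is at most `N` because the components sum to 1, so the loss is at most `ε / 2`;
  -- the other half of `ε` makes the inequality strict.
  refine ⟨ε / (2 * N), by positivity, fun α hα => ?_⟩
  have h1 := hf.ofReal_sub_le_lpoProb (δ := (ε / (2 * N) : ℝ≥0)) c α x hN (NNReal.coe_nonneg _)
    (fun S => by have := hα S; rw [← NNReal.coe_le_coe] at this; push_cast at this ⊢; linarith) hx
  have h2 : ((ε / (2 * N) : ℝ≥0) : ℝ) * minSum x ≤ (ε / 2 : ℝ≥0) := by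
    have h3 := minSum_le_mul_sum x
    rw [hx, mul_one] at h3
    have h4 : ε / (2 * N) * minSum x ≤ ε / (2 * N) * N := by gcongr
    have h5 : ε / (2 * N) * N = ε / 2 := by field_simp
    exact_mod_cast h4.trans h5.le
  have h6 : ENNReal.ofReal (f x) ≤ lpoProb G c α x + (ε / 2 : ℝ≥0) := by
    calc ENNReal.ofReal (f x) ≤ ENNReal.ofReal
          ((f x - ((ε / (2 * N) : ℝ≥0) : ℝ) * minSum x) + (ε / 2 : ℝ≥0)) :=
          ENNReal.ofReal_le_ofReal (by linarith)
      _ ≤ _ := ENNReal.ofReal_add_le.trans (add_le_add h1 (by rw [ENNReal.ofReal_coe_nnreal]))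
  by_cases htop : lpoProb G c α x = ⊤
  · rw [htop, top_add]; exact ENNReal.ofReal_lt_top
  · refine h6.trans_lt (ENNReal.add_lt_add_left htop ?_)
    exact_mod_cast NNReal.half_lt_self hε.ne'

end IsLowerPotential

/-! ### The optimal probability from matching potentials -/

/-- A choice rule. -/
noncomputable def someChoiceRule (N : ℕ) [NeZero N] : ChoiceRule N where
  pick S := if h : S.Nonempty then h.choose else 0
  pick_mem S h := by rw [dif_pos h]; exact h.choose_spec

theorem lpoProb_le_optimalProb (G : SimpleGraph (Fin N)) (c : ChoiceRule N)
    (α : Finset (Fin N) → Set.Iio (1 : ℝ≥0)) (x : Fin N → ℝ≥0) :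
    lpoProb G c α x ≤ optimalProb G x :=
  le_iSup₂_of_le 2 le_rfl (le_iSup₂_of_le (LPOMemory N) (lpo G c α x) le_rfl)

theorem optimalProb_eq {G : SimpleGraph (Fin N)} {f : (Fin N → ℝ≥0) → ℝ} [NeZero N]
    (hu : IsUpperPotential G f) (hl : IsLowerPotential G f) {x : Fin N → ℝ≥0}
    (hx : ∑ i, x i = 1) : optimalProb G x = ENNReal.ofReal (f x) := by
  refine le_antisymm (hu.optimalProb_le x) (ENNReal.le_of_forall_pos_le_add fun ε hε _ => ?_)
  obtain ⟨δ, hδ, h⟩ := hl.exists_forall_lt_lpoProb (someChoiceRule N) x (NeZero.pos N) hx hε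
  have hlt : 1 - min δ 1 < 1 := tsub_lt_self one_pos (lt_min hδ one_pos)
  refine (h (fun _ => ⟨1 - min δ 1, hlt⟩) fun _ => ?_).le.trans
    (add_le_add_left (lpoProb_le_optimalProb _ _ _ _) _)
  change 1 ≤ 1 - min δ 1 + δ
  calc (1 : ℝ≥0) = 1 - min δ 1 + min δ 1 := (tsub_add_cancel_of_le (min_le_right _ _)).symm
    _ ≤ _ := by gcongr; exact min_le_left _ _

/-! ### Gluing formulas according to the maximal party -/

/-- Every point of the graph of `φ` lies on a non-decreasing line above the graph. -/
def HasSupport (φ : ℝ≥0 → ℝ) : Prop :=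
  ∀ t₀ : ℝ≥0, ∃ m : ℝ, 0 ≤ m ∧ ∀ t : ℝ≥0, φ t ≤ φ t₀ + m * (t - t₀)

variable [NeZero N]

/-- A party with a maximal component. -/
noncomputable def argMax (y : Fin N → ℝ≥0) : Fin N := (Finite.exists_max y).choose

theorem le_argMax (y : Fin N → ℝ≥0) (j : Fin N) : y j ≤ y (argMax y) :=
  (Finite.exists_max y).choose_spec j

/-- The function given by `piece n` where the component of party `n` is maximal. -/
noncomputable def maxGlue (piece : Fin N → (Fin N → ℝ≥0) → ℝ) (y : Fin N → ℝ≥0) : ℝ :=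
  piece (argMax y) y

/-- Conditions on `piece` under which `maxGlue piece` is the optimal distillation probability. -/
structure PieceSystem (G : SimpleGraph (Fin N)) (piece : Fin N → (Fin N → ℝ≥0) → ℝ) : Prop where
  tie : ∀ y n m, (∀ j, y j ≤ y n) → y m = y n → n < m → piece n y = piece m y
  smul : ∀ (s : ℝ≥0) y n, piece n (fun j => s * y j) = s * piece n y
  nonneg : ∀ y n, (∀ j, y j ≤ y n) → 0 ≤ piece n y
  single : ∀ y n, (∀ j, j ≠ n → y j = 0) → piece n y = 0
  le_sum : ∀ y n, (∀ j, y j ≤ y n) → piece n y ≤ 3 * ∑ i, (y i : ℝ)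
  edge : ∀ y i j, G.Adj i j → y j ≤ y i → (∀ l, l ≠ i → l ≠ j → y l = 0) → piece i y = 2 * y j
  isolated : ∀ y n k, (∀ j, y j ≤ y n) → (∀ j, G.Adj k j → y j = 0) →
    piece n y ≤ 0 ∨ ∃ i j, G.Adj i j ∧ i ≠ k ∧ j ≠ k ∧ piece n y ≤ 2 * min (y i : ℝ) (y j)
  affine : ∀ y n k, G.Adj k n → ∃ A B : ℝ, ∀ t : ℝ≥0, piece n (Function.update y k t) = A + B * t
  disconnected : ∀ y n n' k k', (∀ j, y j ≤ y n) → y n' = y n → G.Adj n n' → G.Adj k k' →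
    ¬ G.Adj k n → ¬ G.Adj k n' → ¬ G.Adj k' n → ¬ G.Adj k' n' → k ≠ n → k ≠ n' →
    ∃ A B : ℝ, ∀ t : ℝ≥0, t ≤ y n → piece n (Function.update y k t) = A + B * t
  support : ∀ y k n, n ≠ k → (∀ j, j ≠ k → y j ≤ y n) → ∀ φ : ℝ≥0 → ℝ,
    (∀ t, t ≤ y n → φ t = piece n (Function.update y k t)) →
    (∀ t, y n ≤ t → φ t = piece k (Function.update y k t)) → HasSupport φ
  equal : ∀ (S : Finset (Fin N)) (k : Fin N) (α : ℝ≥0), 3 ≤ S.card → k ∈ leastParties G S → α ≤ 1 →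
    ∃ m ∈ S, m ≠ k ∧ piece k (indicatorState S) ≤ piece k (afterEqual (indicatorState S) k α) +
      (1 - α) * piece m (indicatorState (S.erase k)) + 2 * (1 - α) ^ 2

namespace PieceSystem

variable {G : SimpleGraph (Fin N)} {piece : Fin N → (Fin N → ℝ≥0) → ℝ}

/-- Agreement at ties makes the arbitrary choice in `argMax` harmless: any maximal party may be
used. -/
theorem maxGlue_eq (h : PieceSystem G piece) {y : Fin N → ℝ≥0} {n : Fin N}
    (hn : ∀ j, y j ≤ y n) : maxGlue piece y = piece n y := by
  have heq := le_antisymm (hn _) (le_argMax y n)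
  rcases lt_trichotomy n (argMax y) with hlt | hlt | hlt
  · exact (h.tie y n _ hn heq hlt).symm
  · rw [maxGlue, ← hlt]
  · exact h.tie y _ n (le_argMax y) heq.symm hlt

theorem maxGlue_smul (h : PieceSystem G piece) (s : ℝ≥0) (y : Fin N → ℝ≥0) :
    maxGlue piece (fun j => s * y j) = s * maxGlue piece y := by
  rw [h.maxGlue_eq (n := argMax y) fun j => mul_le_mul_right (le_argMax y j) s, h.smul, maxGlue]

theorem maxGlue_nonneg (h : PieceSystem G piece) (y : Fin N → ℝ≥0) : 0 ≤ maxGlue piece y :=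
  h.nonneg _ _ (le_argMax y)

theorem maxGlue_single (h : PieceSystem G piece) (y : Fin N → ℝ≥0) (k : Fin N)
    (hy : ∀ j, j ≠ k → y j = 0) : maxGlue piece y = 0 := by
  rw [h.maxGlue_eq (n := k), h.single y k hy]
  intro j
  by_cases hj : j = k
  · rw [hj]
  · rw [hy j hj]; exact zero_le

/-- Along the `k`-th coordinate only two pieces occur: that of the largest other party `n` while
component `k` is below it, and that of `k` afterwards. -/
theorem maxGlue_support [Nontrivial (Fin N)] (h : PieceSystem G piece) (y : Fin N → ℝ≥0)
    (k : Fin N) : ∃ m : ℝ, 0 ≤ m ∧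
      ∀ t : ℝ≥0, maxGlue piece (Function.update y k t) ≤ maxGlue piece y + m * (t - y k) := by
  obtain ⟨n, hn, hmax⟩ := Finset.exists_max_image (Finset.univ.erase k) y
    (by obtain ⟨j, hj⟩ := exists_ne k; exact ⟨j, by simpa using hj⟩)
  have hnk : n ≠ k := (Finset.mem_erase.1 hn).1
  have hmax' : ∀ j, j ≠ k → y j ≤ y n := fun j hj => hmax j (by simpa using hj)
  have := h.support y k n hnk hmax' (fun t => maxGlue piece (Function.update y k t))
    (fun t ht => h.maxGlue_eq fun j => ?_) (fun t ht => h.maxGlue_eq fun j => ?_) (y k)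
  · simpa using this
  · rw [Function.update_of_ne hnk]
    by_cases hj : j = k
    · rw [hj, Function.update_self]; exact ht
    · rw [Function.update_of_ne hj]; exact hmax' j hj
  · rw [Function.update_self]
    by_cases hj : j = k
    · rw [hj, Function.update_self]
    · rw [Function.update_of_ne hj]; exact (hmax' j hj).trans ht

theorem maxGlue_update_zero_le [Nontrivial (Fin N)] (h : PieceSystem G piece) (y : Fin N → ℝ≥0)
    (k : Fin N) : maxGlue piece (Function.update y k 0) ≤ maxGlue piece y := by
  obtain ⟨m, hm, hs⟩ := h.maxGlue_support y k
  refine (hs 0).trans ?_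
  have : 0 ≤ m * y k := by positivity
  rw [NNReal.coe_zero]
  linarith

theorem maxGlue_restrict_le [Nontrivial (Fin N)] (h : PieceSystem G piece) (y : Fin N → ℝ≥0)
    (s : Finset (Fin N)) : maxGlue piece (fun j => if j ∈ s then 0 else y j) ≤ maxGlue piece y := by
  induction s using Finset.induction_on with
  | empty => simp
  | insert k s _ ih =>
    refine le_trans (le_of_eq ?_) ((h.maxGlue_update_zero_le _ k).trans ih)
    congr 1
    funext j
    by_cases hj : j = k
    · subst hj; simp
    · simp [hj]

/-- Deleting parties cannot raise the value, and with only `i` and `j` left it is exactly `2 min`.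
-/
theorem two_mul_min_le [Nontrivial (Fin N)] (h : PieceSystem G piece) (y : Fin N → ℝ≥0)
    (i j : Fin N) (hij : G.Adj i j) : 2 * min (y i : ℝ) (y j) ≤ maxGlue piece y := by
  wlog hle : y j ≤ y i generalizing i j
  · rw [min_comm]; exact this j i hij.symm (le_of_not_ge hle)
  refine le_trans (le_of_eq ?_) (h.maxGlue_restrict_le y (Finset.univ \ {i, j}))
  set z : Fin N → ℝ≥0 := fun l => if l ∈ Finset.univ \ {i, j} then 0 else y l with hz
  have hi : z i = y i := by simp [hz]
  have hj : z j = y j := by simp [hz]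
  have hl : ∀ l, l ≠ i → l ≠ j → z l = 0 := fun l h1 h2 => by simp [hz, h1, h2]
  rw [h.maxGlue_eq (n := i), h.edge z i j hij (by rw [hi, hj]; exact hle) hl, hj,
    min_eq_right (by exact_mod_cast hle)]
  intro l
  by_cases h1 : l = i
  · rw [h1]
  by_cases h2 : l = j
  · rw [h2, hi, hj]; exact hle
  · rw [hl l h1 h2]; exact zero_le

theorem isUpperPotential [Nontrivial (Fin N)] (h : PieceSystem G piece) :
    IsUpperPotential G (maxGlue piece) where
  nonneg := h.maxGlue_nonneg
  smul := h.maxGlue_smul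
  single := h.maxGlue_single
  edge := h.two_mul_min_le
  support := h.maxGlue_support

theorem le_of_affine (h : PieceSystem G piece) {y : Fin N → ℝ≥0} {n k : Fin N}
    (hn : ∀ j, y j ≤ y n) (hk : y k < y n)
    (hA : ∃ A B : ℝ, ∀ t : ℝ≥0, t ≤ y n → piece n (Function.update y k t) = A + B * t) :
    y n * maxGlue piece y ≤ y k * maxGlue piece (Function.update y k (y n)) +
      (y n - y k) * maxGlue piece (Function.update y k 0) := by
  have hnk : n ≠ k := by rintro rfl; exact lt_irrefl _ hk
  obtain ⟨A, B, hA⟩ := hA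
  have key : ∀ t, t ≤ y n → maxGlue piece (Function.update y k t) = A + B * t := by
    intro t ht
    rw [h.maxGlue_eq (n := n), hA t ht]
    intro j
    rw [Function.update_of_ne hnk]
    by_cases hj : j = k
    · rw [hj, Function.update_self]; exact ht
    · rw [Function.update_of_ne hj]; exact hn j
  have h0 := key (y k) hk.le
  rw [Function.update_eq_self] at h0
  rw [h0, key _ le_rfl, key 0 zero_le, NNReal.coe_zero]
  exact le_of_eq (by ring)

theorem isLowerPotential [Nontrivial (Fin N)] (h : PieceSystem G piece) :
    IsLowerPotential G (maxGlue piece) where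
  smul := h.maxGlue_smul
  single := h.maxGlue_single
  le_sum y := h.le_sum _ _ (le_argMax y)
  pair y i j hij hy h0 := by
    rw [h.maxGlue_eq (n := i), h.edge y i j hij hy.ge h0, hy]
    intro l
    by_cases h1 : l = i
    · rw [h1]
    by_cases h2 : l = j
    · rw [h2, hy]
    · rw [h0 l h1 h2]; exact zero_le
  isolated y k hk := by
    -- Deletion could lower the value in general; here it is at most 0, or at most the value of an
    -- edge that survives the deletion.
    rcases h.isolated y _ k (le_argMax y) hk with h1 | ⟨i, j, hij, hik, hjk, h1⟩
    · exact h1.trans (h.maxGlue_nonneg _)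
    · have := h.two_mul_min_le (Function.update y k 0) i j hij
      rw [Function.update_of_ne hik, Function.update_of_ne hjk] at this
      exact h1.trans this
  adjacent y n k hn hadj hk := by
    obtain ⟨A, B, hA⟩ := h.affine y n k hadj
    exact h.le_of_affine hn hk ⟨A, B, fun t _ => hA t⟩
  disconnected y n n' k k' hn hn' h1 h2 h3 h4 h5 h6 hk _ :=
    h.le_of_affine hn hk (h.disconnected y n n' k k' hn hn' h1 h2 h3 h4 h5 h6
      (by rintro rfl; exact lt_irrefl _ hk) (by rintro rfl; exact hk.ne hn'))
  equal S k α hc hk hα := by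
    obtain ⟨m, hm, hmk, hle⟩ := h.equal S k α hc hk hα
    have hkS : k ∈ S := (Finset.mem_filter.1 hk).1
    have h1 : ∀ T : Finset (Fin N), ∀ j, indicatorState T j ≤ 1 := fun T j => by
      unfold indicatorState; split_ifs <;> simp
    have h2 : ∀ {T : Finset (Fin N)} {j}, j ∈ T → indicatorState T j = 1 := fun hj => if_pos hj
    have h3 : afterVanish (indicatorState S) k α =
        fun j => (1 - α) * indicatorState (S.erase k) j := by
      funext j
      by_cases hj : j = k
      · subst hj; simp [afterVanish, indicatorState]
      · simp [afterVanish, indicatorState, hj]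
    rw [h.maxGlue_eq (n := k) fun j => (h1 S j).trans (h2 hkS).ge,
      h.maxGlue_eq (n := k) (y := afterEqual _ _ _), h3, h.maxGlue_smul,
      h.maxGlue_eq (n := m) (y := indicatorState (S.erase k)), NNReal.coe_sub hα]
    · exact hle
    · exact fun j => (h1 _ j).trans (h2 (Finset.mem_erase.2 ⟨hmk, hm⟩)).ge
    · intro j
      simp only [afterEqual, if_true, h2 hkS]
      split_ifs
      · exact h1 S j
      · exact mul_le_one' hα (h1 S j)

end PieceSystem

/-! ### Supporting lines of glued functions -/

/-- The second derivative of `C - D/t + E/t²` is `(6E - 2Dt)/t⁴`, which is non-positive for `t ≥ N`.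
The gap to the tangent is computed explicitly, with a factor `(t - t₀)²`. -/
theorem le_tangent_of_three_mul_le {N D E t t₀ : ℝ} (hN : 0 < N) (hE : 0 ≤ E)
    (hD : 3 * E ≤ D * N) (ht : N ≤ t) (ht₀ : N ≤ t₀) (C : ℝ) :
    C - D / t + E / t ^ 2 ≤
      C - D / t₀ + E / t₀ ^ 2 + (D / t₀ ^ 2 - 2 * E / t₀ ^ 3) * (t - t₀) := by
  have h0 : 0 < t := hN.trans_le ht
  have h1 : 0 < t₀ := hN.trans_le ht₀
  have key : C - D / t₀ + E / t₀ ^ 2 + (D / t₀ ^ 2 - 2 * E / t₀ ^ 3) * (t - t₀) -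
      (C - D / t + E / t ^ 2) =
      (t - t₀) ^ 2 / (t * t₀ ^ 2) * (D - E * (2 * t + t₀) / (t * t₀)) := by
    field_simp; ring
  have h2 : E * (2 * t + t₀) / (t * t₀) ≤ D := by
    rw [div_le_iff₀ (by positivity)]
    have h3 : N * (2 * t + t₀) ≤ 3 * (t * t₀) := by nlinarith
    have h4 : E * (N * (2 * t + t₀)) ≤ E * (3 * (t * t₀)) := mul_le_mul_of_nonneg_left h3 hE
    have h5 : 3 * E * (t * t₀) ≤ D * N * (t * t₀) := by gcongr
    have h6 : N * (E * (2 * t + t₀)) ≤ N * (D * (t * t₀)) := by linarith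
    exact le_of_mul_le_mul_left h6 hN
  have h3 : 0 ≤ (t - t₀) ^ 2 / (t * t₀ ^ 2) * (D - E * (2 * t + t₀) / (t * t₀)) :=
    mul_nonneg (by positivity) (sub_nonneg.2 h2)
  linarith

/-- An affine piece followed by a concave non-decreasing one is concave and non-decreasing as soon
as the slope does not rise at the joint. -/
theorem hasSupport_of_glue {φ : ℝ≥0 → ℝ} {N : ℝ≥0} (hN : 0 < N) {A B C D E : ℝ} (hE : 0 ≤ E)
    (hD : 3 * E ≤ D * N) (hL : ∀ t, t ≤ N → φ t = A + B * t)
    (hR : ∀ t, N ≤ t → φ t = C - D / t + E / t ^ 2)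
    (hB : D / N ^ 2 - 2 * E / N ^ 3 ≤ B) : HasSupport φ := by
  have hN' : (0 : ℝ) < N := by exact_mod_cast hN
  have hslope : ∀ t₀ : ℝ≥0, N ≤ t₀ → 0 ≤ D / (t₀ : ℝ) ^ 2 - 2 * E / (t₀ : ℝ) ^ 3 := by
    intro t₀ h
    have h' : (N : ℝ) ≤ t₀ := by exact_mod_cast h
    have h0 : (0 : ℝ) < t₀ := hN'.trans_le h'
    have hD0 : 0 ≤ D := by
      by_contra hneg
      have := mul_neg_of_neg_of_pos (not_le.1 hneg) hN'
      linarith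
    rw [sub_nonneg, div_le_div_iff₀ (by positivity) (by positivity)]
    have h1 : D * N ≤ D * t₀ := by gcongr
    have h2 : 2 * E * (t₀ : ℝ) ^ 2 ≤ D * t₀ * (t₀ : ℝ) ^ 2 :=
      mul_le_mul_of_nonneg_right (by linarith) (sq_nonneg _)
    linarith
  have htan : ∀ t₀ t : ℝ≥0, N ≤ t₀ → N ≤ t →
      φ t ≤ φ t₀ + (D / (t₀ : ℝ) ^ 2 - 2 * E / (t₀ : ℝ) ^ 3) * (t - t₀) := by
    intro t₀ t h1 h2
    rw [hR t h2, hR t₀ h1]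
    exact le_tangent_of_three_mul_le hN' hE hD (by exact_mod_cast h2) (by exact_mod_cast h1) C
  intro t₀
  rcases le_total t₀ N with h | h
  · refine ⟨B, (hslope N le_rfl).trans hB, fun t => ?_⟩
    rcases le_total t N with ht | ht
    · rw [hL t ht, hL t₀ h]; linarith
    · have h1 := htan N t le_rfl ht
      have ht' : (0 : ℝ) ≤ t - N := sub_nonneg.2 (by exact_mod_cast ht)
      have h2 := mul_le_mul_of_nonneg_right hB ht'
      have h3 := hL N le_rfl
      have h4 := hL t₀ h
      linarith
  · refine ⟨_, hslope t₀ h, fun t => ?_⟩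
    rcases le_total t N with ht | ht
    · have h1 := htan t₀ N h le_rfl
      have h2 := htan N t₀ le_rfl h
      have h3 := hL N le_rfl
      have h4 := hL t ht
      have ht' : (0 : ℝ) ≤ N - t := sub_nonneg.2 (by exact_mod_cast ht)
      -- The slope at `t₀ > N` is at most the slope at `N`: add the tangent inequalities between the
      -- two points.
      have h5 : (D / (t₀ : ℝ) ^ 2 - 2 * E / (t₀ : ℝ) ^ 3) * (N - t) ≤ B * (N - t) := by
        rcases eq_or_lt_of_le h with h' | h'
        · rw [← h']; exact mul_le_mul_of_nonneg_right hB ht'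
        · have h0 : (0 : ℝ) < t₀ - N := sub_pos.2 (by exact_mod_cast h')
          refine mul_le_mul_of_nonneg_right (le_trans ?_ hB) ht'
          refine le_of_mul_le_mul_right ?_ h0
          linarith
      linarith
    · exact htan t₀ t h ht

theorem hasSupport_zero {φ : ℝ≥0 → ℝ} (h : ∀ t, φ t = 0) : HasSupport φ :=
  fun _ => ⟨0, le_rfl, fun _ => by simp [h]⟩

/-- At each point the supporting line of the smaller function serves. This handles a kink where the
roles of two parties are exchanged. -/
theorem hasSupport_min {φ φ₁ φ₂ : ℝ≥0 → ℝ} (h₁ : HasSupport φ₁) (h₂ : HasSupport φ₂)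
    (h : ∀ t, φ t = min (φ₁ t) (φ₂ t)) : HasSupport φ := by
  intro t₀
  rcases le_total (φ₁ t₀) (φ₂ t₀) with hle | hle
  · obtain ⟨m, hm, hs⟩ := h₁ t₀
    refine ⟨m, hm, fun t => ?_⟩
    rw [h, h t₀, min_eq_left hle]
    exact (min_le_left _ _).trans (hs t)
  · obtain ⟨m, hm, hs⟩ := h₂ t₀
    refine ⟨m, hm, fun t => ?_⟩
    rw [h, h t₀, min_eq_right hle]
    exact (min_le_right _ _).trans (hs t)

theorem hasSupport_affine {φ : ℝ≥0 → ℝ} {A B : ℝ} (hB : 0 ≤ B) (h : ∀ t, φ t = A + B * t) :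
    HasSupport φ := fun t₀ => ⟨B, hB, fun t => by rw [h, h]; linarith⟩

/-! ### The function `τ` -/

/-- The expression `τ` as a function of the components of the parties `n`, `n'`, `p`, `p'`. -/
noncomputable def tauFun (n n' p p' : ℝ) : ℝ :=
  2 * p + 2 * p' - 2 * (p * p' / n) + 2 / 3 * (p * p' * n' / n ^ 2)

theorem tauFun_comm (n n' p p' : ℝ) : tauFun n n' p p' = tauFun n n' p' p := by
  unfold tauFun; ring

/-- At a tie `p = n` the terms in `p'` alone cancel, leaving an expression symmetric in `n'` and
`p'`. The hypothesis covers `n = 0`, where division returns 0. -/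
theorem tauFun_self (n u v : ℝ) (h : n = 0 → v = 0) :
    tauFun n u n v = 2 * n + 2 / 3 * (u * v / n) := by
  unfold tauFun
  rcases eq_or_ne n 0 with h0 | h0
  · simp [h0, h h0]
  · field_simp; ring

theorem tauFun_nonneg {n n' p p' : ℝ} (hn' : 0 ≤ n') (hp : 0 ≤ p) (hp' : 0 ≤ p') (hpn : p ≤ n) :
    0 ≤ tauFun n n' p p' := by
  have hn : 0 ≤ n := hp.trans hpn
  have h1 : p * p' / n ≤ p' := by
    refine div_le_of_le_mul₀ hn hp' ?_
    rw [mul_comm]; gcongr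
  have h2 : 0 ≤ p * p' * n' / n ^ 2 := by positivity
  unfold tauFun
  linarith

theorem tauFun_le {n n' p p' : ℝ} (hn' : 0 ≤ n') (hp : 0 ≤ p) (hp' : 0 ≤ p') (hpn : p ≤ n)
    (hpn' : p' ≤ n) : tauFun n n' p p' ≤ 2 * p + 2 * p' + 2 / 3 * n' := by
  have hn : 0 ≤ n := hp.trans hpn
  have h1 : 0 ≤ p * p' / n := by positivity
  have h2 : p * p' * n' / n ^ 2 ≤ n' := by
    refine div_le_of_le_mul₀ (by positivity) hn' ?_
    rw [mul_comm, pow_two]; gcongr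
  unfold tauFun
  linarith

theorem tauFun_smul (s n n' p p' : ℝ) :
    tauFun (s * n) (s * n') (s * p) (s * p') = s * tauFun n n' p p' := by
  unfold tauFun
  rcases eq_or_ne s 0 with h | h
  · simp [h]
  rcases eq_or_ne n 0 with h0 | h0
  · simp [h0]; ring
  · field_simp

section

variable {φ : ℝ≥0 → ℝ} {N u v : ℝ≥0}

/-- The moving party is the `n'` of the maximal one and exchanges places with it; both slopes at `N`
equal `2uv / (3N²)`. -/
theorem hasSupport_tauFun_of_opposite (hu : u ≤ N) (hv : v ≤ N)
    (hL : ∀ t, t ≤ N → φ t = tauFun N t u v) (hR : ∀ t, N ≤ t → φ t = tauFun t N u v) :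
    HasSupport φ := by
  rcases eq_or_ne N 0 with rfl | hN
  · rw [nonpos_iff_eq_zero] at hu hv
    exact hasSupport_zero fun t => by rw [hR t zero_le, hu, hv]; simp [tauFun]
  have hN' : (0 : ℝ) < N := by exact_mod_cast pos_iff_ne_zero.2 hN
  refine hasSupport_of_glue (pos_iff_ne_zero.2 hN) (A := 2 * u + 2 * v - 2 * (u * v / N))
    (B := 2 / 3 * (u * v / N ^ 2)) (C := 2 * u + 2 * v) (D := 2 * (u * v))
    (E := 2 / 3 * (u * v * N)) (by positivity) (by linarith) (fun t ht => ?_) (fun t ht => ?_) ?_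
  · rw [hL t ht, tauFun]; ring
  · rw [hR t ht, tauFun]; ring
  · refine le_of_eq ?_
    field_simp; ring

/-- The slope at `N` drops by `2(N - u)(N - v)/N²`. -/
theorem hasSupport_tauFun_of_adjacent (hu : u ≤ N) (hv : v ≤ N)
    (hL : ∀ t, t ≤ N → φ t = tauFun N u t v) (hR : ∀ t, N ≤ t → φ t = tauFun t v N u) :
    HasSupport φ := by
  rcases eq_or_ne N 0 with rfl | hN
  · rw [nonpos_iff_eq_zero] at hu hv
    exact hasSupport_zero fun t => by rw [hR t zero_le, hu, hv]; simp [tauFun]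
  have hN' : (0 : ℝ) < N := by exact_mod_cast pos_iff_ne_zero.2 hN
  have hu' : (u : ℝ) ≤ N := by exact_mod_cast hu
  have hv' : (v : ℝ) ≤ N := by exact_mod_cast hv
  refine hasSupport_of_glue (pos_iff_ne_zero.2 hN) (A := 2 * v)
    (B := 2 - 2 * (v / N) + 2 / 3 * (u * v / N ^ 2)) (C := 2 * N + 2 * u) (D := 2 * (N * u))
    (E := 2 / 3 * (N * u * v)) (by positivity) ?_ (fun t ht => ?_) (fun t ht => ?_) ?_
  · have : (N * u * v : ℝ) ≤ N * u * N := by gcongr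
    linarith
  · rw [hL t ht, tauFun]; ring
  · rw [hR t ht, tauFun]; ring
  · have key : 2 - 2 * ((v : ℝ) / N) + 2 / 3 * (u * v / N ^ 2) -
        (2 * (N * u) / N ^ 2 - 2 * (2 / 3 * (N * u * v)) / N ^ 3) =
        2 * ((N - u) * (N - v)) / N ^ 2 := by field_simp; ring
    have : (0 : ℝ) ≤ 2 * ((N - u) * (N - v)) / N ^ 2 :=
      div_nonneg (mul_nonneg two_pos.le (mul_nonneg (sub_nonneg.2 hu') (sub_nonneg.2 hv')))
        (by positivity)
    linarith

/-- Here `v` is the `n'` on both sides of `N`. The slope drops by `2((N - u)² + u(v - u))/N²`, hence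
the need for `u ≤ v`. -/
theorem hasSupport_tauFun_of_partner (huv : u ≤ v) (hv : v ≤ N)
    (hL : ∀ t, t ≤ N → φ t = tauFun N v t u) (hR : ∀ t, N ≤ t → φ t = tauFun t v N u) :
    HasSupport φ := by
  rcases eq_or_ne N 0 with rfl | hN
  · rw [nonpos_iff_eq_zero] at hv
    rw [hv, nonpos_iff_eq_zero] at huv
    exact hasSupport_zero fun t => by rw [hR t zero_le, huv, hv]; simp [tauFun]
  have hN' : (0 : ℝ) < N := by exact_mod_cast pos_iff_ne_zero.2 hN
  have hu' : (u : ℝ) ≤ v := by exact_mod_cast huv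
  have hv' : (v : ℝ) ≤ N := by exact_mod_cast hv
  refine hasSupport_of_glue (pos_iff_ne_zero.2 hN) (A := 2 * u)
    (B := 2 - 2 * (u / N) + 2 / 3 * (u * v / N ^ 2)) (C := 2 * N + 2 * u) (D := 2 * (N * u))
    (E := 2 / 3 * (N * u * v)) (by positivity) ?_ (fun t ht => ?_) (fun t ht => ?_) ?_
  · have : (N * u * v : ℝ) ≤ N * u * N := by gcongr
    linarith
  · rw [hL t ht, tauFun]; ring
  · rw [hR t ht, tauFun]; ring
  · have key : 2 - 2 * ((u : ℝ) / N) + 2 / 3 * (u * v / N ^ 2) -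
        (2 * (N * u) / N ^ 2 - 2 * (2 / 3 * (N * u * v)) / N ^ 3) =
        2 * ((N - u) * (N - u) + u * (v - u)) / N ^ 2 := by field_simp; ring
    have : (0 : ℝ) ≤ 2 * ((N - u) * (N - u) + u * (v - u)) / N ^ 2 :=
      div_nonneg (mul_nonneg two_pos.le (add_nonneg (mul_self_nonneg _)
        (mul_nonneg u.coe_nonneg (sub_nonneg.2 hu')))) (by positivity)
    linarith

/-- The moving party competes with `v` for the role of `n'`. Exchanging the two roles changes
`tauFun` by `2(1 - u/N)` times their difference, so the true function is the minimum of an affine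
one and the one of the opposite case. -/
theorem hasSupport_tauFun_of_distant (hu : u ≤ N) (hv : v ≤ N)
    (hL : ∀ t, t ≤ N → φ t = tauFun N (max t v) u (min t v))
    (hR : ∀ t, N ≤ t → φ t = tauFun t N v u) :
    HasSupport φ := by
  rcases eq_or_ne N 0 with rfl | hN
  · rw [nonpos_iff_eq_zero] at hu hv
    exact hasSupport_zero fun t => by rw [hR t zero_le, hu, hv]; simp [tauFun]
  have hN' : (0 : ℝ) < N := by exact_mod_cast pos_iff_ne_zero.2 hN
  have hu' : (u : ℝ) ≤ N := by exact_mod_cast hu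
  have hv' : (v : ℝ) ≤ N := by exact_mod_cast hv
  have hs : (u : ℝ) / N ≤ 1 := div_le_one_of_le₀ hu' hN'.le
  have hB : 0 ≤ 2 * (1 - (u : ℝ) / N) + 2 / 3 * (u * v / N ^ 2) := by
    have : 0 ≤ 2 * (1 - (u : ℝ) / N) := by linarith
    positivity
  have hdiff : ∀ a b : ℝ, tauFun N a u b - tauFun N b u a = 2 * (1 - u / N) * (b - a) := by
    intro a b; unfold tauFun; ring
  refine hasSupport_min (φ₁ := fun t => tauFun N v u t)
    (φ₂ := fun t => if t ≤ N then tauFun N t u v else tauFun t N u v)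
    (hasSupport_affine (A := 2 * u) hB fun t => by unfold tauFun; ring)
    (hasSupport_tauFun_of_opposite hu hv (fun t ht => if_pos ht) fun t ht => ?_) fun t => ?_
  · split_ifs with h
    · rw [le_antisymm h ht]
    · rfl
  · rcases le_total t N with ht | ht
    · rw [hL t ht, if_pos ht]
      rcases le_total t v with htv | htv
      · have htv' : (t : ℝ) ≤ v := by exact_mod_cast htv
        rw [max_eq_right htv', min_eq_left htv', min_eq_left]
        have := hdiff v t
        have h2 : 2 * (1 - (u : ℝ) / N) * (t - v) ≤ 0 :=
          mul_nonpos_of_nonneg_of_nonpos (by linarith) (by linarith)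
        linarith
      · have htv' : (v : ℝ) ≤ t := by exact_mod_cast htv
        rw [max_eq_left htv', min_eq_right htv', min_eq_right]
        have := hdiff t v
        have h2 : 2 * (1 - (u : ℝ) / N) * (v - t) ≤ 0 :=
          mul_nonpos_of_nonneg_of_nonpos (by linarith) (by linarith)
        linarith
    · have ht' : (N : ℝ) ≤ t := by exact_mod_cast ht
      have ht0 : (0 : ℝ) < t := hN'.trans_le ht'
      have heq : (if t ≤ N then tauFun N t u v else tauFun t N u v) = tauFun t N u v := by
        split_ifs with h
        · rw [le_antisymm h ht]
        · rfl
      rw [heq, hR t ht, tauFun_comm, min_eq_right]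
      -- Beyond `N` the opposite-case function lies below its tangent at `N`, and this tangent lies
      -- below the affine function.
      have h1 := le_tangent_of_three_mul_le (D := 2 * (u * v)) (E := 2 / 3 * (u * v * N)) hN'
        (by positivity) (by linarith) ht' le_rfl (2 * (u : ℝ) + 2 * v)
      have h2 : tauFun t N u v =
          2 * (u : ℝ) + 2 * v - 2 * (u * v) / t + 2 / 3 * (u * v * N) / t ^ 2 := by
        unfold tauFun; ring
      have h3 : (2 * (u : ℝ) + 2 * v - 2 * (u * v) / N + 2 / 3 * (u * v * N) / N ^ 2 +
          (2 * (u * v) / N ^ 2 - 2 * (2 / 3 * (u * v * N)) / N ^ 3) * (t - N)) =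
          2 * u + 2 * v - 2 * (u / N) * v + 2 / 3 * (u * v / N ^ 2) * t := by
        field_simp; ring
      have h4 : tauFun N v u t =
          2 * u + 2 * (1 - u / N) * t + 2 / 3 * (u * v / N ^ 2) * t := by unfold tauFun; ring
      have h5 : 2 * (1 - (u : ℝ) / N) * v ≤ 2 * (1 - u / N) * t := by
        have : 0 ≤ 2 * (1 - (u : ℝ) / N) := by linarith
        exact mul_le_mul_of_nonneg_left (hv'.trans ht') this
      linarith

end

/-! ### Configurations III -/

/-- `τ` on the cycle `0 - 1 - 2 - 3 - 0`, if the component of party `n` is maximal. -/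
noncomputable def cyclePiece : Fin 4 → (Fin 4 → ℝ≥0) → ℝ
  | 0, x => tauFun (x 0) (x 2) (x 1) (x 3)
  | 1, x => tauFun (x 1) (x 3) (x 0) (x 2)
  | 2, x => tauFun (x 2) (x 0) (x 1) (x 3)
  | 3, x => tauFun (x 3) (x 1) (x 0) (x 2)

theorem tauFun_tie {n m u v : ℝ≥0} (h : m = n) (hu : u ≤ n) (hv : v ≤ n) :
    tauFun n u m v = tauFun m v n u := by
  subst h
  have h0 : ∀ {w : ℝ≥0}, w ≤ m → (m : ℝ) = 0 → (w : ℝ) = 0 := fun hw h => by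
    rw [NNReal.coe_eq_zero] at h ⊢
    exact le_antisymm (h ▸ hw) zero_le
  rw [tauFun_self _ _ _ (h0 hv), tauFun_self _ _ _ (h0 hu), mul_comm (u : ℝ)]

theorem exists_eq_erase {S : Finset (Fin 4)} (h : 3 ≤ S.card) :
    S = Finset.univ ∨ ∃ j, S = Finset.univ.erase j := by
  revert S; decide

theorem adj_cycle_iff (i j : Fin 4) :
    (SimpleGraph.fromEdgeSet {s(0, 1), s(1, 2), s(2, 3), s((0 : Fin 4), 3)}).Adj i j ↔
      j = i + 1 ∨ i = j + 1 := by
  fin_cases i <;> fin_cases j <;> simp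

theorem cyclePieceSystem :
    PieceSystem (SimpleGraph.fromEdgeSet {s(0, 1), s(1, 2), s(2, 3), s((0 : Fin 4), 3)})
      cyclePiece where
  tie y n m hn hm hlt := by
    have h0 := hn 0; have h1 := hn 1; have h2 := hn 2; have h3 := hn 3
    fin_cases n <;> fin_cases m <;> simp at hlt h0 h1 h2 h3 hm ⊢ <;>
      simp only [cyclePiece] <;>
      first
      | (rw [hm]; done)
      | exact tauFun_tie hm (by assumption) (by assumption)
      | rw [tauFun_comm]; exact tauFun_tie hm (by assumption) (by assumption)
      | rw [tauFun_comm, tauFun_comm (y 3)]; exact tauFun_tie hm (by assumption) (by assumption)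
  smul s y n := by
    fin_cases n <;> simp [cyclePiece, tauFun_smul]
  nonneg y n hn := by
    fin_cases n <;> exact tauFun_nonneg (NNReal.coe_nonneg _) (NNReal.coe_nonneg _)
      (NNReal.coe_nonneg _) (hn _)
  single y n h := by
    fin_cases n <;> simp [cyclePiece, tauFun, h]
  le_sum y n hn := by
    have h0 := (y 0).coe_nonneg; have h1 := (y 1).coe_nonneg
    have h2 := (y 2).coe_nonneg; have h3 := (y 3).coe_nonneg
    rw [Fin.sum_univ_four]
    fin_cases n <;> refine (tauFun_le (NNReal.coe_nonneg _) (NNReal.coe_nonneg _)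
      (NNReal.coe_nonneg _) (hn _) (hn _)).trans ?_ <;> linarith
  edge y i j hij _ h := by
    rw [adj_cycle_iff] at hij
    have h0 := h 0; have h1 := h 1; have h2 := h 2; have h3 := h 3
    fin_cases i <;> fin_cases j <;> simp at hij h0 h1 h2 h3 ⊢ <;> simp [cyclePiece, tauFun, *]
  isolated y n k hn hk := by
    simp only [adj_cycle_iff] at hk
    left
    have h0 := hn 0; have h1 := hn 1; have h2 := hn 2; have h3 := hn 3
    have k0 := hk 0; have k1 := hk 1; have k2 := hk 2; have k3 := hk 3
    fin_cases k <;> simp at k0 k1 k2 k3 <;> fin_cases n <;> simp at h0 h1 h2 h3 ⊢ <;>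
      simp_all [cyclePiece, tauFun]
  affine y n k h := by
    rw [adj_cycle_iff] at h
    refine ⟨cyclePiece n (Function.update y k 0), cyclePiece n (Function.update y k 1) -
      cyclePiece n (Function.update y k 0), fun t => ?_⟩
    fin_cases k <;> fin_cases n <;> simp at h <;> simp [cyclePiece, tauFun] <;> ring
  disconnected y n n' k k' hn hn' h1 h2 h3 h4 h5 h6 h7 h8 := by
    -- Two disjoint edges of the cycle are always joined by a further edge.
    exfalso
    clear hn hn'
    simp only [adj_cycle_iff] at *
    revert n n' k k'
    decide
  support y k n hnk hmax φ hL hR := by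
    fin_cases k <;> fin_cases n
    · exact absurd rfl hnk
    · exact hasSupport_tauFun_of_adjacent (u := y 3) (v := y 2)
        (hmax 3 (by decide)) (hmax 2 (by decide))
        hL hR
    · exact hasSupport_tauFun_of_opposite (u := y 1) (v := y 3)
        (hmax 1 (by decide)) (hmax 3 (by decide))
        hL hR
    · exact hasSupport_tauFun_of_adjacent (u := y 1) (v := y 2)
        (hmax 1 (by decide)) (hmax 2 (by decide))
        hL (fun t ht => (hR t ht).trans (tauFun_comm _ _ _ _))
    · exact hasSupport_tauFun_of_adjacent (u := y 2) (v := y 3)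
        (hmax 2 (by decide)) (hmax 3 (by decide))
        hL hR
    · exact absurd rfl hnk
    · exact hasSupport_tauFun_of_adjacent (u := y 0) (v := y 3)
        (hmax 0 (by decide)) (hmax 3 (by decide))
        hL (fun t ht => (hR t ht).trans (tauFun_comm _ _ _ _))
    · exact hasSupport_tauFun_of_opposite (u := y 0) (v := y 2)
        (hmax 0 (by decide)) (hmax 2 (by decide))
        hL hR
    · exact hasSupport_tauFun_of_opposite (u := y 1) (v := y 3)
        (hmax 1 (by decide)) (hmax 3 (by decide))
        hL hR
    · exact hasSupport_tauFun_of_adjacent (u := y 3) (v := y 0)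
        (hmax 3 (by decide)) (hmax 0 (by decide))
        (fun t ht => (hL t ht).trans (tauFun_comm _ _ _ _)) hR
    · exact absurd rfl hnk
    · exact hasSupport_tauFun_of_adjacent (u := y 1) (v := y 0)
        (hmax 1 (by decide)) (hmax 0 (by decide))
        (fun t ht => (hL t ht).trans (tauFun_comm _ _ _ _))
        (fun t ht => (hR t ht).trans (tauFun_comm _ _ _ _))
    · exact hasSupport_tauFun_of_adjacent (u := y 2) (v := y 1)
        (hmax 2 (by decide)) (hmax 1 (by decide))
        (fun t ht => (hL t ht).trans (tauFun_comm _ _ _ _)) hR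
    · exact hasSupport_tauFun_of_opposite (u := y 0) (v := y 2)
        (hmax 0 (by decide)) (hmax 2 (by decide))
        hL hR
    · exact hasSupport_tauFun_of_adjacent (u := y 0) (v := y 1)
        (hmax 0 (by decide)) (hmax 1 (by decide))
        (fun t ht => (hL t ht).trans (tauFun_comm _ _ _ _))
        (fun t ht => (hR t ht).trans (tauFun_comm _ _ _ _))
    · exact absurd rfl hnk
  equal S k α hS hk _ := by
    replace hk := (Finset.mem_filter.1 hk).1
    have h1 : 0 ≤ (1 - (α : ℝ)) ^ 2 * α := by positivity
    have h2 : 0 ≤ (1 - (α : ℝ)) ^ 2 := by positivity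
    rcases exists_eq_erase hS with rfl | ⟨j, rfl⟩
    · refine ⟨k + 1, by simp, by simp, ?_⟩
      fin_cases k <;> simp [cyclePiece, tauFun, indicatorState, afterEqual] <;> linarith
    -- The witness is some survivor other than `k`. The constant 2 of the loss is reached when the
    -- middle one of three parties measures.
    · refine ⟨if k + 1 = j then k + 2 else k + 1, ?_, ?_, ?_⟩
      · clear hS; revert k j; decide
      · clear hS; revert k j; decide
      · fin_cases j <;> fin_cases k <;> simp at hk <;>
          simp [cyclePiece, tauFun, indicatorState, afterEqual] <;> linarith

/-! ### The two disjoint edges and the path -/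

/-- `τ` on the graph `0 - 1`, `2 - 3`, if the component of party `n` is maximal. -/
noncomputable def pairPiece : Fin 4 → (Fin 4 → ℝ≥0) → ℝ
  | 0, x => tauFun (x 0) (max (x 2) (x 3)) (x 1) (min (x 2) (x 3))
  | 1, x => tauFun (x 1) (max (x 2) (x 3)) (x 0) (min (x 2) (x 3))
  | 2, x => tauFun (x 2) (max (x 0) (x 1)) (x 3) (min (x 0) (x 1))
  | 3, x => tauFun (x 3) (max (x 0) (x 1)) (x 2) (min (x 0) (x 1))

/-- `τ` on the path `0 - 1 - 2 - 3`, if the component of party `n` is maximal. -/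
noncomputable def pathPiece : Fin 4 → (Fin 4 → ℝ≥0) → ℝ
  | 0, x => pairPiece 0 x
  | 1, x => cyclePiece 1 x
  | 2, x => cyclePiece 2 x
  | 3, x => pairPiece 3 x

theorem hasSupport_tauFun_of_max_min {φ : ℝ≥0 → ℝ} {N a b : ℝ≥0} (ha : a ≤ N) (hb : b ≤ N)
    (hL : ∀ t, t ≤ N → φ t = tauFun N (max (a : ℝ) b) t (min (a : ℝ) b))
    (hR : ∀ t, N ≤ t → φ t = tauFun t (max (a : ℝ) b) N (min (a : ℝ) b)) : HasSupport φ := by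
  refine hasSupport_tauFun_of_partner (u := min a b) (v := max a b)
    min_le_max (max_le ha hb) ?_ ?_
    <;> simpa using by assumption

/-- An end of the path overtakes its inner neighbour: the party `n'` stays the same if `b ≤ a` and
may change otherwise, which decides between the partner and the adjacent case. -/
theorem hasSupport_tauFun_of_max_min_right {φ : ℝ≥0 → ℝ} {N a b : ℝ≥0} (ha : a ≤ N) (hb : b ≤ N)
    (hL : ∀ t, t ≤ N → φ t = tauFun N a t b)
    (hR : ∀ t, N ≤ t → φ t = tauFun t (max (a : ℝ) b) N (min (a : ℝ) b)) : HasSupport φ := by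
  rcases le_total a b with h | h
  · refine hasSupport_tauFun_of_adjacent ha hb hL ?_
    simpa [h] using hR
  · refine hasSupport_tauFun_of_partner h ha hL ?_
    simpa [h] using hR

theorem hasSupport_tauFun_of_max_min_left {φ : ℝ≥0 → ℝ} {N a b : ℝ≥0} (ha : a ≤ N) (hb : b ≤ N)
    (hL : ∀ t, t ≤ N → φ t = tauFun N (max (a : ℝ) b) t (min (a : ℝ) b))
    (hR : ∀ t, N ≤ t → φ t = tauFun t a N b) : HasSupport φ := by
  rcases le_total a b with h | h
  · refine hasSupport_tauFun_of_adjacent hb ha ?_ hR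
    simpa [h] using hL
  · refine hasSupport_tauFun_of_partner h ha ?_ hR
    simpa [h] using hL

theorem tauFun_affine (n n' p' : ℝ) (t : ℝ≥0) :
    tauFun n n' t p' = tauFun n n' (0 : ℝ≥0) p' +
      (tauFun n n' (1 : ℝ≥0) p' - tauFun n n' (0 : ℝ≥0) p') * t := by
  simp [tauFun]; ring

theorem adj_pair_iff (i j : Fin 4) :
    (SimpleGraph.fromEdgeSet {s((0 : Fin 4), 1), s(2, 3)}).Adj i j ↔ j = ![1, 0, 3, 2] i := by
  fin_cases i <;> fin_cases j <;> simp

theorem adj_path_iff (i j : Fin 4) :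
    (SimpleGraph.fromEdgeSet {s((0 : Fin 4), 1), s(1, 2), s(2, 3)}).Adj i j ↔
      (j : ℕ) = i + 1 ∨ (i : ℕ) = j + 1 := by
  fin_cases i <;> fin_cases j <;> simp

/-- Of three parties exactly one has lost its partner, and it alone is least. The order matters: a
measurement by one of the two linked parties would cost a first-order amount in `1 - α`. -/
theorem eq_partner_of_mem_leastParties {j k : Fin 4}
    (hk : k ∈ leastParties (SimpleGraph.fromEdgeSet {s((0 : Fin 4), 1), s(2, 3)})
      (Finset.univ.erase j)) : k = ![1, 0, 3, 2] j := by
  obtain ⟨hkj, hle⟩ := Finset.mem_filter.1 hk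
  clear hk
  have hp : ![1, 0, 3, 2] j ∈ Finset.univ.erase j := by clear hle hkj; revert j; decide
  have h1 : edgesIn (SimpleGraph.fromEdgeSet {s((0 : Fin 4), 1), s(2, 3)}) (Finset.univ.erase j)
      (![1, 0, 3, 2] j) = 0 := edgesIn_eq_zero_iff.2 fun i hi => by
    rw [adj_pair_iff]
    clear hle hp hkj
    revert i j; decide
  have h0 := edgesIn_eq_zero_iff.1 (Nat.le_zero.1 ((hle _ hp).trans h1.le))
  simp only [adj_pair_iff] at h0
  clear hle hp h1
  revert j k; decide

theorem pairPieceSystem :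
    PieceSystem (SimpleGraph.fromEdgeSet {s((0 : Fin 4), 1), s(2, 3)}) pairPiece where
  tie y n m hn hm hlt := by
    have h0 := hn 0; have h1 := hn 1; have h2 := hn 2; have h3 := hn 3
    fin_cases n <;> fin_cases m <;> simp at hlt h0 h1 h2 h3 hm ⊢ <;>
      simp only [pairPiece, hm] <;> simp [h0, h1, h2, h3] <;> exact tauFun_comm _ _ _ _
  smul s y n := by
    fin_cases n <;>
      simp [pairPiece, ← mul_max_of_nonneg, ← mul_min_of_nonneg, tauFun_smul]
  nonneg y n hn := by
    fin_cases n <;> exact tauFun_nonneg (by positivity) (NNReal.coe_nonneg _)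
      (by positivity) (hn _)
  single y n h := by
    fin_cases n <;> simp [pairPiece, tauFun, h]
  le_sum y n hn := by
    have h0 := (y 0).coe_nonneg; have h1 := (y 1).coe_nonneg
    have h2 := (y 2).coe_nonneg; have h3 := (y 3).coe_nonneg
    have h4 : min (y 0 : ℝ) (y 1) + max (y 0 : ℝ) (y 1) = y 0 + y 1 := min_add_max _ _
    have h5 : min (y 2 : ℝ) (y 3) + max (y 2 : ℝ) (y 3) = y 2 + y 3 := min_add_max _ _
    have h6 : 0 ≤ max (y 0 : ℝ) (y 1) := by positivity
    have h7 : 0 ≤ max (y 2 : ℝ) (y 3) := by positivity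
    have h8 : 0 ≤ min (y 0 : ℝ) (y 1) := by positivity
    have h9 : 0 ≤ min (y 2 : ℝ) (y 3) := by positivity
    rw [Fin.sum_univ_four]
    fin_cases n <;> refine (tauFun_le (by positivity) (NNReal.coe_nonneg _)
      (by positivity) (hn _) (by exact min_le_of_left_le (hn _))).trans ?_ <;> linarith
  edge y i j hij _ h := by
    rw [adj_pair_iff] at hij
    have h0 := h 0; have h1 := h 1; have h2 := h 2; have h3 := h 3
    fin_cases i <;> fin_cases j <;> simp at hij h0 h1 h2 h3 ⊢ <;> simp [pairPiece, tauFun, *]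
  isolated y n k hn hk := by
    right
    simp only [adj_pair_iff] at hk ⊢
    have h0 := hn 0; have h1 := hn 1; have h2 := hn 2; have h3 := hn 3
    have k0 := hk 0; have k1 := hk 1; have k2 := hk 2; have k3 := hk 3
    -- The edge not containing `k`, the only one left once the partner of `k` has vanished.
    refine ⟨if k < 2 then 2 else 0, if k < 2 then 3 else 1, ?_, ?_, ?_, ?_⟩
    · clear hk k0 k1 k2 k3; revert k; decide
    · clear hk k0 k1 k2 k3; revert k; decide
    · clear hk k0 k1 k2 k3; revert k; decide
    · fin_cases k <;> simp at k0 k1 k2 k3 <;> fin_cases n <;> simp at h0 h1 h2 h3 ⊢ <;>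
        simp_all [pairPiece, tauFun]
  affine y n k h := by
    rw [adj_pair_iff] at h
    refine ⟨pairPiece n (Function.update y k 0), pairPiece n (Function.update y k 1) -
      pairPiece n (Function.update y k 0), fun t => ?_⟩
    fin_cases k <;> fin_cases n <;> simp at h <;> exact tauFun_affine _ _ _ _
  disconnected y n n' k k' hn hn' h1 h2 h3 h4 h5 h6 h7 h8 := by
    simp only [adj_pair_iff] at *
    subst h1 h2
    -- With `n` and `n'` tied, `tauFun_self` leaves only the product of maximum and minimum, which
    -- is the product of the two components and hence affine in each.
    refine ⟨2 * y n, 2 / 3 * (y (![1, 0, 3, 2] k) / y n), fun t ht => ?_⟩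
    have h0 : (y n : ℝ) = 0 → (t : ℝ) = 0 := fun h => by
      rw [NNReal.coe_eq_zero] at h ⊢
      exact le_antisymm (h ▸ ht) zero_le
    clear h3 h4 h5 h6
    fin_cases n <;> fin_cases k <;> simp at h7 h8 hn' ⊢ <;>
      simp [pairPiece, hn'] <;>
      rw [tauFun_self _ _ _ fun h => by simp [h0 h], max_mul_min] <;> ring
  support y k n hnk hmax φ hL hR := by
    fin_cases k <;> fin_cases n
    · exact absurd rfl hnk
    · exact hasSupport_tauFun_of_max_min (hmax 2 (by decide)) (hmax 3 (by decide)) hL hR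
    · have hu : y 3 ≤ y 2 := hmax 3 (by decide)
      exact hasSupport_tauFun_of_distant (v := y 1) hu (hmax 1 (by decide))
        hL
        fun t ht => (hR t ht).trans (by simp [pairPiece, hu])
    · have hu : y 2 ≤ y 3 := hmax 2 (by decide)
      exact hasSupport_tauFun_of_distant (v := y 1) hu (hmax 1 (by decide))
        hL
        fun t ht => (hR t ht).trans (by simp [pairPiece, hu])
    · exact hasSupport_tauFun_of_max_min (hmax 2 (by decide)) (hmax 3 (by decide)) hL hR
    · exact absurd rfl hnk
    · have hu : y 3 ≤ y 2 := hmax 3 (by decide)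
      exact hasSupport_tauFun_of_distant (v := y 0) hu (hmax 0 (by decide))
        (fun t ht => (hL t ht).trans (by simp [pairPiece, max_comm, min_comm]))
        fun t ht => (hR t ht).trans (by simp [pairPiece, hu])
    · have hu : y 2 ≤ y 3 := hmax 2 (by decide)
      exact hasSupport_tauFun_of_distant (v := y 0) hu (hmax 0 (by decide))
        (fun t ht => (hL t ht).trans (by simp [pairPiece, max_comm, min_comm]))
        fun t ht => (hR t ht).trans (by simp [pairPiece, hu])
    · have hu : y 1 ≤ y 0 := hmax 1 (by decide)
      exact hasSupport_tauFun_of_distant (v := y 3) hu (hmax 3 (by decide))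
        hL
        fun t ht => (hR t ht).trans (by simp [pairPiece, hu])
    · have hu : y 0 ≤ y 1 := hmax 0 (by decide)
      exact hasSupport_tauFun_of_distant (v := y 3) hu (hmax 3 (by decide))
        hL
        fun t ht => (hR t ht).trans (by simp [pairPiece, hu])
    · exact absurd rfl hnk
    · exact hasSupport_tauFun_of_max_min (hmax 0 (by decide)) (hmax 1 (by decide)) hL hR
    · have hu : y 1 ≤ y 0 := hmax 1 (by decide)
      exact hasSupport_tauFun_of_distant (v := y 2) hu (hmax 2 (by decide))
        (fun t ht => (hL t ht).trans (by simp [pairPiece, max_comm, min_comm]))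
        fun t ht => (hR t ht).trans (by simp [pairPiece, hu])
    · have hu : y 0 ≤ y 1 := hmax 0 (by decide)
      exact hasSupport_tauFun_of_distant (v := y 2) hu (hmax 2 (by decide))
        (fun t ht => (hL t ht).trans (by simp [pairPiece, max_comm, min_comm]))
        fun t ht => (hR t ht).trans (by simp [pairPiece, hu])
    · exact hasSupport_tauFun_of_max_min (hmax 0 (by decide)) (hmax 1 (by decide)) hL hR
    · exact absurd rfl hnk
  equal S k α hS hk hα := by
    have h1 : 0 ≤ (1 - (α : ℝ)) ^ 2 * α := by positivity
    have h2 : 0 ≤ (1 - (α : ℝ)) ^ 2 := by positivity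
    rcases exists_eq_erase hS with rfl | ⟨j, rfl⟩
    · refine ⟨k + 1, by simp, by simp, ?_⟩
      fin_cases k <;> simp [pairPiece, tauFun, indicatorState, afterEqual] <;> linarith
    · have hkj : k ≠ j ∧ k = ![1, 0, 3, 2] j :=
        ⟨Finset.ne_of_mem_erase (Finset.mem_filter.1 hk).1,
        eq_partner_of_mem_leastParties hk⟩
      clear hk
      refine ⟨if k + 1 = j then k + 2 else k + 1, ?_, ?_, ?_⟩
      · clear hS; revert k j; decide
      · clear hS; revert k j; decide
      · fin_cases j <;> fin_cases k <;> simp at hkj <;>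
          simp [pairPiece, tauFun, indicatorState, afterEqual] <;> linarith

/-- Without party 1 the path is an isolated end and an edge, where again only the isolated party may
measure without first-order loss. -/
theorem eq_zero_of_mem_leastParties {k : Fin 4}
    (hk : k ∈ leastParties (SimpleGraph.fromEdgeSet {s((0 : Fin 4), 1), s(1, 2), s(2, 3)})
      (Finset.univ.erase 1)) : k = 0 := by
  have hle := (Finset.mem_filter.1 hk).2 0 (by decide)
  rw [(edgesIn_eq_zero_iff (k := 0)).2 (by simp only [adj_path_iff]; decide), Nat.le_zero,
    edgesIn_eq_zero_iff] at hle
  have hk' := (Finset.mem_filter.1 hk).1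
  simp only [adj_path_iff] at hle
  clear hk
  revert k; decide

theorem eq_three_of_mem_leastParties {k : Fin 4}
    (hk : k ∈ leastParties (SimpleGraph.fromEdgeSet {s((0 : Fin 4), 1), s(1, 2), s(2, 3)})
      (Finset.univ.erase 2)) : k = 3 := by
  have hle := (Finset.mem_filter.1 hk).2 3 (by decide)
  rw [(edgesIn_eq_zero_iff (k := 3)).2 (by simp only [adj_path_iff]; decide), Nat.le_zero,
    edgesIn_eq_zero_iff] at hle
  have hk' := (Finset.mem_filter.1 hk).1
  simp only [adj_path_iff] at hle
  clear hk
  revert k; decide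

theorem pathPieceSystem :
    PieceSystem (SimpleGraph.fromEdgeSet {s((0 : Fin 4), 1), s(1, 2), s(2, 3)}) pathPiece where
  tie y n m hn hm hlt := by
    have h0 := hn 0; have h1 := hn 1; have h2 := hn 2; have h3 := hn 3
    fin_cases n <;> fin_cases m <;> simp at hlt h0 h1 h2 h3 hm ⊢
    · rcases le_total (y 2) (y 3) with h | h
      · simp [pathPiece, pairPiece, cyclePiece, h, hm]
      · simpa [pathPiece, pairPiece, cyclePiece, h] using tauFun_tie hm h2 h3
    · simp [pathPiece, pairPiece, cyclePiece, h3, hm]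
    · simpa [pathPiece, pairPiece, h1, h2, hm] using tauFun_comm _ _ _ _
    · exact (tauFun_comm _ _ _ _).trans (tauFun_tie hm h3 h0)
    · simpa [pathPiece, pairPiece, cyclePiece, h0, hm] using tauFun_comm _ _ _ _
    · rcases le_total (y 0) (y 1) with h | h
      · simpa [pathPiece, pairPiece, cyclePiece, h, tauFun_comm _ _ (y 1 : ℝ)] using
          tauFun_tie hm h0 h1
      · simpa [pathPiece, pairPiece, cyclePiece, h, hm] using tauFun_comm _ _ _ _
  smul s y n := by
    fin_cases n
    exacts [pairPieceSystem.smul s y 0, cyclePieceSystem.smul s y 1, cyclePieceSystem.smul s y 2,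
      pairPieceSystem.smul s y 3]
  nonneg y n hn := by
    fin_cases n
    exacts [pairPieceSystem.nonneg y 0 hn, cyclePieceSystem.nonneg y 1 hn,
      cyclePieceSystem.nonneg y 2 hn, pairPieceSystem.nonneg y 3 hn]
  single y n h := by
    fin_cases n
    exacts [pairPieceSystem.single y 0 h, cyclePieceSystem.single y 1 h,
      cyclePieceSystem.single y 2 h, pairPieceSystem.single y 3 h]
  le_sum y n hn := by
    fin_cases n
    exacts [pairPieceSystem.le_sum y 0 hn, cyclePieceSystem.le_sum y 1 hn,
      cyclePieceSystem.le_sum y 2 hn, pairPieceSystem.le_sum y 3 hn]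
  edge y i j hij _ h := by
    rw [adj_path_iff] at hij
    have h0 := h 0; have h1 := h 1; have h2 := h 2; have h3 := h 3
    fin_cases i <;> fin_cases j <;> simp at hij h0 h1 h2 h3 ⊢ <;>
      simp [pathPiece, pairPiece, cyclePiece, tauFun, *]
  isolated y n k hn hk := by
    simp only [adj_path_iff] at hk ⊢
    have h0 := hn 0; have h1 := hn 1; have h2 := hn 2; have h3 := hn 3
    have k0 := hk 0; have k1 := hk 1; have k2 := hk 2; have k3 := hk 3
    fin_cases k <;> simp at k0 k1 k2 k3
    -- An isolated end leaves the far edge; an isolated inner party leaves no edge, and the value is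
    -- then 0.
    on_goal 1 => refine Or.inr ⟨2, 3, by decide, by decide, by decide, ?_⟩
    on_goal 2 => left
    on_goal 3 => left
    on_goal 4 => refine Or.inr ⟨0, 1, by decide, by decide, by decide, ?_⟩
    all_goals
      fin_cases n <;> simp at h0 h1 h2 h3 ⊢ <;>
        simp_all [pathPiece, pairPiece, cyclePiece, tauFun]
  affine y n k h := by
    rw [adj_path_iff] at h
    refine ⟨pathPiece n (Function.update y k 0), pathPiece n (Function.update y k 1) -
      pathPiece n (Function.update y k 0), fun t => ?_⟩
    fin_cases k <;> fin_cases n <;> simp at h <;>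
      first
      | exact tauFun_affine _ _ _ _
      | simp [pathPiece, cyclePiece, tauFun]; ring
  disconnected y n n' k k' hn hn' h1 h2 h3 h4 h5 h6 h7 h8 := by
    exfalso
    clear hn hn'
    simp only [adj_path_iff] at *
    revert n n' k k'
    decide
  support y k n hnk hmax φ hL hR := by
    fin_cases k <;> fin_cases n
    · exact absurd rfl hnk
    · exact hasSupport_tauFun_of_max_min_right (a := y 3) (b := y 2)
        (hmax 3 (by decide)) (hmax 2 (by decide))
        hL (fun t ht => (hR t ht).trans (by simp [pathPiece, pairPiece, max_comm, min_comm]))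
    · have hv : y 3 ≤ y 2 := hmax 3 (by decide)
      exact hasSupport_tauFun_of_opposite (u := y 1) (hmax 1 (by decide)) hv
        hL
        fun t ht => (hR t ht).trans (by simp [pathPiece, pairPiece, hv])
    · have hu : y 2 ≤ y 3 := hmax 2 (by decide)
      exact hasSupport_tauFun_of_distant (v := y 1) hu (hmax 1 (by decide))
        hL
        fun t ht => (hR t ht).trans (by simp [pathPiece, pairPiece, hu])
    · exact hasSupport_tauFun_of_max_min_left (a := y 3) (b := y 2)
        (hmax 3 (by decide)) (hmax 2 (by decide))
        (fun t ht => (hL t ht).trans (by simp [pathPiece, pairPiece, max_comm, min_comm])) hR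
    · exact absurd rfl hnk
    · exact hasSupport_tauFun_of_adjacent (u := y 0) (v := y 3)
        (hmax 0 (by decide)) (hmax 3 (by decide))
        hL (fun t ht => (hR t ht).trans (tauFun_comm _ _ _ _))
    · exact hasSupport_tauFun_of_distant (u := y 2) (v := y 0)
        (hmax 2 (by decide)) (hmax 0 (by decide))
        (fun t ht => (hL t ht).trans (by simp [pathPiece, pairPiece, max_comm, min_comm])) hR
    · exact hasSupport_tauFun_of_distant (u := y 1) (v := y 3)
        (hmax 1 (by decide)) (hmax 3 (by decide))
        hL (fun t ht => (hR t ht).trans (tauFun_comm _ _ _ _))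
    · exact hasSupport_tauFun_of_adjacent (u := y 3) (v := y 0)
        (hmax 3 (by decide)) (hmax 0 (by decide))
        (fun t ht => (hL t ht).trans (tauFun_comm _ _ _ _)) hR
    · exact absurd rfl hnk
    · exact hasSupport_tauFun_of_max_min_left (a := y 0) (b := y 1)
        (hmax 0 (by decide)) (hmax 1 (by decide))
        hL (fun t ht => (hR t ht).trans (tauFun_comm _ _ _ _))
    · have hu : y 1 ≤ y 0 := hmax 1 (by decide)
      exact hasSupport_tauFun_of_distant (v := y 2) hu (hmax 2 (by decide))
        (fun t ht => (hL t ht).trans (by simp [pathPiece, pairPiece, max_comm, min_comm]))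
        fun t ht => (hR t ht).trans (by simp [pathPiece, pairPiece, hu])
    · have hv : y 0 ≤ y 1 := hmax 0 (by decide)
      exact hasSupport_tauFun_of_opposite (u := y 2) (hmax 2 (by decide)) hv
        (fun t ht => (hL t ht).trans (tauFun_comm _ _ _ _))
        fun t ht => (hR t ht).trans (by simp [pathPiece, pairPiece, hv])
    · exact hasSupport_tauFun_of_max_min_right (a := y 0) (b := y 1)
        (hmax 0 (by decide)) (hmax 1 (by decide))
        (fun t ht => (hL t ht).trans (tauFun_comm _ _ _ _)) hR
    · exact absurd rfl hnk
  equal S k α hS hk hα := by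
    have hα' : (α : ℝ) ≤ 1 := by exact_mod_cast hα
    have h1 : 0 ≤ (1 - (α : ℝ)) ^ 2 * α := by positivity
    have h2 : 0 ≤ (1 - (α : ℝ)) ^ 2 := by positivity
    rcases exists_eq_erase hS with rfl | ⟨j, rfl⟩
    · refine ⟨k + 1, by simp, by simp, ?_⟩
      fin_cases k <;>
        simp [pathPiece, pairPiece, cyclePiece, tauFun, indicatorState, afterEqual] <;> linarith
    · have hkj : k ≠ j ∧ (j = 1 → k = 0) ∧ (j = 2 → k = 3) := by
        refine ⟨Finset.ne_of_mem_erase (Finset.mem_filter.1 hk).1, ?_, ?_⟩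
        · rintro rfl; exact eq_zero_of_mem_leastParties hk
        · rintro rfl; exact eq_three_of_mem_leastParties hk
      clear hk
      refine ⟨if k + 1 = j then k + 2 else k + 1, ?_, ?_, ?_⟩
      · clear hS; revert k j; decide
      · clear hS; revert k j; decide
      · fin_cases j <;> fin_cases k <;> simp at hkj <;>
          simp [pathPiece, pairPiece, cyclePiece, tauFun, indicatorState, afterEqual] <;>
          linarith

/-! ### Configuration IV -/

/-- The expression `Γ` as a function of the components of the parties `n`, `n'`, `e₂`, `e₃`, if `n`
has three edges. -/
noncomputable def gammaFunThree (n n' e₂ e₃ : ℝ) : ℝ :=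
  2 * e₃ + (e₂ + n') * (2 - e₃ / n) - 2 * (n' * e₂ / n) + 4 / 3 * (e₂ * e₃ * n' / n ^ 2)

/-- The expression `Γ` as a function of the components of the parties `n`, `n'`, `e₃`, `e₂`, if `n`
has two edges. -/
noncomputable def gammaFunTwo (n n' e₃ e₂ : ℝ) : ℝ :=
  2 * n' + 2 * e₃ - n' * e₃ / n + e₂ * e₃ * n' / (3 * n ^ 2)

theorem gammaFunThree_comm (n n' e₂ e₃ : ℝ) :
    gammaFunThree n n' e₂ e₃ = gammaFunThree n e₂ n' e₃ := by
  unfold gammaFunThree; ring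

theorem gammaFunTwo_comm (n n' e₃ e₂ : ℝ) :
    gammaFunTwo n n' e₃ e₂ = gammaFunTwo n e₃ n' e₂ := by
  unfold gammaFunTwo; ring

theorem gammaFunThree_smul (s n n' e₂ e₃ : ℝ) :
    gammaFunThree (s * n) (s * n') (s * e₂) (s * e₃) = s * gammaFunThree n n' e₂ e₃ := by
  unfold gammaFunThree
  rcases eq_or_ne s 0 with h | h
  · simp [h]
  rcases eq_or_ne n 0 with h0 | h0
  · simp [h0]; ring
  · field_simp

theorem gammaFunTwo_smul (s n n' e₃ e₂ : ℝ) :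
    gammaFunTwo (s * n) (s * n') (s * e₃) (s * e₂) = s * gammaFunTwo n n' e₃ e₂ := by
  unfold gammaFunTwo
  rcases eq_or_ne s 0 with h | h
  · simp [h]
  rcases eq_or_ne n 0 with h0 | h0
  · simp [h0]; ring
  · field_simp

section

variable {n a b d : ℝ}

theorem mul_div_le_of_le (ha : 0 ≤ a) (hb : 0 ≤ b) (han : a ≤ n) : a * b / n ≤ b := by
  refine div_le_of_le_mul₀ (ha.trans han) hb ?_
  rw [mul_comm]; gcongr

theorem mul_mul_div_sq_le (ha : 0 ≤ a) (hb : 0 ≤ b) (hd : 0 ≤ d) (han : a ≤ n) (hbn : b ≤ n) :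
    a * b * d / n ^ 2 ≤ d := by
  refine div_le_of_le_mul₀ (by positivity) hd ?_
  rw [mul_comm, pow_two]
  have : 0 ≤ n := ha.trans han
  gcongr

theorem gammaFunThree_nonneg (ha : 0 ≤ a) (hb : 0 ≤ b) (hd : 0 ≤ d) (han : a ≤ n) (hbn : b ≤ n) :
    0 ≤ gammaFunThree n a b d := by
  have h1 := mul_div_le_of_le hb hd hbn
  have h2 := mul_div_le_of_le ha hd han
  have h3 := mul_div_le_of_le ha hb han
  have h4 := mul_div_le_of_le hb ha hbn
  have h5 : 0 ≤ 4 / 3 * (b * d * a / n ^ 2) := by positivity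
  have h6 : gammaFunThree n a b d = (d - b * d / n) + (d - a * d / n) + (b - a * b / n) +
      (a - b * a / n) + b + a + 4 / 3 * (b * d * a / n ^ 2) := by
    unfold gammaFunThree; ring
  rw [h6]
  linarith

theorem gammaFunTwo_nonneg (ha : 0 ≤ a) (hb : 0 ≤ b) (hd : 0 ≤ d) (han : a ≤ n) :
    0 ≤ gammaFunTwo n a b d := by
  have h1 := mul_div_le_of_le ha hb han
  have h2 : 0 ≤ d * b * a / (3 * n ^ 2) := by positivity
  unfold gammaFunTwo
  linarith

theorem gammaFunThree_le (ha : 0 ≤ a) (hb : 0 ≤ b) (hd : 0 ≤ d) (han : a ≤ n) (hbn : b ≤ n)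
    (hdn : d ≤ n) : gammaFunThree n a b d ≤ 3 * (a + b + d) := by
  have hn := ha.trans han
  have h1 : 0 ≤ (b + a) * (d / n) := by positivity
  have h2 : 0 ≤ a * b / n := by positivity
  have h3 := mul_mul_div_sq_le ha hb hd han hbn
  have h4 := mul_mul_div_sq_le hb hd ha hbn hdn
  have h5 : gammaFunThree n a b d = 2 * d + 2 * b + 2 * a - (b + a) * (d / n) - 2 * (a * b / n) +
      2 / 3 * (a * b * d / n ^ 2) + 2 / 3 * (b * d * a / n ^ 2) := by
    unfold gammaFunThree; ring
  linarith

theorem gammaFunTwo_le (ha : 0 ≤ a) (hb : 0 ≤ b) (hd : 0 ≤ d) (han : a ≤ n) (hbn : b ≤ n) :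
    gammaFunTwo n a b d ≤ 3 * (a + b + d) := by
  have hn := ha.trans han
  have h1 : 0 ≤ a * b / n := by positivity
  have h3 := mul_mul_div_sq_le ha hb hd han hbn
  have h5 : gammaFunTwo n a b d = 2 * a + 2 * b - a * b / n + 1 / 3 * (a * b * d / n ^ 2) := by
    unfold gammaFunTwo; ring
  linarith

end

theorem gammaFunThree_tie {n m : ℝ} (h : m = n) (a b : ℝ) :
    gammaFunThree n a b m = gammaFunThree m a b n := by
  rw [h]

theorem gammaFunThree_eq_two {n m c d : ℝ≥0} (h : m = n) (hc : c ≤ n) (hd : d ≤ n) :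
    gammaFunThree n m d c = gammaFunTwo m n c d := by
  subst h
  unfold gammaFunThree gammaFunTwo
  rcases eq_or_ne m 0 with rfl | h0
  · rw [nonpos_iff_eq_zero] at hc hd
    simp [hc, hd]
  · have h0' : (m : ℝ) ≠ 0 := by exact_mod_cast h0
    field_simp; ring

section

variable {φ : ℝ≥0 → ℝ} {N u v : ℝ≥0}

/-- The slope at `N` drops by `2(N - u)(N - v)/N²`, as it does in the two mixed cases. -/
theorem hasSupport_gamma_three_three (hu : u ≤ N) (hv : v ≤ N)
    (hL : ∀ t, t ≤ N → φ t = gammaFunThree N u v t)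
    (hR : ∀ t, N ≤ t → φ t = gammaFunThree t u v N) :
    HasSupport φ := by
  rcases eq_or_ne N 0 with rfl | hN
  · rw [nonpos_iff_eq_zero] at hu hv
    exact hasSupport_zero fun t => by
      rw [hR t zero_le, hu, hv]; simp [gammaFunThree]
  have hN' : (0 : ℝ) < N := by exact_mod_cast pos_iff_ne_zero.2 hN
  have hu' : (u : ℝ) ≤ N := by exact_mod_cast hu
  have hv' : (v : ℝ) ≤ N := by exact_mod_cast hv
  refine hasSupport_of_glue (pos_iff_ne_zero.2 hN) (A := 2 * (u + v) - 2 * (u * v / N))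
    (B := 2 - (u + v) / N + 4 / 3 * (u * v / N ^ 2)) (C := 2 * N + 2 * (u + v))
    (D := N * (u + v) + 2 * (u * v))
    (E := 4 / 3 * (N * u * v)) (by positivity) ?_ (fun t ht => ?_) (fun t ht => ?_) ?_
  · have h1 : (u * v * N : ℝ) ≤ u * N * N := by gcongr
    have h2 : (u * v * N : ℝ) ≤ N * v * N := by gcongr
    linarith
  · rw [hL t ht, gammaFunThree]; ring
  · rw [hR t ht, gammaFunThree]; ring
  · refine sub_nonneg.1 (le_of_le_of_eq (b := 2 * ((N - u) * (N - v) : ℝ) / N ^ 2) ?_ ?_)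
    · exact div_nonneg (mul_nonneg two_pos.le (mul_nonneg (sub_nonneg.2 hu') (sub_nonneg.2 hv')))
        (by positivity)
    · field_simp; ring

theorem hasSupport_gamma_two_three (hu : u ≤ N) (hv : v ≤ N)
    (hL : ∀ t, t ≤ N → φ t = gammaFunThree N t v u) (hR : ∀ t, N ≤ t → φ t = gammaFunTwo t N u v) :
    HasSupport φ := by
  rcases eq_or_ne N 0 with rfl | hN
  · rw [nonpos_iff_eq_zero] at hu hv
    exact hasSupport_zero fun t => by
      rw [hR t zero_le, hu, hv]; simp [gammaFunTwo]
  have hN' : (0 : ℝ) < N := by exact_mod_cast pos_iff_ne_zero.2 hN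
  have hu' : (u : ℝ) ≤ N := by exact_mod_cast hu
  have hv' : (v : ℝ) ≤ N := by exact_mod_cast hv
  refine hasSupport_of_glue (pos_iff_ne_zero.2 hN) (A := 2 * u + v * (2 - u / N))
    (B := 2 - u / N - 2 * (v / N) + 4 / 3 * (u * v / N ^ 2)) (C := 2 * N + 2 * u) (D := N * u)
    (E := u * v * N / 3) (by positivity) ?_ (fun t ht => ?_) (fun t ht => ?_) ?_
  · have h1 : (u * v * N : ℝ) ≤ u * N * N := by gcongr
    have h2 : (u * v * N : ℝ) ≤ N * v * N := by gcongr
    linarith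
  · rw [hL t ht, gammaFunThree]; ring
  · rw [hR t ht, gammaFunTwo]; ring
  · refine sub_nonneg.1 (le_of_le_of_eq (b := 2 * ((N - u) * (N - v) : ℝ) / N ^ 2) ?_ ?_)
    · exact div_nonneg (mul_nonneg two_pos.le (mul_nonneg (sub_nonneg.2 hu') (sub_nonneg.2 hv')))
        (by positivity)
    · field_simp; ring

theorem hasSupport_gamma_three_two (hu : u ≤ N) (hv : v ≤ N)
    (hL : ∀ t, t ≤ N → φ t = gammaFunTwo N t u v) (hR : ∀ t, N ≤ t → φ t = gammaFunThree t N v u) :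
    HasSupport φ := by
  rcases eq_or_ne N 0 with rfl | hN
  · rw [nonpos_iff_eq_zero] at hu hv
    exact hasSupport_zero fun t => by
      rw [hR t zero_le, hu, hv]; simp [gammaFunThree]
  have hN' : (0 : ℝ) < N := by exact_mod_cast pos_iff_ne_zero.2 hN
  have hu' : (u : ℝ) ≤ N := by exact_mod_cast hu
  have hv' : (v : ℝ) ≤ N := by exact_mod_cast hv
  refine hasSupport_of_glue (pos_iff_ne_zero.2 hN) (A := 2 * u)
    (B := 2 - u / N + u * v / (3 * N ^ 2)) (C := 2 * u + 2 * (v + N))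
    (D := u * (v + N) + 2 * (N * v))
    (E := 4 / 3 * (u * v * N)) (by positivity) ?_ (fun t ht => ?_) (fun t ht => ?_) ?_
  · have h1 : (u * v * N : ℝ) ≤ u * N * N := by gcongr
    have h2 : (u * v * N : ℝ) ≤ N * v * N := by gcongr
    linarith
  · rw [hL t ht, gammaFunTwo]; ring
  · rw [hR t ht, gammaFunThree]; ring
  · refine sub_nonneg.1 (le_of_le_of_eq (b := 2 * ((N - u) * (N - v) : ℝ) / N ^ 2) ?_ ?_)
    · exact div_nonneg (mul_nonneg two_pos.le (mul_nonneg (sub_nonneg.2 hu') (sub_nonneg.2 hv')))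
        (by positivity)
    · field_simp; ring

/-- The two parties of degree 2 are not joined, and the slopes match exactly at `N`. -/
theorem hasSupport_gamma_two_two (hu : u ≤ N) (hv : v ≤ N)
    (hL : ∀ t, t ≤ N → φ t = gammaFunTwo N u v t) (hR : ∀ t, N ≤ t → φ t = gammaFunTwo t u v N) :
    HasSupport φ := by
  rcases eq_or_ne N 0 with rfl | hN
  · rw [nonpos_iff_eq_zero] at hu hv
    exact hasSupport_zero fun t => by
      rw [hR t zero_le, hu, hv]; simp [gammaFunTwo]
  have hN' : (0 : ℝ) < N := by exact_mod_cast pos_iff_ne_zero.2 hN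
  have hu' : (u : ℝ) ≤ N := by exact_mod_cast hu
  have hv' : (v : ℝ) ≤ N := by exact_mod_cast hv
  refine hasSupport_of_glue (pos_iff_ne_zero.2 hN) (A := 2 * u + 2 * v - u * v / N)
    (B := u * v / (3 * N ^ 2)) (C := 2 * u + 2 * v) (D := u * v)
    (E := N * u * v / 3) (by positivity) ?_ (fun t ht => ?_) (fun t ht => ?_) ?_
  · have h1 : (u * v * N : ℝ) ≤ u * N * N := by gcongr
    have h2 : (u * v * N : ℝ) ≤ N * v * N := by gcongr
    linarith
  · rw [hL t ht, gammaFunTwo]; ring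
  · rw [hR t ht, gammaFunTwo]; ring
  · refine le_of_eq ?_
    field_simp; ring

end

/-- `Γ` on the complete graph without the edge `2 - 3`, if the component of party `n` is maximal. -/
noncomputable def gammaPiece : Fin 4 → (Fin 4 → ℝ≥0) → ℝ
  | 0, x => gammaFunThree (x 0) (x 2) (x 3) (x 1)
  | 1, x => gammaFunThree (x 1) (x 2) (x 3) (x 0)
  | 2, x => gammaFunTwo (x 2) (x 0) (x 1) (x 3)
  | 3, x => gammaFunTwo (x 3) (x 0) (x 1) (x 2)

theorem adj_configIV_iff (i j : Fin 4) : configIV.Adj i j ↔ i ≠ j ∧ (i < 2 ∨ j < 2) := by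
  unfold configIV
  fin_cases i <;> fin_cases j <;> simp

theorem gammaPieceSystem : PieceSystem configIV gammaPiece where
  tie y n m hn hm hlt := by
    have h0 := hn 0; have h1 := hn 1; have h2 := hn 2; have h3 := hn 3
    fin_cases n <;> fin_cases m <;> simp at hlt h0 h1 h2 h3 hm ⊢
    · exact gammaFunThree_tie (by rw [hm]) _ _
    · exact gammaFunThree_eq_two hm h1 h3
    · exact (gammaFunThree_comm _ _ _ _).trans (gammaFunThree_eq_two hm h1 h2)
    · exact (gammaFunThree_eq_two hm h0 h3).trans (gammaFunTwo_comm _ _ _ _)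
    · exact (gammaFunThree_comm _ _ _ _).trans
        ((gammaFunThree_eq_two hm h0 h2).trans (gammaFunTwo_comm _ _ _ _))
    · simp [gammaPiece, hm]
  smul s y n := by
    fin_cases n <;> simp [gammaPiece, gammaFunThree_smul, gammaFunTwo_smul]
  nonneg y n hn := by
    have h (j : Fin 4) := (y j).coe_nonneg
    fin_cases n
    exacts [gammaFunThree_nonneg (h _) (h _) (h _) (hn _) (hn _),
      gammaFunThree_nonneg (h _) (h _) (h _) (hn _) (hn _),
      gammaFunTwo_nonneg (h _) (h _) (h _) (hn _), gammaFunTwo_nonneg (h _) (h _) (h _) (hn _)]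
  single y n h := by
    fin_cases n <;> simp [gammaPiece, gammaFunThree, gammaFunTwo, h]
  le_sum y n hn := by
    have h (j : Fin 4) := (y j).coe_nonneg
    have h0 := h 0; have h1 := h 1; have h2 := h 2; have h3 := h 3
    rw [Fin.sum_univ_four]
    fin_cases n
    · refine (gammaFunThree_le (h _) (h _) (h _) (hn _) (hn _) (hn _)).trans ?_
      linarith
    · refine (gammaFunThree_le (h _) (h _) (h _) (hn _) (hn _) (hn _)).trans ?_
      linarith
    · refine (gammaFunTwo_le (h _) (h _) (h _) (hn _) (hn _)).trans ?_
      linarith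
    · refine (gammaFunTwo_le (h _) (h _) (h _) (hn _) (hn _)).trans ?_
      linarith
  edge y i j hij _ h := by
    rw [adj_configIV_iff] at hij
    have h0 := h 0; have h1 := h 1; have h2 := h 2; have h3 := h 3
    fin_cases i <;> fin_cases j <;> simp at hij h0 h1 h2 h3 ⊢ <;>
      simp [gammaPiece, gammaFunThree, gammaFunTwo, *] <;> ring
  isolated y n k hn hk := by
    simp only [adj_configIV_iff] at hk
    -- The only missing edge is `2 - 3`, so an isolated party can coexist with at most one other,
    -- not joined to it; the value is 0.
    left
    have h0 := hn 0; have h1 := hn 1; have h2 := hn 2; have h3 := hn 3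
    have k0 := hk 0; have k1 := hk 1; have k2 := hk 2; have k3 := hk 3
    fin_cases k <;> simp at k0 k1 k2 k3 <;> fin_cases n <;> simp at h0 h1 h2 h3 ⊢ <;>
      simp_all [gammaPiece, gammaFunThree, gammaFunTwo]
  affine y n k h := by
    rw [adj_configIV_iff] at h
    refine ⟨gammaPiece n (Function.update y k 0), gammaPiece n (Function.update y k 1) -
      gammaPiece n (Function.update y k 0), fun t => ?_⟩
    fin_cases k <;> fin_cases n <;> simp at h <;>
      simp [gammaPiece, gammaFunThree, gammaFunTwo] <;> ring
  disconnected y n n' k k' hn hn' h1 h2 h3 h4 h5 h6 h7 h8 := by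
    exfalso
    clear hn hn'
    simp only [adj_configIV_iff] at *
    revert n n' k k'
    decide
  support y k n hnk hmax φ hL hR := by
    fin_cases k <;> fin_cases n
    · exact absurd rfl hnk
    · exact hasSupport_gamma_three_three (u := y 2) (v := y 3)
        (hmax 2 (by decide)) (hmax 3 (by decide))
        hL hR
    · exact hasSupport_gamma_three_two (u := y 1) (v := y 3)
        (hmax 1 (by decide)) (hmax 3 (by decide))
        hL hR
    · exact hasSupport_gamma_three_two (u := y 1) (v := y 2)
        (hmax 1 (by decide)) (hmax 2 (by decide))
        hL (fun t ht => (hR t ht).trans (gammaFunThree_comm _ _ _ _))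
    · exact hasSupport_gamma_three_three (u := y 2) (v := y 3)
        (hmax 2 (by decide)) (hmax 3 (by decide))
        hL hR
    · exact absurd rfl hnk
    · exact hasSupport_gamma_three_two (u := y 0) (v := y 3)
        (hmax 0 (by decide)) (hmax 3 (by decide))
        (fun t ht => (hL t ht).trans (gammaFunTwo_comm _ _ _ _)) hR
    · exact hasSupport_gamma_three_two (u := y 0) (v := y 2)
        (hmax 0 (by decide)) (hmax 2 (by decide))
        (fun t ht => (hL t ht).trans (gammaFunTwo_comm _ _ _ _))
        (fun t ht => (hR t ht).trans (gammaFunThree_comm _ _ _ _))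
    · exact hasSupport_gamma_two_three (u := y 1) (v := y 3)
        (hmax 1 (by decide)) (hmax 3 (by decide))
        hL hR
    · exact hasSupport_gamma_two_three (u := y 0) (v := y 3)
        (hmax 0 (by decide)) (hmax 3 (by decide))
        hL (fun t ht => (hR t ht).trans (gammaFunTwo_comm _ _ _ _))
    · exact absurd rfl hnk
    · exact hasSupport_gamma_two_two (u := y 0) (v := y 1) (hmax 0 (by decide)) (hmax 1 (by decide))
        hL hR
    · exact hasSupport_gamma_two_three (u := y 1) (v := y 2)
        (hmax 1 (by decide)) (hmax 2 (by decide))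
        (fun t ht => (hL t ht).trans (gammaFunThree_comm _ _ _ _)) hR
    · exact hasSupport_gamma_two_three (u := y 0) (v := y 2)
        (hmax 0 (by decide)) (hmax 2 (by decide))
        (fun t ht => (hL t ht).trans (gammaFunThree_comm _ _ _ _))
        (fun t ht => (hR t ht).trans (gammaFunTwo_comm _ _ _ _))
    · exact hasSupport_gamma_two_two (u := y 0) (v := y 1) (hmax 0 (by decide)) (hmax 1 (by decide))
        hL hR
    · exact absurd rfl hnk
  equal S k α hS hk hα := by
    replace hk := (Finset.mem_filter.1 hk).1
    have hα' : (α : ℝ) ≤ 1 := by exact_mod_cast hα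
    have h1 : 0 ≤ (1 - (α : ℝ)) ^ 2 * α := by positivity
    have h2 : 0 ≤ (1 - (α : ℝ)) ^ 2 := by positivity
    rcases exists_eq_erase hS with rfl | ⟨j, rfl⟩
    · refine ⟨k + 1, by simp, by simp, ?_⟩
      fin_cases k <;>
        simp [gammaPiece, gammaFunThree, gammaFunTwo, indicatorState, afterEqual] <;> linarith
    · refine ⟨if k + 1 = j then k + 2 else k + 1, ?_, ?_, ?_⟩
      · clear hS; revert k j; decide
      · clear hS; revert k j; decide
      · fin_cases j <;> fin_cases k <;> simp at hk <;>
          simp [gammaPiece, gammaFunThree, gammaFunTwo, indicatorState, afterEqual] <;>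
          linarith

/-! ### Labellings -/

/-- The condition `largest` makes `x n'` the maximum over the two opposite parties; the neighbour of
`n` and the minimum are left for `p` and `p'`, in either order. -/
theorem TauLabelling.tau_eq_pairPiece {x : Fin 4 → ℝ≥0} {n n' p p' : Fin 4}
    (h : TauLabelling (SimpleGraph.fromEdgeSet {s(0, 1), s(2, 3)}) x n n' p p') :
    tau x n n' p p' = pairPiece n x := by
  obtain ⟨hd, -, hu, hl⟩ := h
  simp only [adj_pair_iff] at hu hl
  have l0 := hl 0; have l1 := hl 1; have l2 := hl 2; have l3 := hl 3
  fin_cases n <;> fin_cases n' <;> first | exact absurd hu (by decide) | skip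
  all_goals
    fin_cases p <;> fin_cases p' <;> first | exact absurd hd (by decide) | skip
  all_goals
    clear hl hd hu
    simp at l0 l1 l2 l3
    simp [tau, pairPiece, tauFun, *]
  all_goals ring

theorem TauLabelling.tau_eq_pathPiece {x : Fin 4 → ℝ≥0} {n n' p p' : Fin 4}
    (h : TauLabelling (SimpleGraph.fromEdgeSet {s(0, 1), s(1, 2), s(2, 3)}) x n n' p p') :
    tau x n n' p p' = pathPiece n x := by
  obtain ⟨hd, -, hu, hl⟩ := h
  simp only [adj_path_iff] at hu hl
  have l0 := hl 0; have l1 := hl 1; have l2 := hl 2; have l3 := hl 3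
  fin_cases n <;> fin_cases n' <;> first | exact absurd hu (by decide) | skip
  all_goals
    fin_cases p <;> fin_cases p' <;> first | exact absurd hd (by decide) | skip
  all_goals
    clear hl hd hu
    simp at l0 l1 l2 l3
    simp [tau, pathPiece, pairPiece, cyclePiece, tauFun, *]
  all_goals ring

theorem TauLabelling.tau_eq_cyclePiece {x : Fin 4 → ℝ≥0} {n n' p p' : Fin 4}
    (h : TauLabelling (SimpleGraph.fromEdgeSet {s(0, 1), s(1, 2), s(2, 3), s(0, 3)}) x n n' p p') :
    tau x n n' p p' = cyclePiece n x := by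
  obtain ⟨hd, -, hu, -⟩ := h
  simp only [adj_cycle_iff] at hu
  fin_cases n <;> fin_cases n' <;> first | exact absurd hu (by decide) | skip
  all_goals
    fin_cases p <;> fin_cases p' <;> first | exact absurd hd (by decide) | skip
  all_goals simp [tau, cyclePiece, tauFun]
  all_goals ring

theorem edgeCount_configIV (k : Fin 4) : edgeCount configIV k = if k < 2 then 3 else 2 := by
  have : configIV.neighborSet k = {j | k ≠ j ∧ (k < 2 ∨ j < 2)} := by
    ext j; exact adj_configIV_iff k j
  rw [edgeCount, this, Set.ncard_eq_toFinset_card']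
  clear this
  revert k; decide

theorem GammaLabelling.gammaValue_eq_gammaPiece {x : Fin 4 → ℝ≥0} {n n' e₂ e₃ : Fin 4}
    (h : GammaLabelling configIV x n n' e₂ e₃) :
    gammaValue configIV x n n' e₂ e₃ = gammaPiece n x := by
  obtain ⟨hd, -, hc, -, h2, h3⟩ := h
  simp only [edgeCount_configIV] at hc h2 h3
  fin_cases n <;> fin_cases n' <;> first | exact absurd hc (by decide) | skip
  all_goals
    fin_cases e₂ <;>
    first | exact absurd h2 (by decide) | skip
  all_goals
    fin_cases e₃ <;>
    first | exact absurd h3 (by decide) | exact absurd hd (by decide) | skip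
  all_goals
    simp [gammaValue, edgeCount_configIV, gammaPiece, gammaFunThree, gammaFunTwo]
  all_goals ring

/-! ### Assembly for the four-party configurations -/

namespace PieceSystem

variable {G : SimpleGraph (Fin 4)} {piece : Fin 4 → (Fin 4 → ℝ≥0) → ℝ}

theorem optimalProb_le (h : PieceSystem G piece) {x : Fin 4 → ℝ≥0} {n : Fin 4}
    (hn : ∀ k, x k ≤ x n) : optimalProb G x ≤ ENNReal.ofReal (piece n x) := by
  rw [← h.maxGlue_eq hn]
  exact h.isUpperPotential.optimalProb_le x

theorem optimalProb_eq (h : PieceSystem G piece) {x : Fin 4 → ℝ≥0} {n : Fin 4}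
    (hn : ∀ k, x k ≤ x n) (hx : ∑ i, x i = 1) :
    optimalProb G x = ENNReal.ofReal (piece n x) := by
  rw [← h.maxGlue_eq hn]
  exact RandomDistillation.optimalProb_eq h.isUpperPotential h.isLowerPotential hx

theorem exists_forall_lt_lpoProb (h : PieceSystem G piece) {x : Fin 4 → ℝ≥0} {n : Fin 4}
    (hn : ∀ k, x k ≤ x n) (hx : ∑ i, x i = 1) (c : ChoiceRule 4) {ε : ℝ≥0} (hε : 0 < ε) :
    ∃ δ : ℝ≥0, 0 < δ ∧ ∀ α : Finset (Fin 4) → Set.Iio (1 : ℝ≥0),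
      (∀ S, 1 ≤ (α S : ℝ≥0) + δ) → ENNReal.ofReal (piece n x) < lpoProb G c α x + ε := by
  rw [← h.maxGlue_eq hn]
  exact h.isLowerPotential.exists_forall_lt_lpoProb c x (by norm_num) hx hε

theorem optimalProb_standardW (h : PieceSystem G piece) :
    optimalProb G (standardW 4) = ENNReal.ofReal (piece 0 (standardW 4)) :=
  h.optimalProb_eq (fun _ => le_rfl) (by simp [standardW])

end PieceSystem

theorem configIII_of_pieceSystem {G : SimpleGraph (Fin 4)} {piece : Fin 4 → (Fin 4 → ℝ≥0) → ℝ}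
    (h : PieceSystem G piece)
    (htau : ∀ {x n n' p p'}, TauLabelling G x n n' p p' → tau x n n' p p' = piece n x)
    (hW : piece 0 (standardW 4) = 2 / 3) :
    (∀ (x : Fin 4 → ℝ≥0) (n n' p p' : Fin 4), ∑ i, x i ≤ 1 → TauLabelling G x n n' p p' →
      optimalProb G x ≤ ENNReal.ofReal (tau x n n' p p')) ∧
    (∀ (x : Fin 4 → ℝ≥0) (n n' p p' : Fin 4), ∑ i, x i = 1 → TauLabelling G x n n' p p' →
      (∀ (c : ChoiceRule 4) (ε : ℝ≥0), 0 < ε → ∃ δ : ℝ≥0, 0 < δ ∧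
        ∀ α : Finset (Fin 4) → Set.Iio (1 : ℝ≥0), (∀ S, 1 ≤ (α S : ℝ≥0) + δ) →
          ENNReal.ofReal (tau x n n' p p') < lpoProb G c α x + ε) ∧
      optimalProb G x = ENNReal.ofReal (tau x n n' p p')) ∧
    optimalProb G (standardW 4) = 2 / 3 := by
  refine ⟨fun x n n' p p' _ hl => ?_, fun x n n' p p' hx hl => ⟨fun c ε hε => ?_, ?_⟩, ?_⟩
  · rw [htau hl]; exact h.optimalProb_le hl.maximal
  · rw [htau hl]; exact h.exists_forall_lt_lpoProb hl.maximal hx c hε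
  · rw [htau hl]; exact h.optimalProb_eq hl.maximal hx
  · rw [h.optimalProb_standardW, hW, ENNReal.ofReal_div_of_pos (by norm_num)]; simp

theorem lt_add_and_le_of_eq {a b : ℝ≥0∞} (h : a = b) (hb : b ≠ ⊤) {ε : ℝ≥0} (hε : 0 < ε) :
    b < a + ε ∧ a ≤ b := by
  subst h
  exact ⟨ENNReal.lt_add_right hb (by simpa using hε.ne'), le_rfl⟩

end RandomDistillation

theorem mainTheorem3 :
    (∀ G ∈ configIII,
      (∀ (x : Fin 4 → NNReal) (n n' p p' : Fin 4), ∑ i, x i ≤ 1 → TauLabelling G x n n' p p' →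
        optimalProb G x ≤ ENNReal.ofReal (tau x n n' p p')) ∧
      (∀ (x : Fin 4 → NNReal) (n n' p p' : Fin 4), ∑ i, x i = 1 → TauLabelling G x n n' p p' →
        (∀ (c : ChoiceRule 4) (ε : NNReal), 0 < ε → ∃ δ : NNReal, 0 < δ ∧
          ∀ α : Finset (Fin 4) → Set.Iio (1 : NNReal), (∀ S, 1 ≤ (α S : NNReal) + δ) →
            ENNReal.ofReal (tau x n n' p p') < lpoProb G c α x + ε) ∧
        optimalProb G x = ENNReal.ofReal (tau x n n' p p')) ∧
      (∀ ε : NNReal, 0 < ε →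
        (2 / 3 : ENNReal) < optimalProb G (standardW 4) + ε ∧
        optimalProb G (standardW 4) ≤ 2 / 3)) ∧
    (∀ (x : Fin 4 → NNReal) (n n' e₂ e₃ : Fin 4), ∑ i, x i ≤ 1 →
      GammaLabelling configIV x n n' e₂ e₃ →
      optimalProb configIV x ≤ ENNReal.ofReal (gammaValue configIV x n n' e₂ e₃)) ∧
    (∀ (x : Fin 4 → NNReal) (n n' e₂ e₃ : Fin 4), ∑ i, x i = 1 →
      GammaLabelling configIV x n n' e₂ e₃ →
      (∀ (c : ChoiceRule 4) (ε : NNReal), 0 < ε → ∃ δ : NNReal, 0 < δ ∧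
        ∀ α : Finset (Fin 4) → Set.Iio (1 : NNReal), (∀ S, 1 ≤ (α S : NNReal) + δ) →
          ENNReal.ofReal (gammaValue configIV x n n' e₂ e₃) < lpoProb configIV c α x + ε) ∧
      optimalProb configIV x = ENNReal.ofReal (gammaValue configIV x n n' e₂ e₃)) ∧
    (∀ ε : NNReal, 0 < ε →
      (5 / 6 : ENNReal) < optimalProb configIV (standardW 4) + ε ∧
      optimalProb configIV (standardW 4) ≤ 5 / 6) := by
  refine ⟨fun G hG => ?_, fun x n n' e₂ e₃ _ hl => ?_, fun x n n' e₂ e₃ hx hl =>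
    ⟨fun c ε hε => ?_, ?_⟩, fun ε hε => ?_⟩
  · suffices h : ∃ piece, PieceSystem G piece ∧
        (∀ {x n n' p p'}, TauLabelling G x n n' p p' → tau x n n' p p' = piece n x) ∧
        piece 0 (standardW 4) = 2 / 3 by
      obtain ⟨piece, h1, h2, h3⟩ := h
      obtain ⟨hle, heq, hW⟩ := configIII_of_pieceSystem h1 h2 h3
      exact ⟨hle, heq, fun ε hε => lt_add_and_le_of_eq hW
        (ENNReal.div_ne_top (by simp) (by simp)) hε⟩
    rcases hG with rfl | rfl | rfl
    · exact ⟨_, pairPieceSystem, TauLabelling.tau_eq_pairPiece, by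
        norm_num [pairPiece, tauFun, standardW]⟩
    · exact ⟨_, pathPieceSystem, TauLabelling.tau_eq_pathPiece, by
        norm_num [pathPiece, pairPiece, tauFun, standardW]⟩
    · exact ⟨_, cyclePieceSystem, TauLabelling.tau_eq_cyclePiece, by
        norm_num [cyclePiece, tauFun, standardW]⟩
  · rw [hl.gammaValue_eq_gammaPiece]; exact gammaPieceSystem.optimalProb_le hl.maximal
  · rw [hl.gammaValue_eq_gammaPiece]
    exact gammaPieceSystem.exists_forall_lt_lpoProb hl.maximal hx c hε
  · rw [hl.gammaValue_eq_gammaPiece]; exact gammaPieceSystem.optimalProb_eq hl.maximal hx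
  · have hW : gammaPiece 0 (standardW 4) = 5 / 6 := by
      norm_num [gammaPiece, gammaFunThree, standardW]
    refine lt_add_and_le_of_eq ?_ (ENNReal.div_ne_top (by simp) (by simp)) hε
    rw [gammaPieceSystem.optimalProb_standardW, hW, ENNReal.ofReal_div_of_pos (by norm_num)]
    simp
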